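/- Let $g\ge 1$. Let $\mathcal L=\partial_x^2-u$, and let $A_k$ ($k\ge 0$) be the unique anti-symmetric ordinary differential operator of order $2k+1$ with leading coefficient $1$, whose coefficients are differential polynomials in $u$, which is homogeneous of degree $2k+1$ (where $\deg\partial_x=1$, $\deg u^{(n)}=n+2$) and for which $[\mathcal L,A_k]$ is the operator of multiplication by a differential polynomial $r_k[u]$ (so $r_0=u'$, $r_1=\frac14(u'''-6uu')$). Let $\mathbf R_g$ be the space of pairs $(u,a)$, where $a=(a_0,\dots,a_{g-2})\in\mathbb C^{g-1}$ and $u$ is the germ at $x=0$ of a holomorphic function satisfying the stationary $g$-KdV equation $$r_g[u]+\sum_{k=0}^{g-2}a_k\,r_k[u]=0 .$$ For $\mu=(\mu_1,\dots,\mu_{2g})\in\mathcal M_g=\mathbb C^{2g}$ put $\mu(\xi)=4\xi^{-1}+\sum_{i=1}^{2g}\mu_i\xi^i$ and let $\Gamma_\mu=\{(\xi,y)\in\mathbb C^2:\ \xi\ne0,\ y^2=4\mu(\xi)\}$ be the corresponding hyperelliptic curve. Let $\mathfrak U_g=\{(\mu,D):\mu\in\mathcal M_g,\ D\in \mathrm{Sym}^g\,\Gamma_\mu\}$,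 with projection $\pi_{\mathfrak U}(\mu,D)=\mu$; it is the quotient by the symmetric group $S_g$ of the affine variety of tuples $(\mu,(\xi_1,y_1),\dots,(\xi_g,y_g))$ with $(\xi_i,y_i)\in\Gamma_\mu$. Theorem. (1) The coordinates $c_k=u^{(k)}(0)$ ($0\le k\le 2g$) and $a_0,\dots,a_{g-2}$ define a bijection $\mathbf R_g\to\mathbb C^{3g}$; by it $\mathbf R_g$ is regarded as an affine space. (2) For every $(u,a)\in\mathbf R_g$ there are unique germs of holomorphic functions $u_1,\dots,u_g$ at $0$ and unique constants $\mu_1,\dots,\mu_{2g}$ such that $u_1=u$, such that $$\mu_k=8a_{g-k-1}+4\sum_{i=1}^{k-2}a_{g-i-1}a_{g-k+i}\qquad(1\le k\le g-1),$$ and such that the generating function $\mathbf u(x,\xi)=\sum_{i=1}^g u_i(x)\xi^i$ satisfies, for $x$ near $0$ and all $\xi\neq 0$ (prime denoting $\partial_x$), $$4\mu(\xi)=\mathbf u'(\xi)^2+2\,\mathbf u''(\xi)\,(2-\mathbf u(\xi))+4(\xi^{-1}+u_1)(2-\mathbf u(\xi))^2 .$$ Thus there is a canonical map $\pi_{\mathcal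 M}:\mathbf R_g\to\mathcal M_g$, $(u,a)\mapsto\mu$. (3) If $u_g(0)\ne0$, let $\xi_1,\dots,\xi_g$ be the roots, with multiplicities, of $2-\mathbf u(0,\xi)=0$, and let $y_i=\mathbf u'(0,\xi_i)$. Then $(\xi_i,y_i)\in\Gamma_\mu$, so that $\upsilon(u,a)=(\mu,[(\xi_1,y_1),\dots,(\xi_g,y_g)])\in\mathfrak U_g$ is well defined. (4) The map $\upsilon$ is a fiber-preserving birational equivalence $\mathbf R_g\to\mathfrak U_g$: it is defined on, and restricts to an isomorphism of varieties from, some Zariski open dense subset of $\mathbf R_g$ onto a Zariski open dense subset of $\mathfrak U_g$, and $\pi_{\mathfrak U}\circ\upsilon=\pi_{\mathcal M}$ there. -/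

import Mathlib

open Filter Topology

noncomputable section

namespace KdV

/-! ### Differential polynomials, differential operators, and the KdV hierarchy -/

/-- Differential polynomials over `ℂ` in one function `u`; the variable `X n` is `u⁽ⁿ⁾`. -/
abbrev DiffPoly : Type := MvPolynomial ℕ ℂ

/-- The total derivative `∂ₓ`, i.e. the derivation with `∂ₓ u⁽ⁿ⁾ = u⁽ⁿ⁺¹⁾`. -/
def dx : Derivation ℂ DiffPoly DiffPoly :=
  MvPolynomial.mkDerivation ℂ fun n => MvPolynomial.X (n + 1)

/-- `∂ₓ` as an operator. -/
def dOp : Module.End ℂ DiffPoly := dx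

/-- The operator of multiplication by `f`. -/
def mulOp (f : DiffPoly) : Module.End ℂ DiffPoly := LinearMap.mulLeft ℂ f

/-- The operator `∑ fᵢ ∂ₓⁱ` with coefficients `fᵢ = A.coeff i`. It is a faithful representation:
the coefficients can be recovered from the action on `u⁽ⁿ⁾`, `n = 0, 1, 2, …`. -/
def toOp (A : Polynomial DiffPoly) : Module.End ℂ DiffPoly :=
  A.sum fun i f => mulOp f * dOp ^ i

/-- The formal conjugate `∑ (-∂ₓ)ⁱ fᵢ` of `∑ fᵢ ∂ₓⁱ`. -/
def conjOp (A : Polynomial DiffPoly) : Module.End ℂ DiffPoly :=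
  A.sum fun i f => (-dOp) ^ i * mulOp f

/-- The Schrödinger operator `ℒ = ∂ₓ² - u`. -/
def schrodinger : Module.End ℂ DiffPoly := dOp ^ 2 - mulOp (MvPolynomial.X 0)

/-- `A` is the operator `A_k` of the KdV hierarchy: it is anti-symmetric, of order `2k+1` with
leading coefficient `1`, homogeneous of degree `2k+1` for `deg ∂ₓ = 1`, `deg u⁽ⁿ⁾ = n + 2`,
and its commutator with `ℒ` is a multiplication operator. -/
structure IsLaxOperator (k : ℕ) (A : Polynomial DiffPoly) : Prop where
  monic : A.Monic
  order_eq : A.natDegree = 2 * k + 1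
  homogeneous : ∀ i ≤ 2 * k + 1,
    MvPolynomial.IsWeightedHomogeneous (fun n : ℕ => n + 2) (A.coeff i) (2 * k + 1 - i)
  antisymm : conjOp A = -toOp A
  commutator : ∃ f : DiffPoly, ⁅schrodinger, toOp A⁆ = mulOp f

/-- `r` is the right-hand side `r_k[u]` of the `k`-th KdV equation: multiplication by `r` is the
commutator `[ℒ, A_k]` (with this sign, `r₀ = u'` and `r₁ = (u''' - 6 u u') / 4`).
The operator `A_k`, hence also `r`, is uniquely determined by `k`. -/
def IsKdVFlow (k : ℕ) (r : DiffPoly) : Prop :=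
  ∃ A, IsLaxOperator k A ∧ ⁅schrodinger, toOp A⁆ = mulOp r

/-- The value at the point `x` of a differential polynomial in the function `f`. -/
def evalJet (f : ℂ → ℂ) (x : ℂ) (p : DiffPoly) : ℂ :=
  MvPolynomial.eval (fun n => iteratedDeriv n f x) p

/-- The function `f` satisfies near `0` the stationary `g`-KdV (Novikov) equation
`r_g[f] + ∑_{k=0}^{g-2} a_k r_k[f] = 0`. -/
def SolvesStationaryKdV (g : ℕ) (a : Fin (g - 1) → ℂ) (f : ℂ → ℂ) : Prop :=
  ∃ r : ℕ → DiffPoly, (∀ k, IsKdVFlow k (r k)) ∧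
    ∀ᶠ x in 𝓝 (0 : ℂ), evalJet f x (r g) + ∑ k : Fin (g - 1), a k * evalJet f x (r k) = 0

/-- The space `𝐑_g` of solutions, regular (holomorphic) at `0`, of all stationary `g`-KdV
equations: pairs of a germ `u` at `0` and the constants `a₀, …, a_{g-2}` of an equation that
`u` satisfies. -/
structure SolutionSpace (g : ℕ) where
  /-- the germ at `0` of the solution -/
  u : Germ (𝓝 (0 : ℂ)) ℂ
  /-- the constants of the equation -/
  a : Fin (g - 1) → ℂ
  regular : ∃ f : ℂ → ℂ, (f : Germ (𝓝 (0 : ℂ)) ℂ) = u ∧ AnalyticAt ℂ f 0 ∧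
    SolvesStationaryKdV g a f

/-- The derivative `u⁽ᵏ⁾(0)` of a germ at `0`. -/
def germDeriv (k : ℕ) (u : Germ (𝓝 (0 : ℂ)) ℂ) : ℂ :=
  Germ.liftOn u (fun f => iteratedDeriv k f 0) fun _ _ h => h.iteratedDeriv_eq k

/-- The coordinates `(c₀, …, c_{2g}, a₀, …, a_{g-2})` on `𝐑_g`, where `c_k = u⁽ᵏ⁾(0)`. -/
def SolutionSpace.coords {g : ℕ} (s : SolutionSpace g) : Fin (2 * g + 1) ⊕ Fin (g - 1) → ℂ :=
  Sum.elim (fun k => germDeriv k s.u) s.a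

/-! ### Hyperelliptic curves and their symmetric powers -/

/-- The parameter space `ℳ_g` of the curves; the entry with index `i` is `μ_{i+1}`. -/
abbrev CurveSpace (g : ℕ) : Type := Fin (2 * g) → ℂ

/-- `μ(ξ) = 4 ξ⁻¹ + ∑_{i=1}^{2g} μ_i ξⁱ`, for `ξ ≠ 0`. -/
def muFun {g : ℕ} (μ : CurveSpace g) (ξ : ℂ) : ℂ :=
  4 * ξ⁻¹ + ∑ i : Fin (2 * g), μ i * ξ ^ ((i : ℕ) + 1)

/-- The curve `Γ = {(ξ, y) | y² = 4 μ(ξ)}`, on which `ξ ≠ 0` because of the term `4 ξ⁻¹`. -/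
def Curve {g : ℕ} (μ : CurveSpace g) : Type :=
  {p : ℂ × ℂ // p.1 ≠ 0 ∧ p.2 ^ 2 = 4 * muFun μ p.1}

/-- The `ξ`-coordinate of a point of `Γ`. -/
def Curve.xi {g : ℕ} {μ : CurveSpace g} (p : Curve μ) : ℂ := p.1.1

/-- The `y`-coordinate of a point of `Γ`. -/
def Curve.y {g : ℕ} {μ : CurveSpace g} (p : Curve μ) : ℂ := p.1.2

/-- The universal family `𝔘_g` of `g`-th symmetric powers of the curves `Γ`. -/
def SymFamily (g : ℕ) : Type := Σ μ : CurveSpace g, Sym (Curve μ) g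

/-- The projection `𝔘_g → ℳ_g`. -/
def SymFamily.proj {g : ℕ} (t : SymFamily g) : CurveSpace g := t.1

/-- The family of `g`-th cartesian powers of the curves `Γ`. -/
def PowerFamily (g : ℕ) : Type := Σ μ : CurveSpace g, (Fin g → Curve μ)

/-- The coordinates `μ_i`, `ξ_i`, `y_i` on the family of cartesian powers. -/
def PowerFamily.coords {g : ℕ} (w : PowerFamily g) : Fin (2 * g) ⊕ Fin g ⊕ Fin g → ℂ :=
  Sum.elim w.1 (Sum.elim (fun i => (w.2 i).xi) fun i => (w.2 i).y)

/-- The quotient map by the symmetric group, from cartesian to symmetric powers. -/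
def PowerFamily.toSym {g : ℕ} (w : PowerFamily g) : SymFamily g :=
  ⟨w.1, ⟨Multiset.map w.2 Finset.univ.val, by simp⟩⟩

/-! ### Birational equivalences of (classical) affine varieties over `ℂ`

A variety is given by its set of points `X` and its coordinate ring `A`, an algebra of
functions on `X`. -/

/-- Polynomial functions in given coordinates. -/
def polyFunctions {X ι : Type} (coords : X → ι → ℂ) : Subalgebra ℂ (X → ℂ) :=
  (MvPolynomial.aeval fun (i : ι) (x : X) => coords x i).range

/-- The coordinate ring of `𝐑_g`: polynomials in `c₀, …, c_{2g}, a₀, …, a_{g-2}`. -/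
def SolutionSpace.coordRing (g : ℕ) : Subalgebra ℂ (SolutionSpace g → ℂ) :=
  polyFunctions SolutionSpace.coords

/-- The coordinate ring of the quotient variety `𝔘_g`: functions whose pullback to the family of
cartesian powers is a polynomial in `μ_i`, `ξ_i`, `y_i`. -/
def SymFamily.coordRing (g : ℕ) : Subalgebra ℂ (SymFamily g → ℂ) :=
  (polyFunctions (PowerFamily.coords (g := g))).comap
    (AlgHom.pi fun w : PowerFamily g => Pi.evalAlgHom ℂ (fun _ : SymFamily g => ℂ) w.toSym)

/-- Zariski open sets: complements of common zero sets of elements of the coordinate ring. -/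
def IsZariskiOpen {X : Type} (A : Subalgebra ℂ (X → ℂ)) (U : Set X) : Prop :=
  ∃ S : Set (X → ℂ), S ⊆ A ∧ U = {x | ∃ f ∈ S, f x ≠ 0}

/-- Zariski dense sets: they meet every nonempty Zariski open set. -/
def IsZariskiDense {X : Type} (A : Subalgebra ℂ (X → ℂ)) (U : Set X) : Prop :=
  ∀ V : Set X, IsZariskiOpen A V → V.Nonempty → (U ∩ V).Nonempty

/-- Regular functions on a Zariski open set `U`: locally quotients of elements of the
coordinate ring. -/
def IsRegularOn {X : Type} (A : Subalgebra ℂ (X → ℂ)) (U : Set X) (f : X → ℂ) : Prop :=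
  ∀ x ∈ U, ∃ p ∈ A, ∃ q ∈ A, q x ≠ 0 ∧ ∀ z ∈ U, q z ≠ 0 → f z = p z / q z

/-- A birational equivalence: an isomorphism of varieties from a dense Zariski open set `source`
onto a dense Zariski open set `target`. -/
structure BirationalEquiv {X Y : Type} (A : Subalgebra ℂ (X → ℂ)) (B : Subalgebra ℂ (Y → ℂ))
    extends PartialEquiv X Y where
  open_source : IsZariskiOpen A source
  dense_source : IsZariskiDense A source
  open_target : IsZariskiOpen B target
  dense_target : IsZariskiDense B target
  regular_toFun : ∀ f ∈ B, IsRegularOn A source (f ∘ toFun)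
  regular_invFun : ∀ f ∈ A, IsRegularOn B target (f ∘ invFun)

/-! ### The curve and the points associated with a solution -/

/-- The generating function `𝐮(x, ξ) = ∑_{i=1}^g u_i(x) ξⁱ`. -/
def genFun (g : ℕ) (U : ℕ → ℂ → ℂ) (x ξ : ℂ) : ℂ :=
  ∑ i ∈ Finset.Icc 1 g, U i x * ξ ^ i

/-- The constants `a_k`, with `a_k = 0` for `k ≥ g - 1`. -/
def SolutionSpace.aExt {g : ℕ} (s : SolutionSpace g) (k : ℕ) : ℂ :=
  if h : k < g - 1 then s.a ⟨k, h⟩ else 0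

/-- The functions `u₁, …, u_g` (holomorphic at `0`) and the constants `μ₁, …, μ_{2g}` are the
ones that belong to the solution `s = (u, a)`: one has `u₁ = u`,
`μ_k = 8 a_{g-k-1} + 4 ∑_{i=1}^{k-2} a_{g-i-1} a_{g-k+i}` for `1 ≤ k ≤ g - 1`, and
`4 μ(ξ) = 𝐮'(ξ)² + 2 𝐮''(ξ) (2 - 𝐮(ξ)) + 4 (ξ⁻¹ + u₁) (2 - 𝐮(ξ))²`,
where the prime is the derivative in `x`. -/
structure IsAssociated {g : ℕ} (s : SolutionSpace g) (U : ℕ → ℂ → ℂ) (μ : CurveSpace g) :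
    Prop where
  analytic : ∀ i ∈ Finset.Icc 1 g, AnalyticAt ℂ (U i) 0
  first : (U 1 : Germ (𝓝 (0 : ℂ)) ℂ) = s.u
  constants : ∀ (k : ℕ) (i : Fin (2 * g)), (i : ℕ) + 1 = k → k ≤ g - 1 →
    μ i = 8 * s.aExt (g - k - 1) +
      4 * ∑ j ∈ Finset.Icc 1 (k - 2), s.aExt (g - j - 1) * s.aExt (g - k + j)
  equation : ∀ᶠ x in 𝓝 (0 : ℂ), ∀ ξ : ℂ, ξ ≠ 0 →
    4 * muFun μ ξ =
      genFun g (fun i => deriv (U i)) x ξ ^ 2 +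
      2 * genFun g (fun i => deriv (deriv (U i))) x ξ * (2 - genFun g U x ξ) +
      4 * (ξ⁻¹ + U 1 x) * (2 - genFun g U x ξ) ^ 2

/-- The polynomial `2 - 𝐮(0, ξ)` in `ξ`. -/
def rootPoly (g : ℕ) (U : ℕ → ℂ → ℂ) : Polynomial ℂ :=
  Polynomial.C 2 - ∑ i ∈ Finset.Icc 1 g, Polynomial.monomial i (U i 0)

/-- The point `t` of `𝔘_g` is `υ(s) = (Γ, [(ξ₁, y₁), …, (ξ_g, y_g)])`: the curve `Γ` is the one
associated with `s`, `ξ₁, …, ξ_g` are the roots (with multiplicities) of `2 - 𝐮(0, ξ)`, and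
`y_i = 𝐮'(0, ξ_i)`. In particular `2 - 𝐮(0, ξ)` has degree `g`. -/
def IsUpsilon {g : ℕ} (s : SolutionSpace g) (t : SymFamily g) : Prop :=
  ∃ U : ℕ → ℂ → ℂ, IsAssociated s U t.1 ∧
    Multiset.map Curve.xi (t.2 : Multiset (Curve t.1)) = (rootPoly g U).roots ∧
    ∀ p ∈ (t.2 : Multiset (Curve t.1)), p.y = genFun g (fun i => deriv (U i)) 0 p.xi

end KdV

end

noncomputable section

namespace KdV

/-! Everything rests on one quadratic form. For a series `F` in `ξ` with coefficients depending on
`x`, put `Q(F) = ξ (F'² - 2 F F'' + 4 u F²) + 4 F²` (`quad`). Then `∂ₓ Q(F) = 2 F Λ(F)`, where `Λ`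
is the Lenard operator (`lenard`, `dxSeries_quad`). The solution `R = 1 + R₁ ξ + …` of `Q(R) = 4`
has differential polynomials as coefficients, `Λ(R) = 0` is the Lenard recursion, and this recursion
produces operators with `[ℒ, A_k] = -2 R_{k+1}'` (`lie_laxOp`). Homogeneity makes `A_k` unique, so
`r_k = -2 R_{k+1}'` (`IsKdVFlow.eq`). The stationary equation therefore reads `∂ₓ (R_{g+1} + ∑ a_k
R_{k+1}) = 0`. As `R_{g+1}` is a nonzero multiple of `u⁽²ᵍ⁾` plus terms of lower order, the equation
can be solved polynomially for `u⁽²ᵍ⁺¹⁾`, and (1) is local existence and uniqueness for holomorphic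
differential equations (`exists_analytic_flow`).

The constants are packed into `φ = 1 + a_{g-2} ξ² + … + a₀ ξᵍ`. The series `2 φ R` satisfies `Q = 16
φ²` and `Λ = 0`, and its coefficient at `ξᵍ⁺¹` is twice the polynomial differentiated in the
stationary equation. So its truncation `F = 2 - 𝐮` at `ξᵍ` satisfies `Λ(F) = 0` exactly when `u` is
a solution. Then `Q(F)` is independent of `x`; being a polynomial in `ξ` of degree at most `2g + 1`
it is `4 ξ μ(ξ)`, and it agrees with `16 φ²` up to `ξᵍ`. Conversely, `Q(F)` up to `ξᵍ` determines
`F` recursively from its constant term `2`; this is the uniqueness in (2). Evaluating `Q(F) = 4 ξ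
μ(ξ)` at a root of `F` gives (3).

To invert `υ`, take points with distinct `ξᵢ`: the roots give `F`, interpolation gives `F'`, and
division in `Q(F) = 4 ξ μ(ξ)` gives `F''` (`exists_quadPoly_eq`). These are initial values for `Λ(F)
= 0`, a polynomial vector field in `u_j, u_j', u_j''`. Its solution preserves `Q(F)`, and the square
root of the curve polynomial supplies the `a_k` (`exists_isAssociated_of_lenard`). All of this is
rational in the points, with powers of the discriminant as denominators (`coords_mem_pairRing`). In
the other direction, symmetric functions of the roots are polynomials in the coefficients of `F` and
`1 / u_g(0)` (`comp_upsilon_mem`). Hence `υ` is an isomorphism from the set where `u_g(0) ≠ 0` and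
the roots are distinct onto the set of distinct `ξᵢ`; both sets are open and dense. -/

/-! ### Differential polynomials of bounded order -/

/-- The differential polynomials of order less than `N`. -/
def jets (N : ℕ) : Subalgebra ℂ DiffPoly := MvPolynomial.supported ℂ {m | m < N}

lemma jets_mono {M N : ℕ} (h : M ≤ N) : jets M ≤ jets N :=
  MvPolynomial.supported_mono fun _ hm => lt_of_lt_of_le hm h

lemma X_mem_jets {n N : ℕ} (h : n < N) : (MvPolynomial.X n : DiffPoly) ∈ jets N :=
  MvPolynomial.X_mem_supported.2 h

lemma C_mem_jets (c : ℂ) (N : ℕ) : (MvPolynomial.C c : DiffPoly) ∈ jets N :=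
  (jets N).algebraMap_mem c

lemma exists_mem_jets (p : DiffPoly) : ∃ N, p ∈ jets N :=
  ⟨p.vars.sup id + 1, MvPolynomial.mem_supported.2 fun _ hm =>
    Nat.lt_succ_of_le (Finset.le_sup (f := id) hm)⟩

lemma jets_induction {N : ℕ} {P : DiffPoly → Prop} (hC : ∀ c, P (MvPolynomial.C c))
    (hX : ∀ n < N, P (MvPolynomial.X n)) (hadd : ∀ p q, P p → P q → P (p + q))
    (hmul : ∀ p q, P p → P q → P (p * q)) {p : DiffPoly} (hp : p ∈ jets N) : P p := by
  refine Algebra.adjoin_induction (p := fun x _ => P x) ?_ hC (fun x y _ _ => hadd x y)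
    (fun x y _ _ => hmul x y) hp
  rintro _ ⟨n, hn, rfl⟩
  exact hX n hn

@[simp] lemma dx_X (n : ℕ) : dx (MvPolynomial.X n) = MvPolynomial.X (n + 1) :=
  MvPolynomial.mkDerivation_X _ _ _

@[simp] lemma dx_C (c : ℂ) : dx (MvPolynomial.C c) = 0 := MvPolynomial.derivation_C _ _

lemma dx_mul (p q : DiffPoly) : dx (p * q) = p * dx q + q * dx p := by
  simp [Derivation.leibniz]

lemma dx_mem_jets {N : ℕ} {p : DiffPoly} (hp : p ∈ jets N) : dx p ∈ jets (N + 1) := by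
  suffices h : p ∈ jets (N + 1) ∧ dx p ∈ jets (N + 1) from h.2
  refine jets_induction (P := fun p => p ∈ jets (N + 1) ∧ dx p ∈ jets (N + 1)) (N := N)
    (fun c => ⟨C_mem_jets _ _, by simp⟩)
    (fun n hn => ⟨X_mem_jets (by omega), by simpa using X_mem_jets (by omega)⟩)
    (fun p q hp hq => ⟨add_mem hp.1 hq.1, by simpa using add_mem hp.2 hq.2⟩)
    (fun p q hp hq => ⟨mul_mem hp.1 hq.1, ?_⟩) hp
  rw [dx_mul]
  exact add_mem (mul_mem hp.1 hq.2) (mul_mem hq.1 hp.2)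

lemma pderiv_eq_zero_of_mem_jets {N k : ℕ} {p : DiffPoly} (hp : p ∈ jets N) (hk : N ≤ k) :
    MvPolynomial.pderiv k p = 0 :=
  MvPolynomial.pderiv_eq_zero_of_notMem_vars fun h =>
    absurd (MvPolynomial.mem_supported.1 hp h) (by simp; omega)

lemma mem_jets_of_pderiv_eq_zero {N : ℕ} {p : DiffPoly} (hp : p ∈ jets (N + 1))
    (h : MvPolynomial.pderiv N p = 0) : p ∈ jets N := by
  refine MvPolynomial.mem_supported.2 fun m hm => ?_
  have hm1 : m < N + 1 := MvPolynomial.mem_supported.1 hp hm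
  rcases Nat.lt_succ_iff_lt_or_eq.1 hm1 with h1 | rfl
  · exact h1
  · exfalso
    obtain ⟨d, hd, hdm⟩ := (MvPolynomial.mem_vars_iff_mem_support _).1 hm
    have hd0 : d m ≠ 0 := Finsupp.mem_support_iff.1 hdm
    have h2 := congrArg (MvPolynomial.coeff (d - Finsupp.single m 1)) h
    have h3 : d - Finsupp.single m 1 + Finsupp.single m 1 = d :=
      tsub_add_cancel_of_le (Finsupp.single_le_iff.2 (by omega))
    rw [MvPolynomial.coeff_pderiv, h3, MvPolynomial.coeff_zero] at h2
    rcases mul_eq_zero.1 h2 with h4 | h4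
    · exact MvPolynomial.mem_support_iff.1 hd h4
    · exact Nat.cast_add_one_ne_zero _ h4

/-- The commutator of `∂/∂u⁽ⁿ⁺¹⁾` with `∂ₓ` is a derivation, so it suffices to compare it with
`∂/∂u⁽ⁿ⁾` on the variables. -/
lemma pderiv_dx (n : ℕ) (p : DiffPoly) : MvPolynomial.pderiv (n + 1) (dx p) =
    dx (MvPolynomial.pderiv (n + 1) p) + MvPolynomial.pderiv n p := by
  have h : ⁅(MvPolynomial.pderiv (n + 1) : Derivation ℂ DiffPoly DiffPoly), dx⁆ =
      MvPolynomial.pderiv n := by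
    refine MvPolynomial.derivation_ext fun i => ?_
    rw [Derivation.commutator_apply, dx_X, MvPolynomial.pderiv_X, MvPolynomial.pderiv_X,
      MvPolynomial.pderiv_X]
    have h1 : dx (Pi.single (M := fun _ => DiffPoly) (n + 1) 1 i) = 0 := by
      by_cases h : n + 1 = i
      · subst h; simp
      · rw [Pi.single_eq_of_ne (Ne.symm h), map_zero]
    rw [h1, sub_zero]
    by_cases h : n = i
    · subst h; simp
    · rw [Pi.single_eq_of_ne (Ne.symm h), Pi.single_eq_of_ne (by omega)]
  have := congrArg (fun D => D p) h
  simp only [Derivation.commutator_apply] at this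
  rw [← this]; ring

/-- If `u⁽ⁿ⁾` is the highest variable allowed in `p`, then `∂(∂ₓ p)/∂u⁽ⁿ⁺¹⁾ = ∂p/∂u⁽ⁿ⁾`. So `∂ₓ p =
0` removes the highest variable, and one descends to constants. -/
lemma exists_eq_C_of_dx_eq_zero {p : DiffPoly} (h : dx p = 0) : ∃ c, p = MvPolynomial.C c := by
  obtain ⟨N, hN⟩ := exists_mem_jets p
  induction N with
  | zero =>
    have h0 : {m : ℕ | m < 0} = ∅ := by ext; simp
    rw [jets, h0, MvPolynomial.supported_empty] at hN
    obtain ⟨c, hc⟩ := Algebra.mem_bot.1 hN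
    exact ⟨c, hc.symm⟩
  | succ n ih =>
    refine ih (mem_jets_of_pderiv_eq_zero hN ?_)
    have := pderiv_dx n p
    rwa [h, map_zero, pderiv_eq_zero_of_mem_jets hN le_rfl, map_zero, zero_add, eq_comm] at this

/-! ### Weights -/

/-- Homogeneity of degree `w` for `deg u⁽ⁿ⁾ = n + 2`. -/
abbrev HasWeight (p : DiffPoly) (w : ℕ) : Prop :=
  MvPolynomial.IsWeightedHomogeneous (fun n : ℕ => n + 2) p w

lemma hasWeight_zero (w : ℕ) : HasWeight 0 w := MvPolynomial.isWeightedHomogeneous_zero _ _ _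

lemma hasWeight_C (c : ℂ) : HasWeight (MvPolynomial.C c) 0 :=
  MvPolynomial.isWeightedHomogeneous_C _ _

lemma hasWeight_X (n : ℕ) : HasWeight (MvPolynomial.X n) (n + 2) :=
  MvPolynomial.isWeightedHomogeneous_X _ _ _

lemma HasWeight.dx {p : DiffPoly} {w : ℕ} (hp : HasWeight p w) : HasWeight (dx p) (w + 1) := by
  rw [p.as_sum, map_sum]
  refine (MvPolynomial.weightedHomogeneousSubmodule ℂ _ (w + 1)).sum_mem fun d hd => ?_
  have hd' : Finsupp.weight (fun n : ℕ => n + 2) d = w := hp (MvPolynomial.mem_support_iff.1 hd)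
  rw [KdV.dx, MvPolynomial.mkDerivation_monomial]
  refine Submodule.smul_mem _ _ ?_
  refine (MvPolynomial.weightedHomogeneousSubmodule ℂ _ (w + 1)).sum_mem fun i hi => ?_
  have h1 : HasWeight (MvPolynomial.monomial (d - Finsupp.single i 1) (d i : ℂ) *
      MvPolynomial.X (i + 1)) (w - (i + 2) + (i + 1 + 2)) := by
    refine MvPolynomial.IsWeightedHomogeneous.mul ?_ (hasWeight_X _)
    refine MvPolynomial.isWeightedHomogeneous_monomial _ _ _ ?_
    have h3 : d - Finsupp.single i 1 + Finsupp.single i 1 = d :=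
      tsub_add_cancel_of_le (Finsupp.single_le_iff.2
        (Nat.one_le_iff_ne_zero.2 (Finsupp.mem_support_iff.1 hi)))
    have h4 := congrArg (Finsupp.weight (fun n : ℕ => n + 2)) h3
    rw [map_add, hd', Finsupp.weight_single] at h4
    simp at h4
    omega
  have h2 : i + 2 ≤ w := by
    rw [← hd']
    exact Finsupp.le_weight_of_ne_zero' (fun n : ℕ => n + 2) (Finsupp.mem_support_iff.1 hi)
  have h5 : w - (i + 2) + (i + 1 + 2) = w + 1 := by omega
  rw [h5] at h1
  simpa using h1

/-! ### The faithful representation by operators -/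

lemma toOp_eq_sum {A : Polynomial DiffPoly} {n : ℕ} (h : A.natDegree < n) :
    toOp A = ∑ i ∈ Finset.range n, mulOp (A.coeff i) * dOp ^ i :=
  Polynomial.sum_over_range' _ (fun i => by ext; simp [mulOp]) _ h

lemma toOp_add (A B : Polynomial DiffPoly) : toOp (A + B) = toOp A + toOp B :=
  Polynomial.sum_add_index _ _ _ (fun i => by ext; simp [mulOp])
    fun i a b => by ext; simp [mulOp, add_mul]

lemma toOp_zero : toOp 0 = 0 := Polynomial.sum_zero_index _

lemma toOp_monomial (i : ℕ) (f : DiffPoly) :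
    toOp (Polynomial.monomial i f) = mulOp f * dOp ^ i :=
  Polynomial.sum_monomial_index _ _ (by ext; simp [mulOp])

lemma conjOp_add (A B : Polynomial DiffPoly) : conjOp (A + B) = conjOp A + conjOp B :=
  Polynomial.sum_add_index _ _ _ (fun i => by ext; simp [mulOp])
    fun i a b => by rw [← mul_add]; congr 1; ext; simp [mulOp, add_mul]

lemma conjOp_monomial (i : ℕ) (f : DiffPoly) :
    conjOp (Polynomial.monomial i f) = (-dOp) ^ i * mulOp f :=
  Polynomial.sum_monomial_index _ _ (by ext; simp [mulOp])

lemma toOp_neg (A : Polynomial DiffPoly) : toOp (-A) = -toOp A := by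
  rw [eq_neg_iff_add_eq_zero, ← toOp_add, neg_add_cancel, toOp_zero]

lemma toOp_sub (A B : Polynomial DiffPoly) : toOp (A - B) = toOp A - toOp B := by
  rw [sub_eq_add_neg, toOp_add, toOp_neg, sub_eq_add_neg]

lemma mulOp_apply (f p : DiffPoly) : mulOp f p = f * p := rfl

lemma dOp_apply (p : DiffPoly) : dOp p = dx p := rfl

lemma dOp_pow_X (i N : ℕ) :
    (dOp ^ i) (MvPolynomial.X N : DiffPoly) = MvPolynomial.X (N + i) := by
  induction i with
  | zero => rfl
  | succ i ih => rw [pow_succ', Module.End.mul_apply, ih, dOp_apply, dx_X]; rfl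

lemma dOp_pow_mem_jets {N : ℕ} {p : DiffPoly} (hp : p ∈ jets N) (i : ℕ) :
    (dOp ^ i) p ∈ jets (N + i) := by
  induction i with
  | zero => exact hp
  | succ i ih => rw [pow_succ', Module.End.mul_apply]; exact dx_mem_jets ih

lemma toOp_apply {A : Polynomial DiffPoly} {n : ℕ} (h : A.natDegree < n) (p : DiffPoly) :
    toOp A p = ∑ i ∈ Finset.range n, A.coeff i * (dOp ^ i) p := by
  rw [toOp_eq_sum h, LinearMap.sum_apply]; rfl

/-- An operator whose commutator with `ℒ` is a multiplication operator has a constant leading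
coefficient. -/
lemma dx_leadingCoeff_eq_zero {B : Polynomial DiffPoly} {r : DiffPoly}
    (h : ⁅schrodinger, toOp B⁆ = mulOp r) : dx B.leadingCoeff = 0 := by
  obtain ⟨N, hB, hr⟩ : ∃ N, (∀ i, B.coeff i ∈ jets N) ∧ r ∈ jets N := by
    obtain ⟨N₀, h₀⟩ := exists_mem_jets r
    choose f hf using fun i => exists_mem_jets (B.coeff i)
    refine ⟨N₀ + ∑ i ∈ Finset.range (B.natDegree + 1), f i, fun i => ?_,
      jets_mono (by omega) h₀⟩
    by_cases hi : i < B.natDegree + 1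
    · refine jets_mono ?_ (hf i)
      have := Finset.single_le_sum (f := f) (fun _ _ => Nat.zero_le _) (Finset.mem_range.2 hi)
      omega
    · rw [Polynomial.coeff_eq_zero_of_natDegree_lt (by omega)]; exact zero_mem _
  set m := B.natDegree with hm
  -- Large enough that `u⁽ᴹ⁾` occurs neither in the coefficients nor in their first two derivatives.
  set M := N + 2 with hM
  have hB2 : ∀ i, B.coeff i ∈ jets M ∧ dx (B.coeff i) ∈ jets M ∧ dx (dx (B.coeff i)) ∈ jets M :=
    fun i => ⟨jets_mono (by omega) (hB i), jets_mono (by omega) (dx_mem_jets (hB i)),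
      dx_mem_jets (dx_mem_jets (hB i))⟩
  -- Both operators are tested on `u⁽ᴹ⁾`, and the coefficient of `u⁽ᴹ⁺ᵐ⁺¹⁾` is extracted. The terms
  -- of order `M + i + 2` cancel in the commutator, so what remains of this order is `2 B_m'
  -- u⁽ᴹ⁺ᵐ⁺¹⁾`, while the multiplication operator contributes nothing.
  have h1 := congrArg (fun T : Module.End ℂ DiffPoly =>
    MvPolynomial.pderiv (M + m + 1) (T (MvPolynomial.X M))) h
  have hX : schrodinger (MvPolynomial.X M) =
      MvPolynomial.X (M + 2) - MvPolynomial.X 0 * MvPolynomial.X M := by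
    simp [schrodinger, pow_two, dOp_apply, mulOp_apply]
  have hL : ∀ p, schrodinger p = dx (dx p) - MvPolynomial.X 0 * p := fun p => by
    simp [schrodinger, pow_two, dOp_apply, mulOp_apply]
  have key : ⁅schrodinger, toOp B⁆ (MvPolynomial.X M) = ∑ i ∈ Finset.range (m + 1),
      (dx (dx (B.coeff i)) * MvPolynomial.X (M + i) + 2 * dx (B.coeff i) * MvPolynomial.X (M + i + 1)
      - MvPolynomial.X 0 * B.coeff i * MvPolynomial.X (M + i)
      + B.coeff i * (dOp ^ i) (MvPolynomial.X 0 * MvPolynomial.X M)) := by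
    rw [LieRing.of_associative_ring_bracket, LinearMap.sub_apply, Module.End.mul_apply,
      Module.End.mul_apply, hX, toOp_apply (Nat.lt_succ_self m), toOp_apply (Nat.lt_succ_self m),
      hL, map_sum, map_sum, Finset.mul_sum, ← Finset.sum_sub_distrib, ← Finset.sum_sub_distrib]
    refine Finset.sum_congr rfl fun i _ => ?_
    rw [map_sub, dOp_pow_X, dOp_pow_X, dx_mul, map_add, dx_mul, dx_mul, dx_X, dx_X]
    rw [show M + 2 + i = M + i + 1 + 1 by ring]
    ring
  have hu : ∀ i < m + 1, (dOp ^ i) (MvPolynomial.X 0 * MvPolynomial.X M) ∈ jets (M + m + 1) :=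
    fun i hi => jets_mono (by omega) (dOp_pow_mem_jets (N := M + 1)
      (mul_mem (X_mem_jets (by omega)) (X_mem_jets (by omega))) i)
  simp only [key, mulOp_apply] at h1
  rw [pderiv_eq_zero_of_mem_jets (N := M + m + 1) (mul_mem (jets_mono (by omega) hr)
    (X_mem_jets (by omega))) le_rfl, Finset.sum_range_succ, map_add,
    pderiv_eq_zero_of_mem_jets (N := M + m + 1) _ le_rfl, zero_add] at h1
  · have h2 : (2 : DiffPoly) ∈ jets M := C_mem_jets 2 M
    have e1 : ∀ c ∈ jets M, MvPolynomial.pderiv (M + m + 1) (c * MvPolynomial.X (M + m)) = 0 :=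
      fun c hc => pderiv_eq_zero_of_mem_jets (N := M + m + 1)
        (mul_mem (jets_mono (by omega) hc) (X_mem_jets (by omega))) le_rfl
    rw [map_add, map_sub, map_add, e1 _ (hB2 m).2.2, e1 _ (mul_mem (X_mem_jets (by omega)) (hB2 m).1),
      pderiv_eq_zero_of_mem_jets (N := M + m + 1) (mul_mem (jets_mono (by omega) (hB2 m).1)
        (hu m (by omega))) le_rfl, MvPolynomial.pderiv_mul, MvPolynomial.pderiv_X_self,
      pderiv_eq_zero_of_mem_jets (N := M) (mul_mem h2 (hB2 m).2.1) (by omega)] at h1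
    rw [mul_one, zero_mul, zero_add, zero_add, sub_zero, add_zero] at h1
    exact (mul_eq_zero.1 h1).resolve_left two_ne_zero
  · refine sum_mem fun i hi => ?_
    have hi' := Finset.mem_range.1 hi
    have e2 : ∀ c ∈ jets M, c ∈ jets (M + m + 1) := fun c hc => jets_mono (by omega) hc
    have e3 : (MvPolynomial.X (M + i) : DiffPoly) ∈ jets (M + m + 1) := X_mem_jets (by omega)
    have e4 : (MvPolynomial.X (M + i + 1) : DiffPoly) ∈ jets (M + m + 1) := X_mem_jets (by omega)
    exact add_mem (sub_mem (add_mem (mul_mem (e2 _ (hB2 i).2.2) e3)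
      (mul_mem (mul_mem (C_mem_jets 2 _) (e2 _ (hB2 i).2.1)) e4))
      (mul_mem (mul_mem (X_mem_jets (by omega)) (e2 _ (hB2 i).1)) e3))
      (mul_mem (e2 _ (hB2 i).1) (hu i (by omega)))

/-- The difference of two candidates has order below `2k + 1`. Its leading coefficient is constant
by `dx_leadingCoeff_eq_zero`, but homogeneous of positive weight, hence zero. -/
lemma IsLaxOperator.unique {k : ℕ} {A B : Polynomial DiffPoly} (hA : IsLaxOperator k A)
    (hB : IsLaxOperator k B) : A = B := by
  by_contra hne
  obtain ⟨r, hr⟩ := hA.commutator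
  obtain ⟨s, hs⟩ := hB.commutator
  have hAB : A - B ≠ 0 := sub_ne_zero.2 hne
  have h : ⁅schrodinger, toOp (A - B)⁆ = mulOp (r - s) := by
    have : mulOp (r - s) = mulOp r - mulOp s := by ext; simp [mulOp, sub_mul]
    rw [this, ← hr, ← hs, toOp_sub]
    simp only [LieRing.of_associative_ring_bracket]
    rw [mul_sub, sub_mul]; abel
  obtain ⟨c, hc⟩ := exists_eq_C_of_dx_eq_zero (dx_leadingCoeff_eq_zero h)
  have hdeg : (A - B).natDegree < 2 * k + 1 := by
    have := Polynomial.degree_sub_lt_left (p := A) (q := B)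
      (by rw [Polynomial.degree_eq_natDegree hA.monic.ne_zero,
        Polynomial.degree_eq_natDegree hB.monic.ne_zero, hA.order_eq, hB.order_eq])
      hA.monic.ne_zero (by rw [hA.monic, hB.monic])
    rw [← hA.order_eq]
    exact Polynomial.natDegree_lt_natDegree hAB this
  have hw : HasWeight (A - B).leadingCoeff (2 * k + 1 - (A - B).natDegree) := by
    rw [Polynomial.leadingCoeff, Polynomial.coeff_sub]
    exact MvPolynomial.IsWeightedHomogeneous.sub (hA.homogeneous _ hdeg.le)
      (hB.homogeneous _ hdeg.le)
  have hc0 : c ≠ 0 := by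
    rintro rfl
    exact hAB (Polynomial.leadingCoeff_eq_zero.1 (by simpa using hc))
  rw [hc] at hw
  have := MvPolynomial.IsWeightedHomogeneous.inj_right (by simpa using hc0) hw (hasWeight_C c)
  omega

lemma mulOp_injective : Function.Injective mulOp := fun f g h => by
  simpa [mulOp] using congrArg (fun T : Module.End ℂ DiffPoly => T 1) h

lemma IsKdVFlow.unique {k : ℕ} {r s : DiffPoly} (hr : IsKdVFlow k r) (hs : IsKdVFlow k s) :
    r = s := by
  obtain ⟨A, hA, hA'⟩ := hr
  obtain ⟨B, hB, hB'⟩ := hs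
  obtain rfl := hA.unique hB
  exact mulOp_injective (hA'.symm.trans hB')

/-! ### The quadratic form whose level sets are the resolvents of the Schrödinger operator -/

open PowerSeries in
/-- `ξ (F'² - 2 F F'' + 4 u F²) + 4 F²`, for given values of `u`, `F`, `F'`, `F''`. -/
def quad {B : Type*} [CommRing B] (u : B) (F F₁ F₂ : PowerSeries B) : PowerSeries B :=
  X * (F₁ ^ 2 - 2 * (F * F₂) + 4 * (C u * F ^ 2)) + 4 * F ^ 2

open PowerSeries in
/-- `ξ (-F''' + 2 u' F + 4 u F') + 4 F'`. -/
def lenard {B : Type*} [CommRing B] (u u₁ : B) (F F₁ F₃ : PowerSeries B) : PowerSeries B :=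
  X * (-F₃ + 2 * (C u₁ * F) + 4 * (C u * F₁)) + 4 * F₁

lemma coeff_lenard_succ {B : Type*} [CommRing B] (u u₁ : B) (F F₁ F₃ : PowerSeries B) (n : ℕ) :
    PowerSeries.coeff (n + 1) (lenard u u₁ F F₁ F₃) =
      -PowerSeries.coeff n F₃ + 2 * u₁ * PowerSeries.coeff n F + 4 * u * PowerSeries.coeff n F₁ +
        4 * PowerSeries.coeff (n + 1) F₁ := by
  have h2 : (2 : PowerSeries B) = PowerSeries.C 2 := (map_ofNat _ 2).symm
  have h4 : (4 : PowerSeries B) = PowerSeries.C 4 := (map_ofNat _ 4).symm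
  simp only [lenard, h2, h4, map_add, map_neg, PowerSeries.coeff_succ_X_mul,
    PowerSeries.coeff_C_mul]
  ring

lemma coeff_lenard_zero {B : Type*} [CommRing B] (u u₁ : B) (F F₁ F₃ : PowerSeries B) :
    PowerSeries.coeff 0 (lenard u u₁ F F₁ F₃) = 4 * PowerSeries.coeff 0 F₁ := by
  have h4 : (4 : PowerSeries B) = PowerSeries.C 4 := (map_ofNat _ 4).symm
  simp [lenard, h4]

lemma coeff_sq_succ {B : Type*} [CommRing B] (F : PowerSeries B) (n : ℕ) :
    PowerSeries.coeff (n + 1) (F ^ 2) =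
      2 * (PowerSeries.coeff 0 F * PowerSeries.coeff (n + 1) F) +
      ∑ i ∈ Finset.range n, PowerSeries.coeff (i + 1) F * PowerSeries.coeff (n - i) F := by
  rw [pow_two, PowerSeries.coeff_mul, Finset.Nat.sum_antidiagonal_eq_sum_range_succ_mk,
    Finset.sum_range_succ, Finset.sum_range_succ']
  simp only [Nat.sub_self, Nat.sub_zero, Nat.add_sub_add_right]
  ring

/-- Only the first summand involves the coefficient of `F` of index `n + 1`, and only indices up to
`n` of `F₁` and `F₂` occur. This triangular shape underlies every recursion below: for the
resolvent, for uniqueness of `2 - 𝐮`, and for solving for `F₂`. -/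
lemma coeff_quad_succ {B : Type*} [CommRing B] (u : B) (F F₁ F₂ : PowerSeries B) (n : ℕ) :
    PowerSeries.coeff (n + 1) (quad u F F₁ F₂) =
      8 * (PowerSeries.coeff 0 F * PowerSeries.coeff (n + 1) F) +
      4 * ∑ i ∈ Finset.range n, PowerSeries.coeff (i + 1) F * PowerSeries.coeff (n - i) F +
      ∑ i ∈ Finset.range (n + 1), (PowerSeries.coeff i F₁ * PowerSeries.coeff (n - i) F₁ -
        2 * (PowerSeries.coeff i F * PowerSeries.coeff (n - i) F₂) +
        4 * (u * (PowerSeries.coeff i F * PowerSeries.coeff (n - i) F))) := by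
  have h2 : (2 : PowerSeries B) = PowerSeries.C 2 := (map_ofNat _ 2).symm
  have h4 : (4 : PowerSeries B) = PowerSeries.C 4 := (map_ofNat _ 4).symm
  simp only [quad, h2, h4, map_add, map_sub, PowerSeries.coeff_succ_X_mul,
    PowerSeries.coeff_C_mul]
  rw [coeff_sq_succ, pow_two, pow_two, PowerSeries.coeff_mul, PowerSeries.coeff_mul,
    PowerSeries.coeff_mul, Finset.Nat.sum_antidiagonal_eq_sum_range_succ_mk,
    Finset.Nat.sum_antidiagonal_eq_sum_range_succ_mk,
    Finset.Nat.sum_antidiagonal_eq_sum_range_succ_mk, Finset.sum_add_distrib,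
    Finset.sum_sub_distrib]
  simp only [← Finset.mul_sum]
  ring

lemma coeff_quad_zero {B : Type*} [CommRing B] (u : B) (F F₁ F₂ : PowerSeries B) :
    PowerSeries.coeff 0 (quad u F F₁ F₂) = 4 * PowerSeries.coeff 0 F ^ 2 := by
  have h4 : (4 : PowerSeries B) = PowerSeries.C 4 := (map_ofNat _ 4).symm
  simp [quad, h4]

/-! ### The coefficients of the resolvent -/

/-- The coefficients `R_n` of the formal solution `R = 1 + R₁ ξ + …` of
`ξ (R'² - 2 R R'' + 4 u R²) + 4 R² = 4`. -/
def resolvent : ℕ → DiffPoly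
  | 0 => 1
  | n + 1 => MvPolynomial.C (-1 / 8) *
      (4 * ∑ i : Fin n, resolvent (i + 1) * resolvent (n - i) +
        ∑ i : Fin (n + 1), (dx (resolvent i) * dx (resolvent (n - i)) -
          2 * (resolvent i * dx (dx (resolvent (n - i)))) +
          4 * (MvPolynomial.X 0 * (resolvent i * resolvent (n - i)))))
  decreasing_by all_goals omega

lemma resolvent_zero : resolvent 0 = 1 := by rw [resolvent]

lemma resolvent_succ (n : ℕ) : resolvent (n + 1) = MvPolynomial.C (-1 / 8) *
      (4 * ∑ i ∈ Finset.range n, resolvent (i + 1) * resolvent (n - i) +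
        ∑ i ∈ Finset.range (n + 1), (dx (resolvent i) * dx (resolvent (n - i)) -
          2 * (resolvent i * dx (dx (resolvent (n - i)))) +
          4 * (MvPolynomial.X 0 * (resolvent i * resolvent (n - i))))) := by
  rw [resolvent, Finset.sum_range, Finset.sum_range]

/-- The generating function of the coefficients of the resolvent. -/
def resolventSeries : PowerSeries DiffPoly := PowerSeries.mk resolvent

/-- The total derivative of the coefficients of a power series. -/
def dxSeries (F : PowerSeries DiffPoly) : PowerSeries DiffPoly :=
  PowerSeries.mk fun n => dx (PowerSeries.coeff n F)

@[simp] lemma coeff_dxSeries (n : ℕ) (F : PowerSeries DiffPoly) :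
    PowerSeries.coeff n (dxSeries F) = dx (PowerSeries.coeff n F) := PowerSeries.coeff_mk _ _

@[simp] lemma coeff_resolventSeries (n : ℕ) :
    PowerSeries.coeff n resolventSeries = resolvent n := PowerSeries.coeff_mk _ _

lemma dxSeries_add (F G : PowerSeries DiffPoly) : dxSeries (F + G) = dxSeries F + dxSeries G := by
  ext1 n; simp

lemma dxSeries_sub (F G : PowerSeries DiffPoly) : dxSeries (F - G) = dxSeries F - dxSeries G := by
  ext1 n; simp

lemma dxSeries_mul (F G : PowerSeries DiffPoly) :
    dxSeries (F * G) = F * dxSeries G + dxSeries F * G := by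
  ext1 n
  simp only [coeff_dxSeries, map_add, PowerSeries.coeff_mul, map_sum, dx_mul,
    ← Finset.sum_add_distrib]
  exact Finset.sum_congr rfl fun _ _ => by ring

lemma dxSeries_C (f : DiffPoly) : dxSeries (PowerSeries.C f) = PowerSeries.C (dx f) := by
  ext1 n
  simp only [coeff_dxSeries, PowerSeries.coeff_C]
  split_ifs <;> simp

lemma dxSeries_X : dxSeries PowerSeries.X = 0 := by
  ext1 n
  simp only [coeff_dxSeries, PowerSeries.coeff_X]
  split_ifs <;> simp

lemma dxSeries_natCast (n : ℕ) : dxSeries (n : PowerSeries DiffPoly) = 0 := by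
  rw [← map_natCast PowerSeries.C n, dxSeries_C, Derivation.map_natCast, map_zero]

/-- The two terms `2 ξ F' F''` cancel, and all others contain `2 F`. Thus `quad` is a first integral
of the system `lenard = 0`. -/
lemma dxSeries_quad (F : PowerSeries DiffPoly) :
    dxSeries (quad (MvPolynomial.X 0) F (dxSeries F) (dxSeries (dxSeries F))) =
      2 * F * lenard (MvPolynomial.X 0) (MvPolynomial.X 1) F (dxSeries F)
        (dxSeries (dxSeries (dxSeries F))) := by
  have h2 : dxSeries 2 = 0 := by
    exact_mod_cast dxSeries_natCast 2
  have h4 : dxSeries 4 = 0 := by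
    exact_mod_cast dxSeries_natCast 4
  simp only [quad, lenard, pow_two, dxSeries_add, dxSeries_sub, dxSeries_mul, dxSeries_C,
    dxSeries_X, h2, h4, dx_X]
  ring

lemma quad_resolventSeries : quad (MvPolynomial.X 0) resolventSeries (dxSeries resolventSeries)
    (dxSeries (dxSeries resolventSeries)) = 4 := by
  ext1 n
  have h4 : (4 : PowerSeries DiffPoly) = PowerSeries.C 4 := (map_ofNat _ 4).symm
  cases n with
  | zero => rw [coeff_quad_zero, h4]; simp [resolvent_zero]
  | succ n =>
    rw [coeff_quad_succ, h4, PowerSeries.coeff_C, if_neg (Nat.succ_ne_zero n)]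
    simp only [coeff_dxSeries, coeff_resolventSeries, resolvent_zero]
    have h8 : (8 : DiffPoly) * MvPolynomial.C (-1 / 8) = -1 := by
      rw [show (8 : DiffPoly) = MvPolynomial.C 8 from (map_ofNat _ 8).symm, ← map_mul]
      norm_num
    have := resolvent_succ n
    linear_combination 8 * this + (4 * ∑ i ∈ Finset.range n, resolvent (i + 1) * resolvent (n - i) +
        ∑ i ∈ Finset.range (n + 1), (dx (resolvent i) * dx (resolvent (n - i)) -
          2 * (resolvent i * dx (dx (resolvent (n - i)))) +
          4 * (MvPolynomial.X 0 * (resolvent i * resolvent (n - i))))) * h8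

/-- Differentiating `quad = 4` gives `2 R Λ(R) = 0`; power series over a domain have no zero
divisors, and `R` has constant term `1`. -/
lemma lenard_resolventSeries :
    lenard (MvPolynomial.X 0) (MvPolynomial.X 1) resolventSeries (dxSeries resolventSeries)
      (dxSeries (dxSeries (dxSeries resolventSeries))) = 0 := by
  have h := dxSeries_quad resolventSeries
  have h4 : dxSeries 4 = 0 := by
    exact_mod_cast dxSeries_natCast 4
  rw [quad_resolventSeries, h4, eq_comm] at h
  refine (mul_eq_zero.1 h).resolve_left fun h0 => ?_
  have := congrArg (PowerSeries.coeff 0) h0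
  rw [show (2 : PowerSeries DiffPoly) = PowerSeries.C 2 from (map_ofNat _ 2).symm,
    PowerSeries.coeff_C_mul, coeff_resolventSeries, resolvent_zero] at this
  simp at this

/-- The Lenard recursion. -/
lemma resolvent_lenard (n : ℕ) :
    4 * dx (resolvent (n + 1)) = dx (dx (dx (resolvent n))) -
      2 * MvPolynomial.X 1 * resolvent n - 4 * MvPolynomial.X 0 * dx (resolvent n) := by
  have h := congrArg (PowerSeries.coeff (n + 1)) lenard_resolventSeries
  rw [coeff_lenard_succ] at h
  simp only [coeff_dxSeries, coeff_resolventSeries, map_zero] at h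
  linear_combination h

lemma hasWeight_resolvent (n : ℕ) : HasWeight (resolvent n) (2 * n) := by
  induction n using Nat.strong_induction_on with
  | _ n ih =>
    cases n with
    | zero => rw [resolvent_zero]; exact hasWeight_C 1
    | succ n =>
      rw [resolvent_succ]
      have hC : ∀ (c : ℂ) {p : DiffPoly} {w : ℕ}, HasWeight p w →
          HasWeight (MvPolynomial.C c * p) w := fun c p w h => by
        simpa using MvPolynomial.IsWeightedHomogeneous.mul (hasWeight_C c) h
      have h2 : (2 : DiffPoly) = MvPolynomial.C 2 := (map_ofNat _ 2).symm
      have h4 : (4 : DiffPoly) = MvPolynomial.C 4 := (map_ofNat _ 4).symm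
      have hmul : ∀ {p q : DiffPoly} {w w' W : ℕ}, HasWeight p w → HasWeight q w' → w + w' = W →
          HasWeight (p * q) W := fun hp hq h => h ▸ hp.mul hq
      rw [h2, h4]
      have hsum : ∀ (s : Finset ℕ) (f : ℕ → DiffPoly), (∀ i ∈ s, HasWeight (f i) (2 * (n + 1))) →
          HasWeight (∑ i ∈ s, f i) (2 * (n + 1)) := fun s f hf =>
        (MvPolynomial.weightedHomogeneousSubmodule ℂ _ _).sum_mem hf
      refine hC _ (MvPolynomial.IsWeightedHomogeneous.add (hC _ (hsum _ _ fun i hi => ?_))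
        (hsum _ _ fun i hi => ?_))
      · have := Finset.mem_range.1 hi
        exact hmul (ih (i + 1) (by omega)) (ih (n - i) (by omega)) (by omega)
      · have := Finset.mem_range.1 hi
        have h1 := ih i (by omega)
        have h3 := ih (n - i) (by omega)
        refine MvPolynomial.IsWeightedHomogeneous.add (MvPolynomial.IsWeightedHomogeneous.sub
          (hmul h1.dx h3.dx (by omega)) (hC _ (hmul h1 h3.dx.dx (by omega))))
          (hC _ (hmul (hasWeight_X 0) (h1.mul h3) (by omega)))

/-- `R_{n+1}` is, up to a nonzero factor, `u⁽²ⁿ⁾` plus terms of lower order. -/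
lemma exists_resolvent_sub_mem_jets (n : ℕ) :
    ∃ c : ℂ, c ≠ 0 ∧ resolvent (n + 1) - MvPolynomial.C c * MvPolynomial.X (2 * n) ∈
      jets (2 * n) := by
  induction n using Nat.strong_induction_on with
  | _ n ih =>
    have hR : ∀ m ≤ n, resolvent m ∈ jets (2 * m - 1) := by
      intro m hm
      cases m with
      | zero => rw [resolvent_zero]; exact one_mem _
      | succ m =>
        obtain ⟨c, -, hc⟩ := ih m (by omega)
        rw [← sub_add_cancel (resolvent (m + 1)) (MvPolynomial.C c * MvPolynomial.X (2 * m))]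
        exact add_mem (jets_mono (by omega) hc) (mul_mem (C_mem_jets _ _) (X_mem_jets (by omega)))
    cases n with
    | zero =>
      refine ⟨-1 / 2, by norm_num, ?_⟩
      rw [resolvent_succ]
      have h4 : (4 : DiffPoly) = MvPolynomial.C 4 := (map_ofNat _ 4).symm
      have : (MvPolynomial.C (-1 / 8) * MvPolynomial.C 4 : DiffPoly) = MvPolynomial.C (-1 / 2) := by
        rw [← map_mul]; norm_num
      simp only [Finset.range_zero, Finset.sum_empty, zero_add, Finset.sum_range_one, Nat.sub_zero,
        resolvent_zero, Derivation.map_one_eq_zero, map_zero, mul_zero, mul_one, sub_zero, h4]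
      rw [← mul_assoc, this, sub_self]
      exact zero_mem _
    | succ n =>
      obtain ⟨c, hc0, hc⟩ := ih n (by omega)
      -- The top order comes from the single term `-2 R₀ R_{n+1}''` of the recursion for `R_{n+2}`,
      -- with the factor `-1/8`; it is the index `0` term of the second sum and is split off below.
      refine ⟨c / 4, by simpa using hc0, ?_⟩
      set N := 2 * (n + 1) with hN
      have hnum : ∀ k : ℕ, (k : DiffPoly) ∈ jets N := fun k => natCast_mem _ k
      have h2 : (2 : DiffPoly) ∈ jets N := hnum 2
      have h4 : (4 : DiffPoly) ∈ jets N := hnum 4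
      have hm : ∀ m ≤ n + 1, resolvent m ∈ jets N := fun m h => jets_mono (by omega) (hR m h)
      have hm1 : ∀ m ≤ n + 1, dx (resolvent m) ∈ jets N := fun m h => by
        rcases Nat.eq_zero_or_pos m with rfl | h0
        · rw [resolvent_zero, Derivation.map_one_eq_zero]; exact zero_mem _
        · exact jets_mono (by omega) (dx_mem_jets (hR m h))
      have hm2 : ∀ m ≤ n, dx (dx (resolvent m)) ∈ jets N := fun m h => by
        rcases Nat.eq_zero_or_pos m with rfl | h0
        · rw [resolvent_zero, Derivation.map_one_eq_zero, map_zero]; exact zero_mem _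
        · exact jets_mono (by omega) (dx_mem_jets (dx_mem_jets (hR m (by omega))))
      have htop : dx (dx (resolvent (n + 1))) - MvPolynomial.C c * MvPolynomial.X N ∈ jets N := by
        have := dx_mem_jets (dx_mem_jets hc)
        rw [map_sub, map_sub, dx_mul, map_add, dx_mul, dx_mul] at this
        simp only [dx_X, dx_C, mul_zero, add_zero, map_zero, zero_mul] at this
        rwa [show 2 * n + 1 + 1 = N by omega] at this
      have h8 : (MvPolynomial.C (-1 / 8) * 2 * MvPolynomial.C c : DiffPoly) =
          -MvPolynomial.C (c / 4) := by
        rw [show (2 : DiffPoly) = MvPolynomial.C 2 from (map_ofNat _ 2).symm, ← map_mul, ← map_mul,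
          ← map_neg]
        congr 1; ring
      rw [resolvent_succ, Finset.sum_range_succ' _ (n + 1)]
      simp only [resolvent_zero, Nat.sub_zero, Derivation.map_one_eq_zero, zero_mul, one_mul,
        zero_sub]
      have e : ∀ S T U W x : DiffPoly, MvPolynomial.C (-1 / 8) * (4 * S + (T + (-(2 * W) + U))) -
          MvPolynomial.C (c / 4) * x =
          MvPolynomial.C (-1 / 8) * (4 * S + (T + (-(2 * (W - MvPolynomial.C c * x)) + U))) := by
        intro S T U W x
        linear_combination (-x) * h8
      rw [e]
      have hsub : ∀ i, n + 1 - (i + 1) = n - i := fun i => by omega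
      refine mul_mem (C_mem_jets _ _) (add_mem (mul_mem h4 (sum_mem fun i hi => ?_))
        (add_mem (sum_mem fun i hi => ?_) (add_mem (neg_mem (mul_mem h2 htop))
        (mul_mem h4 (mul_mem (X_mem_jets (by omega)) (hm _ le_rfl))))))
      · have := Finset.mem_range.1 hi
        exact mul_mem (hm _ (by omega)) (hm _ (by omega))
      · have := Finset.mem_range.1 hi
        exact add_mem (sub_mem (mul_mem (hm1 _ (by omega)) (hm1 _ (by omega)))
          (mul_mem h2 (mul_mem (hm _ (by omega)) (hm2 _ (by omega)))))
          (mul_mem h4 (mul_mem (X_mem_jets (by omega)) (mul_mem (hm _ (by omega)) (hm _ (by omega)))))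

lemma resolvent_mem_jets (n : ℕ) : resolvent n ∈ jets (2 * n - 1) := by
  cases n with
  | zero => rw [resolvent_zero]; exact one_mem _
  | succ n =>
    obtain ⟨c, -, hc⟩ := exists_resolvent_sub_mem_jets n
    rw [← sub_add_cancel (resolvent (n + 1)) (MvPolynomial.C c * MvPolynomial.X (2 * n))]
    exact add_mem (jets_mono (by omega) hc) (mul_mem (C_mem_jets _ _) (X_mem_jets (by omega)))

lemma resolvent_one : resolvent 1 = MvPolynomial.C (-1 / 2) * MvPolynomial.X 0 := by
  rw [resolvent_succ]
  have h4 : (4 : DiffPoly) = MvPolynomial.C 4 := (map_ofNat _ 4).symm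
  have : (MvPolynomial.C (-1 / 8) * MvPolynomial.C 4 : DiffPoly) = MvPolynomial.C (-1 / 2) := by
    rw [← map_mul]; norm_num
  simp only [Finset.range_zero, Finset.sum_empty, zero_add, Finset.sum_range_one, Nat.sub_zero,
    resolvent_zero, Derivation.map_one_eq_zero, map_zero, mul_zero, mul_one, sub_zero, h4]
  rw [← mul_assoc, this]

/-! ### Existence of the Lax operators -/

/-- `S` is a differential operator of order at most `d`, homogeneous of degree `d`, with formal
conjugate `T`, and `c` is its coefficient at `∂ₓᵈ`. -/
def HasSymbol (d : ℕ) (c : DiffPoly) (S T : Module.End ℂ DiffPoly) : Prop :=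
  ∃ A : Polynomial DiffPoly, toOp A = S ∧ conjOp A = T ∧
    (∀ i ≤ d, HasWeight (A.coeff i) (d - i)) ∧ (∀ i, d < i → A.coeff i = 0) ∧ A.coeff d = c

lemma hasSymbol_one : HasSymbol 0 1 1 1 := by
  refine ⟨Polynomial.monomial 0 1, ?_, ?_, fun i hi => ?_, fun i hi => ?_, ?_⟩
  · rw [toOp_monomial]; ext; simp [mulOp]
  · rw [conjOp_monomial]; ext; simp [mulOp]
  · obtain rfl : i = 0 := by omega
    simpa using hasWeight_C 1
  · rw [Polynomial.coeff_monomial, if_neg (by omega)]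
  · simp

lemma HasSymbol.add {d : ℕ} {c c' : DiffPoly} {S S' T T' : Module.End ℂ DiffPoly}
    (h : HasSymbol d c S T) (h' : HasSymbol d c' S' T') :
    HasSymbol d (c + c') (S + S') (T + T') := by
  obtain ⟨A, rfl, rfl, hw, h0, rfl⟩ := h
  obtain ⟨B, rfl, rfl, hw', h0', rfl⟩ := h'
  refine ⟨A + B, toOp_add A B, conjOp_add A B, fun i hi => ?_, fun i hi => ?_, by simp⟩
  · rw [Polynomial.coeff_add]; exact (hw i hi).add (hw' i hi)
  · rw [Polynomial.coeff_add, h0 i hi, h0' i hi, add_zero]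

lemma dOp_mul_mulOp (f : DiffPoly) : dOp * mulOp f = mulOp f * dOp + mulOp (dx f) := by
  refine LinearMap.ext fun p => ?_
  simp only [LinearMap.add_apply, Module.End.mul_apply, dOp_apply, mulOp_apply, dx_mul]
  ring

/-- By the Leibniz rule `∂ₓ f ∂ₓⁱ = f ∂ₓⁱ⁺¹ + f' ∂ₓⁱ`. Conjugation reverses products and sends `∂ₓ`
to `-∂ₓ`, so the factor moves to the right with a sign. -/
lemma HasSymbol.dOp_mul {d : ℕ} {c : DiffPoly} {S T : Module.End ℂ DiffPoly}
    (h : HasSymbol d c S T) : HasSymbol (d + 1) c (dOp * S) (-(T * dOp)) := by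
  obtain ⟨A, rfl, rfl, hw, h0, rfl⟩ := h
  have key : ∃ B : Polynomial DiffPoly, toOp B = dOp * toOp A ∧ conjOp B = -(conjOp A * dOp) ∧
      B.coeff 0 = dx (A.coeff 0) ∧ ∀ i, B.coeff (i + 1) = A.coeff i + dx (A.coeff (i + 1)) := by
    clear hw h0
    induction A using Polynomial.induction_on' with
    | add A B hA hB =>
      obtain ⟨A', h1, h2, h3, h4⟩ := hA
      obtain ⟨B', k1, k2, k3, k4⟩ := hB
      refine ⟨A' + B', ?_, ?_, by simp [h3, k3], fun i => ?_⟩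
      · rw [toOp_add, h1, k1, toOp_add, mul_add]
      · rw [conjOp_add, h2, k2, conjOp_add, add_mul, neg_add]
      · simp only [Polynomial.coeff_add, h4, k4, map_add]; ring
    | monomial n f =>
      refine ⟨Polynomial.monomial (n + 1) f + Polynomial.monomial n (dx f), ?_, ?_, ?_, fun i => ?_⟩
      · rw [toOp_add, toOp_monomial, toOp_monomial, toOp_monomial, ← mul_assoc, dOp_mul_mulOp,
          pow_succ', add_mul, mul_assoc]
      · rw [conjOp_add, conjOp_monomial, conjOp_monomial, conjOp_monomial, pow_succ]
        refine LinearMap.ext fun p => ?_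
        simp only [LinearMap.add_apply, LinearMap.neg_apply, Module.End.mul_apply, mulOp_apply,
          dOp_apply]
        rw [← map_add, dx_mul,
          show -(f * dx p + p * dx f) + dx f * p = -(f * dx p) by ring, map_neg]
      · simp only [Polynomial.coeff_add, Polynomial.coeff_monomial]
        split_ifs <;> simp_all
      · simp only [Polynomial.coeff_add, Polynomial.coeff_monomial]
        split_ifs <;> first | omega | simp
  obtain ⟨B, h1, h2, h3, h4⟩ := key
  refine ⟨B, h1, h2, fun i hi => ?_, fun i hi => ?_, ?_⟩
  · have hA : ∀ i, i ≤ d → HasWeight (dx (A.coeff i)) (d + 1 - i) := fun i hi => by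
      have := (hw i hi).dx
      rwa [show d - i + 1 = d + 1 - i by omega] at this
    cases i with
    | zero => rw [h3]; exact hA 0 (by omega)
    | succ i =>
      rw [h4]
      have h5 := hw i (by omega)
      rw [show d - i = d + 1 - (i + 1) by omega] at h5
      refine h5.add ?_
      by_cases hd : i + 1 ≤ d
      · exact hA _ hd
      · rw [h0 _ (by omega), map_zero]; exact hasWeight_zero _
  · cases i with
    | zero => omega
    | succ i => rw [h4, h0 i (by omega), h0 (i + 1) (by omega), map_zero, add_zero]
  · rw [h4, h0 (d + 1) (by omega), map_zero, add_zero]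

/-- Multiplication raises the degree by `w > 0` but not the order, whence the vanishing symbol in
degree `d + w`. -/
lemma HasSymbol.mulOp_mul {d w : ℕ} {c f : DiffPoly} {S T : Module.End ℂ DiffPoly}
    (h : HasSymbol d c S T) (hf : HasWeight f w) (hw0 : 0 < w) :
    HasSymbol (d + w) 0 (mulOp f * S) (T * mulOp f) := by
  obtain ⟨A, rfl, rfl, hw, h0, rfl⟩ := h
  refine ⟨Polynomial.C f * A, ?_, ?_, fun i hi => ?_, fun i hi => ?_, ?_⟩
  · clear hw h0
    induction A using Polynomial.induction_on' with
    | add A B hA hB => rw [mul_add, toOp_add, hA, hB, toOp_add, mul_add]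
    | monomial n p =>
      rw [Polynomial.C_mul_monomial, toOp_monomial, toOp_monomial, ← mul_assoc]
      congr 1; ext; simp [mulOp]
  · clear hw h0
    induction A using Polynomial.induction_on' with
    | add A B hA hB => rw [mul_add, conjOp_add, hA, hB, conjOp_add, add_mul]
    | monomial n p =>
      rw [Polynomial.C_mul_monomial, conjOp_monomial, conjOp_monomial, mul_assoc]
      congr 1; ext; simp [mulOp, mul_left_comm]
  · rw [Polynomial.coeff_C_mul]
    by_cases hd : i ≤ d
    · have := hf.mul (hw i hd)
      rwa [show w + (d - i) = d + w - i by omega] at this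
    · rw [h0 i (by omega), mul_zero]; exact hasWeight_zero _
  · rw [Polynomial.coeff_C_mul, h0 i (by omega), mul_zero]
  · rw [Polynomial.coeff_C_mul, h0 _ (by omega), mul_zero]

/-- The Lax operators of the hierarchy. -/
def laxOp : ℕ → Module.End ℂ DiffPoly
  | 0 => dOp
  | k + 1 => laxOp k * schrodinger + (mulOp (resolvent (k + 1)) * dOp -
      mulOp (MvPolynomial.C (1 / 2) * dx (resolvent (k + 1))))

lemma schrodinger_apply (p : DiffPoly) :
    schrodinger p = dx (dx p) - MvPolynomial.X 0 * p := by
  simp [schrodinger, pow_two, dOp_apply, mulOp_apply]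

lemma two_mul_C_half : (2 : DiffPoly) * MvPolynomial.C (1 / 2) = 1 := by
  rw [show (2 : DiffPoly) = MvPolynomial.C 2 from (map_ofNat _ 2).symm, ← map_mul]
  norm_num

/-- A telescoping induction. For `P = R_{k+1} ∂ₓ - R_{k+1}' / 2`, the Lenard recursion gives `[ℒ, P]
= 2 R_{k+1}' ℒ - 2 R_{k+2}'`, and the first term cancels `[ℒ, A_k] ℒ = -2 R_{k+1}' ℒ`. -/
lemma lie_laxOp (k : ℕ) :
    schrodinger * laxOp k - laxOp k * schrodinger = mulOp (-2 * dx (resolvent (k + 1))) := by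
  induction k with
  | zero =>
    refine LinearMap.ext fun p => ?_
    simp only [laxOp, LinearMap.sub_apply, Module.End.mul_apply, schrodinger_apply, dOp_apply,
      mulOp_apply, map_sub, dx_mul, dx_X, zero_add, resolvent_one, dx_C]
    have := two_mul_C_half
    rw [neg_div, MvPolynomial.C_neg]
    linear_combination (-(p * MvPolynomial.X 1)) * this
  | succ k ih =>
    set R := resolvent (k + 1) with hR
    have h1 : schrodinger * (mulOp R * dOp - mulOp (MvPolynomial.C (1 / 2) * dx R)) -
        (mulOp R * dOp - mulOp (MvPolynomial.C (1 / 2) * dx R)) * schrodinger =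
        mulOp (2 * dx R) * schrodinger + mulOp (-2 * dx (resolvent (k + 2))) := by
      refine LinearMap.ext fun p => ?_
      have h2 := resolvent_lenard (k + 1)
      have h3 := two_mul_C_half
      rw [← hR] at h2
      simp only [LinearMap.sub_apply, LinearMap.add_apply, Module.End.mul_apply, schrodinger_apply,
        dOp_apply, mulOp_apply, map_sub, map_add, dx_mul, dx_X, dx_C, mul_zero, add_zero, zero_add]
      linear_combination (p - p * MvPolynomial.C (1 / 2)) * h2 - p * dx (dx (dx R)) * h3 +
        (2 * p * dx (resolvent (k + 1 + 1)) + p * MvPolynomial.X 1 * R - dx (dx R) * dx p +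
          2 * p * MvPolynomial.X 0 * dx R) * h3
    have h4 : laxOp (k + 1) = laxOp k * schrodinger +
        (mulOp R * dOp - mulOp (MvPolynomial.C (1 / 2) * dx R)) := rfl
    rw [h4]
    generalize mulOp R * dOp - mulOp (MvPolynomial.C (1 / 2) * dx R) = P at h1 ⊢
    refine LinearMap.ext fun p => ?_
    have e1 := congrArg (fun T : Module.End ℂ DiffPoly => T (schrodinger p)) ih
    have e2 := congrArg (fun T : Module.End ℂ DiffPoly => T p) h1
    simp only [LinearMap.add_apply, LinearMap.sub_apply, Module.End.mul_apply, mulOp_apply,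
      map_add] at e1 e2 ⊢
    linear_combination e1 + e2

/-- `HasSymbol` is only propagated through multiplication from the left, so `ℒ` is moved across
`A_k`. The commutator adds `2 R_{k+1}'`, which turns the coefficient `-1/2` into `3/2`. -/
lemma laxOp_succ (k : ℕ) : laxOp (k + 1) = (dOp * (dOp * laxOp k) +
    mulOp (-MvPolynomial.X 0) * laxOp k) + (mulOp (resolvent (k + 1)) * dOp +
      mulOp (MvPolynomial.C (3 / 2) * dx (resolvent (k + 1))) * 1) := by
  have h := lie_laxOp k
  have h1 : laxOp k * schrodinger = schrodinger * laxOp k -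
      mulOp (-2 * dx (resolvent (k + 1))) := by rw [← h]; abel
  rw [laxOp, h1]
  refine LinearMap.ext fun p => ?_
  simp only [LinearMap.sub_apply, LinearMap.add_apply, Module.End.mul_apply, Module.End.one_apply,
    schrodinger_apply, dOp_apply, mulOp_apply]
  have h3 : (MvPolynomial.C (3 / 2) : DiffPoly) = 2 - MvPolynomial.C (1 / 2) := by
    rw [show (2 : DiffPoly) = MvPolynomial.C 2 from (map_ofNat _ 2).symm, ← map_sub]
    norm_num
  rw [h3]
  ring

lemma hasSymbol_laxOp (k : ℕ) : HasSymbol (2 * k + 1) 1 (laxOp k) (-laxOp k) := by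
  have hd : HasSymbol 1 1 dOp (-dOp) := by simpa using hasSymbol_one.dOp_mul
  induction k with
  | zero => exact hd
  | succ k ih =>
    have hw := hasWeight_resolvent (k + 1)
    have hw' : HasWeight (MvPolynomial.C (3 / 2) * dx (resolvent (k + 1))) (2 * (k + 1) + 1) := by
      simpa using MvPolynomial.IsWeightedHomogeneous.mul (hasWeight_C (3 / 2)) hw.dx
    have h1 := (ih.dOp_mul.dOp_mul.add (ih.mulOp_mul (hasWeight_X 0).neg (by omega)))
    have h2 := (hd.mulOp_mul hw (by omega))
    have h3 := hasSymbol_one.mulOp_mul hw' (by omega)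
    rw [show 1 + 2 * (k + 1) = 2 * (k + 1) + 1 by ring] at h2
    rw [zero_add] at h3
    have h4 := h1.add (h2.add h3)
    rw [← laxOp_succ] at h4
    convert h4 using 1
    · ring
    · simp
    -- Anti-symmetry: conjugating the form with `ℒ` on the left yields `-A_k ℒ - ∂ₓ R_{k+1} + (3/2)
    -- R_{k+1}'`, which is the negative of the defining form with `ℒ` on the right.
    · have : laxOp (k + 1) = laxOp k * schrodinger + (mulOp (resolvent (k + 1)) * dOp -
          mulOp (MvPolynomial.C (1 / 2) * dx (resolvent (k + 1)))) := rfl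
      rw [this]
      refine LinearMap.ext fun p => ?_
      simp only [LinearMap.sub_apply, LinearMap.add_apply, LinearMap.neg_apply,
        Module.End.mul_apply, Module.End.one_apply,
        schrodinger_apply, dOp_apply, mulOp_apply, map_sub, map_neg, dx_mul, neg_mul]
      have h3 : (MvPolynomial.C (3 / 2) : DiffPoly) = 1 + MvPolynomial.C (1 / 2) := by
        rw [show (1 : DiffPoly) = MvPolynomial.C 1 from (map_one _).symm, ← map_add]
        norm_num
      rw [h3]
      ring

lemma isKdVFlow_resolvent (k : ℕ) : IsKdVFlow k (-2 * dx (resolvent (k + 1))) := by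
  obtain ⟨A, h1, h2, h3, h4, h5⟩ := hasSymbol_laxOp k
  have hdeg : A.natDegree = 2 * k + 1 :=
    le_antisymm (Polynomial.natDegree_le_iff_coeff_eq_zero.2 h4)
      (Polynomial.le_natDegree_of_ne_zero (by rw [h5]; exact one_ne_zero))
  have h6 : ⁅schrodinger, toOp A⁆ = mulOp (-2 * dx (resolvent (k + 1))) := by
    rw [LieRing.of_associative_ring_bracket, h1, lie_laxOp]
  exact ⟨A, ⟨by rw [Polynomial.Monic, Polynomial.leadingCoeff, hdeg, h5], hdeg, h3, by rw [h1, h2],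
    _, h6⟩, h6⟩

lemma IsKdVFlow.eq {k : ℕ} {r : DiffPoly} (h : IsKdVFlow k r) :
    r = -2 * dx (resolvent (k + 1)) := h.unique (isKdVFlow_resolvent k)

/-! ### Holomorphic solutions of polynomial differential equations -/

lemma eventually_eq_zero_of_iteratedDeriv_eq_zero {f : ℂ → ℂ} (hf : AnalyticAt ℂ f 0)
    (h : ∀ n, iteratedDeriv n f 0 = 0) : ∀ᶠ x in 𝓝 0, f x = 0 := by
  rw [← analyticOrderAt_eq_top, ENat.eq_top_iff_forall_ge]
  exact fun n => (natCast_le_analyticOrderAt_iff_iteratedDeriv_eq_zero hf).2 fun i _ => h i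

lemma eventuallyEq_of_iteratedDeriv_eq {f g : ℂ → ℂ} (hf : AnalyticAt ℂ f 0)
    (hg : AnalyticAt ℂ g 0) (h : ∀ n, iteratedDeriv n f 0 = iteratedDeriv n g 0) :
    f =ᶠ[𝓝 0] g := by
  have := eventually_eq_zero_of_iteratedDeriv_eq_zero (hf.sub hg) fun n => by
    rw [iteratedDeriv_sub hf.contDiffAt hg.contDiffAt, h, sub_self]
  filter_upwards [this] with x hx
  exact sub_eq_zero.1 hx

/-- The bound says that the series `∑ aₙ xⁿ / n!` has radius of convergence at least `1 / A`. -/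
lemma exists_analyticAt_iteratedDeriv_eq {a : ℕ → ℂ} {K A : ℝ} (hA : 0 < A)
    (ha : ∀ n, ‖a n‖ ≤ K * n.factorial * A ^ n) :
    ∃ y : ℂ → ℂ, AnalyticAt ℂ y 0 ∧ ∀ n, iteratedDeriv n y 0 = a n := by
  set p := FormalMultilinearSeries.ofScalars ℂ (fun n => a n / (n.factorial : ℂ)) with hp
  have hr : 0 < p.radius := by
    have h1 : ((A⁻¹.toNNReal : NNReal) : ENNReal) ≤ p.radius := by
      refine p.le_radius_of_bound K fun n => ?_
      have hf : (0 : ℝ) < n.factorial := by exact_mod_cast n.factorial_pos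
      rw [hp, FormalMultilinearSeries.ofScalars_norm, norm_div, Complex.norm_natCast,
        Real.coe_toNNReal _ (inv_nonneg.2 hA.le), inv_pow, ← div_eq_mul_inv, div_div,
        div_le_iff₀ (by positivity)]
      linarith [ha n, mul_assoc K n.factorial (A ^ n)]
    refine lt_of_lt_of_le ?_ h1
    simpa using hA
  have hs := (p.hasFPowerSeriesOnBall hr).hasFPowerSeriesAt
  refine ⟨p.sum, hs.analyticAt, fun n => ?_⟩
  have h2 := hs.eq_formalMultilinearSeries hs.analyticAt.hasFPowerSeriesAt
  have h3 := congrFun (FormalMultilinearSeries.ofScalars_series_injective ℂ ℂ h2) n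
  have hf : (n.factorial : ℂ) ≠ 0 := by exact_mod_cast n.factorial_ne_zero
  exact ((div_left_inj' hf).1 h3).symm

/-! ### Weighted norms of polynomials and their growth under derivations -/

section Norm

variable {σ : Type*}

/-- The weighted `ℓ¹` norm of the coefficients of a polynomial. -/
def wnorm (ρ : ℝ) (p : MvPolynomial σ ℂ) : ℝ :=
  ∑ m ∈ p.support, ‖p.coeff m‖ * ρ ^ m.degree

lemma wnorm_eq_sum {ρ : ℝ} {p : MvPolynomial σ ℂ} {S : Finset (σ →₀ ℕ)} (h : p.support ⊆ S) :
    wnorm ρ p = ∑ m ∈ S, ‖p.coeff m‖ * ρ ^ m.degree :=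
  Finset.sum_subset h fun m _ hm => by simp [MvPolynomial.notMem_support_iff.1 hm]

lemma wnorm_nonneg {ρ : ℝ} (hρ : 0 ≤ ρ) (p : MvPolynomial σ ℂ) : 0 ≤ wnorm ρ p :=
  Finset.sum_nonneg fun _ _ => by positivity

lemma wnorm_add_le {ρ : ℝ} (hρ : 0 ≤ ρ) (p q : MvPolynomial σ ℂ) :
    wnorm ρ (p + q) ≤ wnorm ρ p + wnorm ρ q := by
  classical
  rw [wnorm_eq_sum (S := p.support ∪ q.support) MvPolynomial.support_add,
    wnorm_eq_sum (p := p) (S := p.support ∪ q.support) Finset.subset_union_left,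
    wnorm_eq_sum (p := q) (S := p.support ∪ q.support) Finset.subset_union_right,
    ← Finset.sum_add_distrib]
  refine Finset.sum_le_sum fun m _ => ?_
  rw [← add_mul, MvPolynomial.coeff_add]
  exact mul_le_mul_of_nonneg_right (norm_add_le _ _) (by positivity)

lemma wnorm_sum_le {ι : Type*} {ρ : ℝ} (hρ : 0 ≤ ρ) (s : Finset ι) (f : ι → MvPolynomial σ ℂ) :
    wnorm ρ (∑ i ∈ s, f i) ≤ ∑ i ∈ s, wnorm ρ (f i) := by
  classical
  induction s using Finset.induction_on with
  | empty => simp [wnorm]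
  | insert i s hi ih =>
    rw [Finset.sum_insert hi, Finset.sum_insert hi]
    exact (wnorm_add_le hρ _ _).trans (by linarith)

lemma wnorm_monomial (ρ : ℝ) (m : σ →₀ ℕ) (a : ℂ) :
    wnorm ρ (MvPolynomial.monomial m a) = ‖a‖ * ρ ^ m.degree := by
  classical
  rw [wnorm_eq_sum MvPolynomial.support_monomial_subset]
  simp

lemma wnorm_monomial_mul_le {ρ : ℝ} (hρ : 0 ≤ ρ) (m : σ →₀ ℕ) (a : ℂ) (p : MvPolynomial σ ℂ) :
    wnorm ρ (MvPolynomial.monomial m a * p) ≤ ‖a‖ * ρ ^ m.degree * wnorm ρ p := by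
  conv_lhs => rw [p.as_sum, Finset.mul_sum]
  refine (wnorm_sum_le hρ _ _).trans (le_of_eq ?_)
  rw [wnorm, Finset.mul_sum]
  refine Finset.sum_congr rfl fun m' _ => ?_
  rw [MvPolynomial.monomial_mul, wnorm_monomial, norm_mul, map_add, pow_add]
  ring

lemma norm_eval_le_wnorm {ρ : ℝ} {c : σ → ℂ} (hc : ∀ i, ‖c i‖ ≤ ρ) (p : MvPolynomial σ ℂ) :
    ‖MvPolynomial.eval c p‖ ≤ wnorm ρ p := by
  rw [MvPolynomial.eval_eq]
  refine (norm_sum_le _ _).trans (Finset.sum_le_sum fun m _ => ?_)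
  rw [norm_mul, norm_prod, Finsupp.degree_apply, ← Finset.prod_pow_eq_pow_sum]
  refine mul_le_mul_of_nonneg_left (Finset.prod_le_prod (fun _ _ => norm_nonneg _) fun i _ => ?_)
    (norm_nonneg _)
  rw [norm_pow]
  exact pow_le_pow_left₀ (norm_nonneg _) (hc i) _

lemma mkDerivation_eq_sum (V : σ → MvPolynomial σ ℂ) (p : MvPolynomial σ ℂ) :
    MvPolynomial.mkDerivation ℂ V p = ∑ m ∈ p.support, ∑ i ∈ m.support,
      MvPolynomial.monomial (m - Finsupp.single i 1) (p.coeff m * m i) * V i := by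
  conv_lhs => rw [p.as_sum, map_sum]
  refine Finset.sum_congr rfl fun m _ => ?_
  rw [MvPolynomial.mkDerivation_monomial, Finsupp.sum, Finset.smul_sum]
  refine Finset.sum_congr rfl fun i _ => ?_
  rw [smul_eq_mul, ← smul_mul_assoc, MvPolynomial.smul_monomial, smul_eq_mul]

lemma degree_sub_single {m : σ →₀ ℕ} {i : σ} (hi : i ∈ m.support) :
    (m - Finsupp.single i 1).degree + 1 = m.degree := by
  have h3 : m - Finsupp.single i 1 + Finsupp.single i 1 = m :=
    tsub_add_cancel_of_le (Finsupp.single_le_iff.2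
      (Nat.one_le_iff_ne_zero.2 (Finsupp.mem_support_iff.1 hi)))
  conv_rhs => rw [← h3]
  simp

lemma totalDegree_mkDerivation_le {V : σ → MvPolynomial σ ℂ} {d e : ℕ}
    (hV : ∀ i, (V i).totalDegree ≤ d) {p : MvPolynomial σ ℂ} (hp : p.totalDegree ≤ e) :
    (MvPolynomial.mkDerivation ℂ V p).totalDegree ≤ e + d := by
  rw [mkDerivation_eq_sum]
  refine MvPolynomial.totalDegree_finsetSum_le fun m hm =>
    MvPolynomial.totalDegree_finsetSum_le fun i hi => ?_
  refine (MvPolynomial.totalDegree_mul _ _).trans (add_le_add ?_ (hV i))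
  refine (MvPolynomial.totalDegree_monomial_le _ _).trans ?_
  have h1 := MvPolynomial.le_totalDegree hm
  have h2 := degree_sub_single hi
  rw [Finsupp.degree_apply, Finsupp.degree_apply] at h2
  simp only [Finsupp.sum] at h1 ⊢
  simp only [id] at *
  omega

/-- Differentiating a monomial of degree `m` produces `m` terms, counted with multiplicity; each
loses one variable, which does not increase the norm as `ρ ≥ 1`, and gains a factor `V i` of norm at
most `M`. The price is the degree, with no loss in `ρ`, so the estimate can be iterated. -/
lemma wnorm_mkDerivation_le {V : σ → MvPolynomial σ ℂ} {e : ℕ} {ρ M : ℝ} (hρ : 1 ≤ ρ) (hM : 0 ≤ M)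
    (hV : ∀ i, wnorm ρ (V i) ≤ M) {p : MvPolynomial σ ℂ} (hp : p.totalDegree ≤ e) :
    wnorm ρ (MvPolynomial.mkDerivation ℂ V p) ≤ e * M * wnorm ρ p := by
  have hρ0 : 0 ≤ ρ := zero_le_one.trans hρ
  rw [mkDerivation_eq_sum, wnorm.eq_def ρ p, Finset.mul_sum]
  refine (wnorm_sum_le hρ0 _ _).trans (Finset.sum_le_sum fun m hm => ?_)
  refine (wnorm_sum_le hρ0 _ _).trans ?_
  calc ∑ i ∈ m.support, wnorm ρ
        (MvPolynomial.monomial (m - Finsupp.single i 1) (p.coeff m * m i) * V i)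
      ≤ ∑ i ∈ m.support, (m i : ℝ) * (M * (‖p.coeff m‖ * ρ ^ m.degree)) := by
        refine Finset.sum_le_sum fun i hi => (wnorm_monomial_mul_le hρ0 _ _ _).trans ?_
        have h1 : ρ ^ (m - Finsupp.single i 1).degree ≤ ρ ^ m.degree :=
          pow_le_pow_right₀ hρ (by have := degree_sub_single hi; omega)
        rw [norm_mul, Complex.norm_natCast]
        calc _ ≤ ‖p.coeff m‖ * m i * ρ ^ m.degree * M := by
              gcongr
              · exact wnorm_nonneg hρ0 _
              · exact hV i
          _ = _ := by ring
    _ = (m.degree : ℝ) * (M * (‖p.coeff m‖ * ρ ^ m.degree)) := by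
        rw [← Finset.sum_mul, Finsupp.degree_apply]
        push_cast
        rfl
    _ ≤ _ := by
        rw [mul_assoc]
        have h1 := MvPolynomial.le_totalDegree hm
        have h2 : m.degree ≤ e := by
          rw [Finsupp.degree_apply]
          exact h1.trans hp
        gcongr

end Norm

lemma iterate_derivation_mul {R A : Type*} [CommRing R] [CommRing A] [Algebra R A]
    (D : Derivation R A A) (n : ℕ) (a b : A) :
    D^[n] (a * b) = ∑ i ∈ Finset.range (n + 1), n.choose i • (D^[i] a * D^[n - i] b) := by
  rw [← Finset.Nat.sum_antidiagonal_eq_sum_range_succ (fun i j => n.choose i • (D^[i] a * D^[j] b)) n]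
  induction n with
  | zero => simp
  | succ n ih =>
    rw [Finset.sum_antidiagonal_choose_succ_nsmul (M := A) (fun i j => D^[i] a * D^[j] b) n,
      Function.iterate_succ_apply', ih]
    simp only [map_sum, map_nsmul, Derivation.leibniz, smul_eq_mul, nsmul_add,
      Finset.sum_add_distrib, Function.iterate_succ_apply']
    congr 1
    refine Finset.sum_congr rfl fun ij hij => ?_
    rw [n.choose_symm_of_eq_add (Finset.HasAntidiagonal.mem_antidiagonal.1 hij).symm, mul_comm]

/-- Local existence of holomorphic solutions of a polynomial differential equation. -/
theorem exists_analytic_flow {σ : Type*} [Fintype σ] (V : σ → MvPolynomial σ ℂ) (c : σ → ℂ) :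
    ∃ y : ℂ → σ → ℂ, (∀ i, AnalyticAt ℂ (fun x => y x i) 0) ∧ y 0 = c ∧
      ∀ᶠ x in 𝓝 0, ∀ i, HasDerivAt (fun x => y x i) (MvPolynomial.eval (y x) (V i)) x := by
  classical
  set D := MvPolynomial.mkDerivation ℂ V with hD
  set ρ : ℝ := 1 + ∑ i, ‖c i‖ with hρ
  have hρ1 : 1 ≤ ρ := le_add_of_nonneg_right (Finset.sum_nonneg fun _ _ => norm_nonneg _)
  have hρ0 : 0 ≤ ρ := zero_le_one.trans hρ1
  have hc : ∀ i, ‖c i‖ ≤ ρ := fun i => by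
    have := Finset.single_le_sum (f := fun i => ‖c i‖) (fun _ _ => norm_nonneg _) (Finset.mem_univ i)
    linarith
  set M : ℝ := 1 + ∑ i, wnorm ρ (V i) with hM
  have hV : ∀ i, wnorm ρ (V i) ≤ M := fun i => by
    have := Finset.single_le_sum (f := fun i => wnorm ρ (V i)) (fun _ _ => wnorm_nonneg hρ0 _)
      (Finset.mem_univ i)
    linarith
  have hM0 : 0 < M := add_pos_of_pos_of_nonneg one_pos
    (Finset.sum_nonneg fun _ _ => wnorm_nonneg hρ0 _)
  set d : ℕ := ∑ i, (V i).totalDegree with hd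
  have hVd : ∀ i, (V i).totalDegree ≤ d := fun i =>
    Finset.single_le_sum (f := fun i => (V i).totalDegree) (fun _ _ => Nat.zero_le _)
      (Finset.mem_univ i)
  have hdeg : ∀ i n, (D^[n] (MvPolynomial.X i)).totalDegree ≤ 1 + n * d := fun i n => by
    induction n with
    | zero => simp
    | succ n ih =>
      rw [Function.iterate_succ_apply']
      exact (totalDegree_mkDerivation_le hVd ih).trans (by ring_nf; omega)
  -- The degree after `n` steps is at most `1 + n d ≤ (n + 1) (1 + d)`, so the next step costs at
  -- most the factor `(n + 1) (1 + d) M`. The product of these factors is the factorial bound needed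
  -- for a convergent Taylor series.
  have hnorm : ∀ i n, wnorm ρ (D^[n] (MvPolynomial.X i)) ≤
      ρ * n.factorial * ((1 + d) * M) ^ n := fun i n => by
    induction n with
    | zero =>
      rw [Function.iterate_zero, id, MvPolynomial.X, wnorm_monomial]
      simp
    | succ n ih =>
      rw [Function.iterate_succ_apply']
      refine (wnorm_mkDerivation_le hρ1 hM0.le hV (hdeg i n)).trans ?_
      have h1 : ((1 + n * d : ℕ) : ℝ) ≤ (n + 1) * (1 + d) := by
        push_cast
        nlinarith [Nat.cast_nonneg (α := ℝ) n, Nat.cast_nonneg (α := ℝ) d]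
      calc ((1 + n * d : ℕ) : ℝ) * M * wnorm ρ (D^[n] (MvPolynomial.X i))
          ≤ ((n + 1) * (1 + d)) * M * (ρ * n.factorial * ((1 + d) * M) ^ n) := by
            have := wnorm_nonneg hρ0 (D^[n] (MvPolynomial.X i))
            gcongr
        _ = _ := by
            rw [Nat.factorial_succ]
            push_cast
            ring
  -- A solution must have the Taylor coefficients `(Dⁿ Xᵢ)(c)`, where `D` is the derivation of the
  -- vector field; they are taken as the definition.
  have hy : ∀ i, ∃ y : ℂ → ℂ, AnalyticAt ℂ y 0 ∧
      ∀ n, iteratedDeriv n y 0 = MvPolynomial.eval c (D^[n] (MvPolynomial.X i)) := fun i =>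
    exists_analyticAt_iteratedDeriv_eq (K := ρ) (A := (1 + d) * M) (by positivity)
      fun n => (norm_eval_le_wnorm hc _).trans (hnorm i n)
  choose y hya hyd using hy
  have hana : ∀ p : MvPolynomial σ ℂ,
      AnalyticAt ℂ (fun x => MvPolynomial.eval (fun i => y i x) p) 0 := fun p =>
    AnalyticAt.aeval_mvPolynomial (f := fun x i => y i x) hya p
  -- Both sides obey the Leibniz formula in `p`, so agreement on the variables suffices. For `p = V
  -- i` it says that `yᵢ'` and `V i (y)` have the same Taylor coefficients.
  have key : ∀ p : MvPolynomial σ ℂ, ∀ n, iteratedDeriv n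
      (fun x => MvPolynomial.eval (fun i => y i x) p) 0 = MvPolynomial.eval c (D^[n] p) := by
    intro p
    induction p using MvPolynomial.induction_on with
    | C a =>
      intro n
      simp only [MvPolynomial.eval_C]
      cases n with
      | zero => simp
      | succ n =>
        rw [Function.iterate_succ_apply, iteratedDeriv_const, if_neg (Nat.succ_ne_zero n), hD,
          MvPolynomial.derivation_C, iterate_map_zero, map_zero]
    | add p q hp hq =>
      intro n
      simp only [map_add]
      rw [iterate_map_add, map_add, ← hp, ← hq]
      exact iteratedDeriv_add (hana p).contDiffAt (hana q).contDiffAt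
    | mul_X p i hp =>
      intro n
      simp only [map_mul, MvPolynomial.eval_X]
      have := iteratedDeriv_mul (n := n) (hana p).contDiffAt (hya i).contDiffAt
      rw [iterate_derivation_mul, map_sum]
      refine Eq.trans this (Finset.sum_congr rfl fun k _ => ?_)
      rw [hp, hyd, map_nsmul, map_mul, nsmul_eq_mul, mul_assoc]
  refine ⟨fun x i => y i x, hya, funext fun i => by simpa using hyd i 0, ?_⟩
  rw [Filter.eventually_all]
  intro i
  have h1 : deriv (y i) =ᶠ[𝓝 0] fun x => MvPolynomial.eval (fun j => y j x) (V i) := by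
    refine eventuallyEq_of_iteratedDeriv_eq (hya i).deriv (hana _) fun n => ?_
    rw [key, ← iteratedDeriv_succ', hyd, Function.iterate_succ_apply, hD,
      MvPolynomial.mkDerivation_X]
  filter_upwards [h1, (hya i).eventually_analyticAt] with x hx hx'
  rw [← hx]
  exact hx'.differentiableAt.hasDerivAt

/-! ### Evaluation of differential polynomials on holomorphic functions -/

lemma evalJet_add (f : ℂ → ℂ) (x : ℂ) (p q : DiffPoly) :
    evalJet f x (p + q) = evalJet f x p + evalJet f x q := map_add _ _ _

lemma evalJet_mul (f : ℂ → ℂ) (x : ℂ) (p q : DiffPoly) :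
    evalJet f x (p * q) = evalJet f x p * evalJet f x q := map_mul _ _ _

lemma evalJet_sub (f : ℂ → ℂ) (x : ℂ) (p q : DiffPoly) :
    evalJet f x (p - q) = evalJet f x p - evalJet f x q := map_sub _ _ _

@[simp] lemma evalJet_C (f : ℂ → ℂ) (x c : ℂ) : evalJet f x (MvPolynomial.C c) = c :=
  MvPolynomial.eval_C _

@[simp] lemma evalJet_X (f : ℂ → ℂ) (x : ℂ) (n : ℕ) :
    evalJet f x (MvPolynomial.X n) = iteratedDeriv n f x := MvPolynomial.eval_X _

lemma evalJet_sum {ι : Type*} (f : ℂ → ℂ) (x : ℂ) (s : Finset ι) (p : ι → DiffPoly) :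
    evalJet f x (∑ i ∈ s, p i) = ∑ i ∈ s, evalJet f x (p i) := map_sum _ _ _

lemma analyticAt_iteratedDeriv {f : ℂ → ℂ} {x : ℂ} (hf : AnalyticAt ℂ f x) (n : ℕ) :
    AnalyticAt ℂ (iteratedDeriv n f) x := by
  rw [iteratedDeriv_eq_iterate]; exact hf.iterated_deriv n

lemma analyticAt_evalJet {f : ℂ → ℂ} {x : ℂ} (hf : AnalyticAt ℂ f x) (p : DiffPoly) :
    AnalyticAt ℂ (fun x => evalJet f x p) x :=
  AnalyticAt.aeval_mvPolynomial (f := fun x n => iteratedDeriv n f x)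
    (fun n => analyticAt_iteratedDeriv hf n) p

lemma hasDerivAt_evalJet {f : ℂ → ℂ} {x : ℂ} (hf : AnalyticAt ℂ f x) (p : DiffPoly) :
    HasDerivAt (fun x => evalJet f x p) (evalJet f x (dx p)) x := by
  induction p using MvPolynomial.induction_on with
  | C a => simpa [evalJet] using hasDerivAt_const x a
  | add p q hp hq =>
    simp only [map_add, evalJet_add]
    exact hp.add hq
  | mul_X p n hp =>
    have h := (analyticAt_iteratedDeriv hf n).differentiableAt.hasDerivAt
    rw [← iteratedDeriv_succ] at h
    simp only [dx_mul, dx_X, evalJet_add, evalJet_mul, evalJet_X]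
    exact (hp.mul h).congr_deriv (by ring)

lemma eval_eq_of_mem_jets {N : ℕ} {v w : ℕ → ℂ} (h : ∀ n < N, v n = w n) {p : DiffPoly}
    (hp : p ∈ jets N) : MvPolynomial.eval v p = MvPolynomial.eval w p := by
  refine jets_induction (P := fun p => MvPolynomial.eval v p = MvPolynomial.eval w p) (N := N)
    (fun c => by simp) (fun n hn => by simpa using h n hn) (fun p q hp hq => by simp [hp, hq])
    (fun p q hp hq => by simp [hp, hq]) hp

lemma eventually_evalJet_dx_eq {f : ℂ → ℂ} (hf : AnalyticAt ℂ f 0) {p q : DiffPoly}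
    (h : ∀ᶠ x in 𝓝 0, evalJet f x p = evalJet f x q) :
    ∀ᶠ x in 𝓝 0, evalJet f x (dx p) = evalJet f x (dx q) := by
  filter_upwards [h.eventually_nhds, hf.eventually_analyticAt] with x hx hfx
  exact (hasDerivAt_evalJet hfx p).unique
    ((hasDerivAt_evalJet hfx q).congr_of_eventuallyEq hx)

/-! ### The stationary equation as an ordinary differential equation -/

/-- The stationary equation is `∂ₓ` of this differential polynomial. -/
def stationaryPoly (g : ℕ) (a : Fin (g - 1) → ℂ) : DiffPoly :=
  resolvent (g + 1) + ∑ k : Fin (g - 1), MvPolynomial.C (a k) * resolvent (k + 1)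

lemma solvesStationaryKdV_iff {g : ℕ} {a : Fin (g - 1) → ℂ} {f : ℂ → ℂ} :
    SolvesStationaryKdV g a f ↔ ∀ᶠ x in 𝓝 0, evalJet f x (dx (stationaryPoly g a)) = 0 := by
  have key : ∀ x, evalJet f x (-2 * dx (resolvent (g + 1))) +
      ∑ k : Fin (g - 1), a k * evalJet f x (-2 * dx (resolvent (k + 1))) =
      -2 * evalJet f x (dx (stationaryPoly g a)) := fun x => by
    have h2 : (-2 : DiffPoly) = MvPolynomial.C (-2) := by
      rw [MvPolynomial.C_neg, show (MvPolynomial.C 2 : DiffPoly) = 2 from map_ofNat _ 2]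
    simp only [stationaryPoly, map_add, map_sum, dx_mul, dx_C, mul_zero, add_zero, evalJet_add,
      evalJet_sum, evalJet_mul, evalJet_C, h2, mul_add, Finset.mul_sum]
    congr 1
    exact Finset.sum_congr rfl fun k _ => by ring
  constructor
  · rintro ⟨r, hr, h⟩
    filter_upwards [h] with x hx
    rw [(hr g).eq] at hx
    simp only [fun k => (hr k).eq] at hx
    rw [key] at hx
    simpa using hx
  · intro h
    refine ⟨fun k => -2 * dx (resolvent (k + 1)), isKdVFlow_resolvent, ?_⟩
    filter_upwards [h] with x hx
    rw [key, hx, mul_zero]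

/-- The variable `u⁽²ᵍ⁾` enters `R_{g+1}` linearly with a constant coefficient, and the `R_{k+1}`
with `k ≤ g - 2` have smaller order. After `∂ₓ`, the highest derivative can thus be isolated without
dividing by a function. -/
lemma exists_dx_stationaryPoly_eq (g : ℕ) (a : Fin (g - 1) → ℂ) :
    ∃ c : ℂ, c ≠ 0 ∧ ∃ P ∈ jets (2 * g + 1), dx (stationaryPoly g a) =
      MvPolynomial.C c * (MvPolynomial.X (2 * g + 1) - P) := by
  obtain ⟨c, hc, h⟩ := exists_resolvent_sub_mem_jets g
  set Q := stationaryPoly g a - MvPolynomial.C c * MvPolynomial.X (2 * g) with hQ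
  have hQj : Q ∈ jets (2 * g) := by
    rw [hQ, stationaryPoly, add_sub_right_comm]
    exact add_mem h (sum_mem fun k _ => mul_mem (C_mem_jets _ _)
      (jets_mono (by omega) (resolvent_mem_jets _)))
  refine ⟨c, hc, -(MvPolynomial.C c⁻¹ * dx Q),
    neg_mem (mul_mem (C_mem_jets _ _) (dx_mem_jets hQj)), ?_⟩
  have h1 : (MvPolynomial.C c * MvPolynomial.C c⁻¹ : DiffPoly) = 1 := by
    rw [← map_mul, mul_inv_cancel₀ hc, map_one]
  have h2 : dx Q = dx (stationaryPoly g a) - MvPolynomial.C c * MvPolynomial.X (2 * g + 1) := by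
    rw [hQ, map_sub, dx_mul, dx_X, dx_C]
    ring
  linear_combination (-dx Q) * h1 - h2

/-- The highest derivative in the stationary equation, expressed by the lower ones. -/
lemma exists_stationary_normalForm (g : ℕ) (a : Fin (g - 1) → ℂ) :
    ∃ P ∈ jets (2 * g + 1), ∀ f : ℂ → ℂ, SolvesStationaryKdV g a f ↔
      ∀ᶠ x in 𝓝 0, evalJet f x (MvPolynomial.X (2 * g + 1)) = evalJet f x P := by
  obtain ⟨c, hc, P, hP, h⟩ := exists_dx_stationaryPoly_eq g a
  refine ⟨P, hP, fun f => ?_⟩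
  rw [solvesStationaryKdV_iff, h]
  refine eventually_congr (Eventually.of_forall fun x => ?_)
  rw [evalJet_mul, evalJet_C, evalJet_sub, mul_eq_zero, sub_eq_zero]
  simp [hc]

/-- Repeated differentiation of the normal form expresses each `u⁽²ᵍ⁺¹⁺ᵐ⁾` by lower derivatives, so
all Taylor coefficients follow from the first `2g + 1`. -/
lemma eventuallyEq_of_solvesStationaryKdV {g : ℕ} {a : Fin (g - 1) → ℂ} {f h : ℂ → ℂ}
    (hf : AnalyticAt ℂ f 0) (hh : AnalyticAt ℂ h 0) (hfs : SolvesStationaryKdV g a f)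
    (hhs : SolvesStationaryKdV g a h)
    (h0 : ∀ k < 2 * g + 1, iteratedDeriv k f 0 = iteratedDeriv k h 0) : f =ᶠ[𝓝 0] h := by
  obtain ⟨P, hP, hiff⟩ := exists_stationary_normalForm g a
  have hstep : ∀ f : ℂ → ℂ, AnalyticAt ℂ f 0 → SolvesStationaryKdV g a f → ∀ m,
      ∀ᶠ x in 𝓝 0, evalJet f x (MvPolynomial.X (2 * g + 1 + m)) = evalJet f x (dx^[m] P) := by
    intro f hf hs m
    induction m with
    | zero => exact (hiff f).1 hs
    | succ m ih =>
      have := eventually_evalJet_dx_eq hf ih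
      rwa [dx_X, ← Function.iterate_succ_apply' dx] at this
  have hmem : ∀ m, dx^[m] P ∈ jets (2 * g + 1 + m) := fun m => by
    induction m with
    | zero => exact hP
    | succ m ih => rw [Function.iterate_succ_apply']; exact dx_mem_jets ih
  refine eventuallyEq_of_iteratedDeriv_eq hf hh fun n => ?_
  induction n using Nat.strong_induction_on with
  | _ n ih =>
    by_cases hn : n < 2 * g + 1
    · exact h0 n hn
    · obtain ⟨m, rfl⟩ := Nat.exists_eq_add_of_le (not_lt.1 hn)
      have h1 := (hstep f hf hfs m).self_of_nhds
      have h2 := (hstep h hh hhs m).self_of_nhds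
      rw [evalJet_X] at h1 h2
      rw [h1, h2]
      exact eval_eq_of_mem_jets ih (hmem m)

/-- The normal form becomes the companion system `yᵢ' = yᵢ₊₁`, whose last equation has the
polynomial `P` on the right. -/
lemma exists_solvesStationaryKdV (g : ℕ) (a : Fin (g - 1) → ℂ) (c : Fin (2 * g + 1) → ℂ) :
    ∃ f : ℂ → ℂ, AnalyticAt ℂ f 0 ∧ SolvesStationaryKdV g a f ∧
      ∀ k : Fin (2 * g + 1), iteratedDeriv k f 0 = c k := by
  obtain ⟨P, hP, hiff⟩ := exists_stationary_normalForm g a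
  -- The default value `0` is harmless, because `P` contains no variable of index `2g + 1` or more.
  set P' : MvPolynomial (Fin (2 * g + 1)) ℂ := MvPolynomial.aeval
    (fun n : ℕ => if h : n < 2 * g + 1 then MvPolynomial.X ⟨n, h⟩ else 0) P with hP'
  obtain ⟨y, hya, hy0, hy⟩ := exists_analytic_flow (fun i : Fin (2 * g + 1) =>
    if h : (i : ℕ) + 1 < 2 * g + 1 then MvPolynomial.X ⟨i + 1, h⟩ else P') c
  set f : ℂ → ℂ := fun x => y x 0 with hf
  have hjet : ∀ n (hn : n < 2 * g + 1), iteratedDeriv n f =ᶠ[𝓝 0] fun x => y x ⟨n, hn⟩ := by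
    intro n
    induction n with
    | zero => intro hn; rw [iteratedDeriv_zero]; exact EventuallyEq.rfl
    | succ n ih =>
      intro hn
      rw [iteratedDeriv_succ]
      refine (ih (by omega)).deriv.trans ?_
      filter_upwards [hy] with x hx
      have := (hx ⟨n, by omega⟩).deriv
      simp only [hn, dif_pos, MvPolynomial.eval_X] at this
      exact this
  have hall : ∀ᶠ x in 𝓝 0, ∀ n (hn : n < 2 * g + 1), iteratedDeriv n f x = y x ⟨n, hn⟩ := by
    have : ∀ᶠ x in 𝓝 0, ∀ i : Fin (2 * g + 1), iteratedDeriv i f x = y x i :=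
      eventually_all.2 fun i => hjet i i.2
    exact this.mono fun x hx n hn => hx ⟨n, hn⟩
  refine ⟨f, hya 0, (hiff f).2 ?_, fun k => ?_⟩
  · have h1 := (hjet (2 * g) (by omega)).deriv
    filter_upwards [h1, hy, hall] with x hx hyx hax
    rw [evalJet_X, iteratedDeriv_succ, hx, (hyx ⟨2 * g, by omega⟩).deriv, dif_neg (by simp), hP',
      evalJet, MvPolynomial.aeval_def, ← MvPolynomial.coe_eval₂Hom, ← RingHom.comp_apply]
    have : (MvPolynomial.eval (y x)).comp (MvPolynomial.eval₂Hom
        (algebraMap ℂ (MvPolynomial (Fin (2 * g + 1)) ℂ))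
        fun n : ℕ => if h : n < 2 * g + 1 then MvPolynomial.X ⟨n, h⟩ else 0) =
        MvPolynomial.eval fun n : ℕ => if h : n < 2 * g + 1 then y x ⟨n, h⟩ else 0 := by
      refine MvPolynomial.ringHom_ext (fun c => by simp) fun n => ?_
      simp only [RingHom.comp_apply, MvPolynomial.eval₂Hom_X', MvPolynomial.eval_X]
      split_ifs <;> simp
    rw [this]
    refine eval_eq_of_mem_jets (fun n hn => ?_) hP
    rw [dif_pos hn, hax n hn]
  · rw [(hjet k k.2).self_of_nhds]
    exact congrFun hy0 k

lemma SolutionSpace.ext' {g : ℕ} {s t : SolutionSpace g} (hu : s.u = t.u) (ha : s.a = t.a) :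
    s = t := by
  cases s; cases t; simp_all

/-- The coordinates `u⁽ᵏ⁾(0)`, `a_k` identify the space of solutions with an affine space. -/
theorem SolutionSpace.coords_bijective (g : ℕ) :
    Function.Bijective (SolutionSpace.coords (g := g)) := by
  constructor
  · intro s t hst
    have ha : s.a = t.a := funext fun k => congrFun hst (Sum.inr k)
    obtain ⟨f, hf, hfa, hfs⟩ := s.regular
    obtain ⟨h, hh, hha, hhs⟩ := t.regular
    refine SolutionSpace.ext' ?_ ha
    rw [← hf, ← hh]
    refine Germ.coe_eq.2 (eventuallyEq_of_solvesStationaryKdV hfa hha hfs (ha ▸ hhs) fun k hk => ?_)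
    have := congrFun hst (Sum.inl ⟨k, hk⟩)
    simp only [coords, Sum.elim_inl, ← hf, ← hh] at this
    exact this
  · intro c
    obtain ⟨f, hfa, hfs, hf⟩ := exists_solvesStationaryKdV g (fun k => c (Sum.inr k))
      fun k => c (Sum.inl k)
    refine ⟨⟨f, fun k => c (Sum.inr k), f, rfl, hfa, hfs⟩, funext fun k => ?_⟩
    cases k with
    | inl k => exact hf k
    | inr k => rfl

/-! ### Generating functions of holomorphic functions -/

/-- The quadratic form `quad`, evaluated at `x` on the series `∑ Hₙ ξⁿ` of functions. -/
def quadF (u : ℂ → ℂ) (H : ℕ → ℂ → ℂ) (x : ℂ) : PowerSeries ℂ :=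
  quad (u x) (PowerSeries.mk fun n => H n x) (PowerSeries.mk fun n => deriv (H n) x)
    (PowerSeries.mk fun n => deriv (deriv (H n)) x)

/-- The Lenard operator, evaluated at `x` on the series `∑ Hₙ ξⁿ` of functions. -/
def lenardF (u : ℂ → ℂ) (H : ℕ → ℂ → ℂ) (x : ℂ) : PowerSeries ℂ :=
  lenard (u x) (deriv u x) (PowerSeries.mk fun n => H n x)
    (PowerSeries.mk fun n => deriv (H n) x) (PowerSeries.mk fun n => deriv (deriv (deriv (H n))) x)

lemma coeff_quad_succ_congr {B : Type*} [CommRing B] {u : B} {F F₁ F₂ G G₁ G₂ : PowerSeries B}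
    {n : ℕ} (h : ∀ k ≤ n, PowerSeries.coeff k F = PowerSeries.coeff k G)
    (h₁ : ∀ k ≤ n, PowerSeries.coeff k F₁ = PowerSeries.coeff k G₁)
    (h₂ : ∀ k ≤ n, PowerSeries.coeff k F₂ = PowerSeries.coeff k G₂) :
    PowerSeries.coeff (n + 1) (quad u F F₁ F₂) - PowerSeries.coeff (n + 1) (quad u G G₁ G₂) =
      8 * PowerSeries.coeff 0 F * (PowerSeries.coeff (n + 1) F - PowerSeries.coeff (n + 1) G) := by
  have e1 : ∑ i ∈ Finset.range n, PowerSeries.coeff (i + 1) F * PowerSeries.coeff (n - i) F =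
      ∑ i ∈ Finset.range n, PowerSeries.coeff (i + 1) G * PowerSeries.coeff (n - i) G :=
    Finset.sum_congr rfl fun i hi => by
      have := Finset.mem_range.1 hi
      rw [h _ (by omega), h _ (by omega)]
  rw [coeff_quad_succ, coeff_quad_succ, e1, h 0 (Nat.zero_le _)]
  have e2 : ∀ i ∈ Finset.range (n + 1),
      (PowerSeries.coeff i F₁ * PowerSeries.coeff (n - i) F₁ -
        2 * (PowerSeries.coeff i F * PowerSeries.coeff (n - i) F₂) +
        4 * (u * (PowerSeries.coeff i F * PowerSeries.coeff (n - i) F))) =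
      (PowerSeries.coeff i G₁ * PowerSeries.coeff (n - i) G₁ -
        2 * (PowerSeries.coeff i G * PowerSeries.coeff (n - i) G₂) +
        4 * (u * (PowerSeries.coeff i G * PowerSeries.coeff (n - i) G))) := fun i hi => by
    have := Finset.mem_range.1 hi
    rw [h i (by omega), h₁ i (by omega), h (n - i) (by omega), h₁ (n - i) (by omega),
      h₂ (n - i) (by omega)]
  rw [Finset.sum_congr rfl e2]
  ring

/-- A series of functions with constant term `2` is determined, up to order `g`, by the values of
the quadratic form up to order `g`. -/
lemma eventuallyEq_of_coeff_quadF_eq {u v : ℂ → ℂ} {H K : ℕ → ℂ → ℂ} {g : ℕ} (huv : u =ᶠ[𝓝 0] v)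
    (hH : H 0 =ᶠ[𝓝 0] fun _ => 2) (hK : K 0 =ᶠ[𝓝 0] fun _ => 2)
    (h : ∀ n < g, ∀ᶠ x in 𝓝 0, PowerSeries.coeff (n + 1) (quadF u H x) =
      PowerSeries.coeff (n + 1) (quadF v K x)) (n : ℕ) (hn : n ≤ g) : H n =ᶠ[𝓝 0] K n := by
  induction n using Nat.strong_induction_on with
  | _ n ih =>
    cases n with
    | zero => exact hH.trans hK.symm
    | succ n =>
      have ih' : ∀ᶠ x in 𝓝 0, ∀ k ∈ Finset.range (n + 1), H k x = K k x ∧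
          deriv (H k) x = deriv (K k) x ∧ deriv (deriv (H k)) x = deriv (deriv (K k)) x := by
        rw [eventually_all_finset]
        intro k hk
        have := ih k (Finset.mem_range.1 hk) (by have := Finset.mem_range.1 hk; omega)
        exact this.and (this.deriv.and this.deriv.deriv)
      filter_upwards [ih', h n (by omega), huv, hH] with x hx hq hu h0
      have h1 := fun k (hk : k ≤ n) => hx k (Finset.mem_range.2 (by omega))
      rw [quadF, quadF, hu, ← sub_eq_zero, coeff_quad_succ_congr
        (fun k hk => by simpa using (h1 k hk).1) (fun k hk => by simpa using (h1 k hk).2.1)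
        (fun k hk => by simpa using (h1 k hk).2.2)] at hq
      simp only [PowerSeries.coeff_mk, h0] at hq
      exact sub_eq_zero.1 ((mul_eq_zero.1 hq).resolve_left (by norm_num))

/-- Coefficientwise differentiability of a family of power series. -/
def HasCoeffDerivAt (F : ℂ → PowerSeries ℂ) (F' : PowerSeries ℂ) (x : ℂ) : Prop :=
  ∀ n, HasDerivAt (fun z => PowerSeries.coeff n (F z)) (PowerSeries.coeff n F') x

/-! ### Rules of differentiation for families of power series -/

namespace HasCoeffDerivAt

variable {F G : ℂ → PowerSeries ℂ} {F' G' : PowerSeries ℂ} {x : ℂ}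

lemma const (A : PowerSeries ℂ) : HasCoeffDerivAt (fun _ => A) 0 x := fun n => by
  simpa using hasDerivAt_const x (PowerSeries.coeff n A)

lemma constC {f : ℂ → ℂ} {f' : ℂ} (h : HasDerivAt f f' x) :
    HasCoeffDerivAt (fun z => PowerSeries.C (f z)) (PowerSeries.C f') x := fun n => by
  simp only [PowerSeries.coeff_C]
  split_ifs
  · exact h
  · exact hasDerivAt_const x 0

lemma add (hF : HasCoeffDerivAt F F' x) (hG : HasCoeffDerivAt G G' x) :
    HasCoeffDerivAt (fun z => F z + G z) (F' + G') x := fun n => by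
  simp only [map_add]; exact (hF n).add (hG n)

lemma sub (hF : HasCoeffDerivAt F F' x) (hG : HasCoeffDerivAt G G' x) :
    HasCoeffDerivAt (fun z => F z - G z) (F' - G') x := fun n => by
  simp only [map_sub]; exact (hF n).sub (hG n)

lemma mul (hF : HasCoeffDerivAt F F' x) (hG : HasCoeffDerivAt G G' x) :
    HasCoeffDerivAt (fun z => F z * G z) (F' * G x + F x * G') x := fun n => by
  simp only [PowerSeries.coeff_mul, map_add, ← Finset.sum_add_distrib]
  exact HasDerivAt.fun_sum fun p _ => (hF p.1).mul (hG p.2)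

end HasCoeffDerivAt

/-- The identity of `dxSeries_quad` for arbitrary holomorphic coefficients. It is needed in this
generality because a solution of the Lenard system is not known beforehand to consist of
differential polynomials in `u`. -/
lemma hasCoeffDerivAt_quadF {u : ℂ → ℂ} {H : ℕ → ℂ → ℂ} {x : ℂ} (hu : AnalyticAt ℂ u x)
    (hH : ∀ n, AnalyticAt ℂ (H n) x) : HasCoeffDerivAt (quadF u H)
      (2 * (PowerSeries.mk fun n => H n x) * lenardF u H x) x := by
  have h0 : HasCoeffDerivAt (fun z => PowerSeries.mk fun n => H n z)
      (PowerSeries.mk fun n => deriv (H n) x) x := fun n => by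
    simpa using (hH n).differentiableAt.hasDerivAt
  have h1 : HasCoeffDerivAt (fun z => PowerSeries.mk fun n => deriv (H n) z)
      (PowerSeries.mk fun n => deriv (deriv (H n)) x) x := fun n => by
    simpa using (hH n).deriv.differentiableAt.hasDerivAt
  have h2 : HasCoeffDerivAt (fun z => PowerSeries.mk fun n => deriv (deriv (H n)) z)
      (PowerSeries.mk fun n => deriv (deriv (deriv (H n))) x) x := fun n => by
    simpa using (hH n).deriv.deriv.differentiableAt.hasDerivAt
  have hU := HasCoeffDerivAt.constC hu.differentiableAt.hasDerivAt
  have h := ((HasCoeffDerivAt.const PowerSeries.X).mul (((h1.mul h1).sub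
    ((HasCoeffDerivAt.const 2).mul (h0.mul h2))).add
    ((HasCoeffDerivAt.const 4).mul (hU.mul (h0.mul h0))))).add
    ((HasCoeffDerivAt.const 4).mul (h0.mul h0))
  unfold quadF quad lenardF lenard
  simp only [pow_two]
  convert h using 1
  ring

/-- By `hasCoeffDerivAt_quadF` the coefficients have derivative zero on a ball, which is convex, so
they are constant there. -/
lemma eventually_quadF_eq {u : ℂ → ℂ} {H : ℕ → ℂ → ℂ} (hu : AnalyticAt ℂ u 0)
    (hHe : ∀ᶠ x in 𝓝 0, ∀ n, AnalyticAt ℂ (H n) x)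
    (h : ∀ᶠ x in 𝓝 0, lenardF u H x = 0) (n : ℕ) :
    ∀ᶠ x in 𝓝 0, PowerSeries.coeff n (quadF u H x) = PowerSeries.coeff n (quadF u H 0) := by
  have hd : ∀ᶠ x in 𝓝 0, HasDerivAt (fun z => PowerSeries.coeff n (quadF u H z)) 0 x := by
    filter_upwards [hHe, hu.eventually_analyticAt, h] with x hHx hux hx
    have := hasCoeffDerivAt_quadF hux hHx n
    rwa [hx, mul_zero, map_zero] at this
  obtain ⟨ε, hε, hball⟩ := Metric.eventually_nhds_iff_ball.1 hd
  refine Metric.eventually_nhds_iff_ball.2 ⟨ε, hε, fun y hy => ?_⟩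
  exact (convex_ball (0 : ℂ) ε).is_const_of_fderivWithin_eq_zero (𝕜 := ℂ)
    (f := fun z => PowerSeries.coeff n (quadF u H z))
    (fun z hz => (hball z hz).differentiableAt.differentiableWithinAt)
    (fun z hz => by
      rw [fderivWithin_of_isOpen Metric.isOpen_ball hz, (hball z hz).hasFDerivAt.fderiv]
      ext; simp) hy (Metric.mem_ball_self hε)

/-! ### Multiples of the resolvent -/

/-- `2 φ R`, for a power series `φ` with constant coefficients. -/
def resolventMul (φ : PowerSeries ℂ) : PowerSeries DiffPoly :=
  2 * (PowerSeries.map MvPolynomial.C φ * resolventSeries)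

lemma dxSeries_map_C (φ : PowerSeries ℂ) :
    dxSeries (PowerSeries.map (MvPolynomial.C : ℂ →+* DiffPoly) φ) = 0 := by
  ext1 n
  simp

lemma dxSeries_resolventMul_aux (φ : PowerSeries ℂ) (G : PowerSeries DiffPoly) :
    dxSeries (2 * (PowerSeries.map MvPolynomial.C φ * G)) =
      2 * (PowerSeries.map MvPolynomial.C φ * dxSeries G) := by
  have h2 : dxSeries 2 = 0 := by exact_mod_cast dxSeries_natCast 2
  rw [dxSeries_mul, dxSeries_mul, dxSeries_map_C, h2]
  ring

/-- A series with constant coefficients leaves the quadratic form as a square, so `4` is multiplied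
by `(2 φ)²`. The factor `2` matches the constant term of `2 - 𝐮`. -/
lemma quad_resolventMul (φ : PowerSeries ℂ) :
    quad (MvPolynomial.X 0) (resolventMul φ) (dxSeries (resolventMul φ))
      (dxSeries (dxSeries (resolventMul φ))) = PowerSeries.map MvPolynomial.C (16 * φ ^ 2) := by
  simp only [resolventMul, dxSeries_resolventMul_aux, map_mul, map_pow, map_ofNat]
  have h := quad_resolventSeries
  unfold quad at h ⊢
  linear_combination 4 * (PowerSeries.map MvPolynomial.C φ) ^ 2 * h

lemma lenard_resolventMul (φ : PowerSeries ℂ) :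
    lenard (MvPolynomial.X 0) (MvPolynomial.X 1) (resolventMul φ) (dxSeries (resolventMul φ))
      (dxSeries (dxSeries (dxSeries (resolventMul φ)))) = 0 := by
  simp only [resolventMul, dxSeries_resolventMul_aux]
  have h := lenard_resolventSeries
  unfold lenard at h ⊢
  linear_combination 2 * (PowerSeries.map MvPolynomial.C φ) * h

/-- The values of the coefficients of `2 φ R` on the function `f`. -/
def resolventFun (φ : PowerSeries ℂ) (f : ℂ → ℂ) (n : ℕ) (x : ℂ) : ℂ :=
  evalJet f x (PowerSeries.coeff n (resolventMul φ))

lemma analyticAt_resolventFun (φ : PowerSeries ℂ) {f : ℂ → ℂ} {x : ℂ} (hf : AnalyticAt ℂ f x)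
    (n : ℕ) : AnalyticAt ℂ (resolventFun φ f n) x := analyticAt_evalJet hf _

lemma deriv_evalJet {f : ℂ → ℂ} {x : ℂ} (hf : AnalyticAt ℂ f x) (p : DiffPoly) :
    deriv (fun x => evalJet f x p) =ᶠ[𝓝 x] fun x => evalJet f x (dx p) :=
  hf.eventually_analyticAt.mono fun _ hz => (hasDerivAt_evalJet hz p).deriv

lemma map_quad {B B' : Type*} [CommRing B] [CommRing B'] (e : B →+* B') (u : B)
    (F F₁ F₂ : PowerSeries B) : PowerSeries.map e (quad u F F₁ F₂) =
      quad (e u) (PowerSeries.map e F) (PowerSeries.map e F₁) (PowerSeries.map e F₂) := by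
  simp [quad, show PowerSeries.map e 2 = 2 from map_ofNat _ 2,
    show PowerSeries.map e 4 = 4 from map_ofNat _ 4]

lemma map_lenard {B B' : Type*} [CommRing B] [CommRing B'] (e : B →+* B') (u u₁ : B)
    (F F₁ F₃ : PowerSeries B) : PowerSeries.map e (lenard u u₁ F F₁ F₃) =
      lenard (e u) (e u₁) (PowerSeries.map e F) (PowerSeries.map e F₁) (PowerSeries.map e F₃) := by
  simp [lenard, show PowerSeries.map e 2 = 2 from map_ofNat _ 2,
    show PowerSeries.map e 4 = 4 from map_ofNat _ 4]

lemma mk_deriv_resolventFun {φ : PowerSeries ℂ} {f : ℂ → ℂ} {x : ℂ} (hf : AnalyticAt ℂ f x) :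
    (PowerSeries.mk fun n => resolventFun φ f n x) =
      PowerSeries.map (MvPolynomial.eval fun n => iteratedDeriv n f x) (resolventMul φ) ∧
    (PowerSeries.mk fun n => deriv (resolventFun φ f n) x) =
      PowerSeries.map (MvPolynomial.eval fun n => iteratedDeriv n f x)
        (dxSeries (resolventMul φ)) ∧
    (PowerSeries.mk fun n => deriv (deriv (resolventFun φ f n)) x) =
      PowerSeries.map (MvPolynomial.eval fun n => iteratedDeriv n f x)
        (dxSeries (dxSeries (resolventMul φ))) ∧
    (PowerSeries.mk fun n => deriv (deriv (deriv (resolventFun φ f n))) x) =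
      PowerSeries.map (MvPolynomial.eval fun n => iteratedDeriv n f x)
        (dxSeries (dxSeries (dxSeries (resolventMul φ)))) := by
  have h1 : ∀ n, deriv (resolventFun φ f n) =ᶠ[𝓝 x]
      fun x => evalJet f x (dx (PowerSeries.coeff n (resolventMul φ))) :=
    fun n => deriv_evalJet hf _
  have h2 := fun n => (h1 n).deriv.trans (deriv_evalJet hf _)
  have h3 := fun n => (h2 n).deriv.trans (deriv_evalJet hf _)
  refine ⟨?_, ?_, ?_, ?_⟩ <;> ext1 n
  · simp [resolventFun, evalJet]
  · simp [(h1 n).self_of_nhds, evalJet]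
  · simp [(h2 n).self_of_nhds, evalJet]
  · simp [(h3 n).self_of_nhds, evalJet]

lemma quadF_resolventFun (φ : PowerSeries ℂ) {f : ℂ → ℂ} {x : ℂ} (hf : AnalyticAt ℂ f x) :
    quadF f (resolventFun φ f) x = 16 * φ ^ 2 := by
  obtain ⟨h0, h1, h2, -⟩ := mk_deriv_resolventFun (φ := φ) hf
  have h := congrArg (PowerSeries.map (MvPolynomial.eval fun n => iteratedDeriv n f x))
    (quad_resolventMul φ)
  rw [map_quad, MvPolynomial.eval_X, iteratedDeriv_zero, ← h0, ← h1, ← h2] at h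
  rw [quadF, h]
  ext1 n
  simp only [PowerSeries.coeff_map, MvPolynomial.eval_C]

lemma lenardF_resolventFun (φ : PowerSeries ℂ) {f : ℂ → ℂ} {x : ℂ} (hf : AnalyticAt ℂ f x) :
    lenardF f (resolventFun φ f) x = 0 := by
  obtain ⟨h0, h1, -, h3⟩ := mk_deriv_resolventFun (φ := φ) hf
  have h := congrArg (PowerSeries.map (MvPolynomial.eval fun n => iteratedDeriv n f x))
    (lenard_resolventMul φ)
  rw [map_lenard, MvPolynomial.eval_X, MvPolynomial.eval_X, iteratedDeriv_zero, iteratedDeriv_one,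
    ← h0, ← h1, ← h3, map_zero] at h
  exact h

lemma coeff_resolventMul (φ : PowerSeries ℂ) (n : ℕ) : PowerSeries.coeff n (resolventMul φ) =
    2 * ∑ i ∈ Finset.range (n + 1),
      MvPolynomial.C (PowerSeries.coeff i φ) * resolvent (n - i) := by
  rw [resolventMul, show (2 : PowerSeries DiffPoly) = PowerSeries.C 2 from (map_ofNat _ 2).symm,
    PowerSeries.coeff_C_mul, PowerSeries.coeff_mul,
    Finset.Nat.sum_antidiagonal_eq_sum_range_succ_mk]
  simp

lemma resolventFun_zero {φ : PowerSeries ℂ} (h0 : PowerSeries.coeff 0 φ = 1) (f : ℂ → ℂ) :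
    resolventFun φ f 0 = fun _ => 2 := by
  funext x
  rw [resolventFun, coeff_resolventMul]
  simp only [zero_add, Finset.sum_range_one, h0, Nat.sub_zero, resolvent_zero, map_one, mul_one]
  exact map_ofNat (MvPolynomial.eval _) 2

lemma resolventFun_one {φ : PowerSeries ℂ} (h0 : PowerSeries.coeff 0 φ = 1)
    (h1 : PowerSeries.coeff 1 φ = 0) (f : ℂ → ℂ) (x : ℂ) :
    resolventFun φ f 1 x = -f x := by
  rw [resolventFun, coeff_resolventMul, Finset.sum_range_succ, Finset.sum_range_one, h0, h1,
    map_zero, zero_mul, add_zero, map_one, one_mul, Nat.sub_zero, resolvent_one,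
    show (2 : DiffPoly) = MvPolynomial.C 2 from (map_ofNat _ 2).symm, evalJet_mul, evalJet_mul,
    evalJet_C, evalJet_C, evalJet_X, iteratedDeriv_zero]
  ring

/-! ### The constants of the equation -/

/-- The series `φ = 1 + ∑_{l=2}^g a_{g-l} ξˡ`. -/
def phi (g : ℕ) (a : Fin (g - 1) → ℂ) : PowerSeries ℂ := PowerSeries.mk fun l =>
  if l = 0 then 1 else if h : 2 ≤ l ∧ l ≤ g then a ⟨g - l, by omega⟩ else 0

lemma coeff_phi_zero (g : ℕ) (a : Fin (g - 1) → ℂ) : PowerSeries.coeff 0 (phi g a) = 1 := by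
  rw [phi, PowerSeries.coeff_mk, if_pos rfl]

lemma coeff_phi_one (g : ℕ) (a : Fin (g - 1) → ℂ) : PowerSeries.coeff 1 (phi g a) = 0 := by
  rw [phi, PowerSeries.coeff_mk, if_neg one_ne_zero, dif_neg (by omega)]

lemma coeff_phi_of_lt {g l : ℕ} (hl : g < l) (a : Fin (g - 1) → ℂ) :
    PowerSeries.coeff l (phi g a) = 0 := by
  rw [phi, PowerSeries.coeff_mk, if_neg (by omega), dif_neg (by omega)]

lemma coeff_phi {g l : ℕ} (h2 : 2 ≤ l) (hl : l ≤ g) (a : Fin (g - 1) → ℂ) :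
    PowerSeries.coeff l (phi g a) = a ⟨g - l, by omega⟩ := by
  rw [phi, PowerSeries.coeff_mk, if_neg (by omega), dif_pos ⟨h2, hl⟩]

lemma SolutionSpace.aExt_eq {g : ℕ} (s : SolutionSpace g) {l : ℕ} (h2 : 2 ≤ l) (hl : l ≤ g) :
    s.aExt (g - l) = PowerSeries.coeff l (phi g s.a) := by
  rw [coeff_phi h2 hl, SolutionSpace.aExt, dif_pos]

/-- The term `φ_l R_{g+1-l}` is `R_{g+1}` for `l = 0`, vanishes for `l = 1` and `l = g + 1`, and is
`a_k R_{k+1}` for `l = g - k`. So the stationary equation says that the first coefficient beyond the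
truncation is constant in `x`. -/
lemma coeff_resolventMul_phi {g : ℕ} (hg : 1 ≤ g) (a : Fin (g - 1) → ℂ) :
    PowerSeries.coeff (g + 1) (resolventMul (phi g a)) = 2 * stationaryPoly g a := by
  obtain ⟨m, rfl⟩ : ∃ m, g = m + 1 := ⟨g - 1, by omega⟩
  rw [coeff_resolventMul, stationaryPoly, Finset.sum_range_succ, Finset.sum_range_succ',
    Finset.sum_range_succ', coeff_phi_of_lt (Nat.lt_succ_self (m + 1)), coeff_phi_one,
    coeff_phi_zero, map_zero, zero_mul, zero_mul, add_zero, add_zero, map_one, one_mul,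
    ← Finset.sum_range_reflect, Finset.sum_range, add_comm]
  congr 2
  refine Finset.sum_congr rfl fun k _ => ?_
  have hk : (k : ℕ) < m := k.2
  rw [coeff_phi (by omega) (by omega)]
  congr 2
  · congr 1
    exact Fin.ext (by simp; omega)
  · omega

/-! ### The generating function `2 - 𝐮` -/

/-- The coefficients of `2 - 𝐮(x, ξ)` as functions of `x`. -/
def genCoeff (g : ℕ) (U : ℕ → ℂ → ℂ) (n : ℕ) : ℂ → ℂ :=
  if n = 0 then fun _ => 2 else if n ≤ g then fun x => -U n x else fun _ => 0

lemma genCoeff_zero (g : ℕ) (U : ℕ → ℂ → ℂ) : genCoeff g U 0 = fun _ => 2 := if_pos rfl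

lemma genCoeff_of_mem {g n : ℕ} (h1 : 1 ≤ n) (hn : n ≤ g) (U : ℕ → ℂ → ℂ) :
    genCoeff g U n = fun x => -U n x := by
  rw [genCoeff, if_neg (by omega), if_pos hn]

lemma genCoeff_of_lt {g n : ℕ} (hn : g < n) (U : ℕ → ℂ → ℂ) : genCoeff g U n = fun _ => 0 := by
  rw [genCoeff, if_neg (by omega), if_neg (by omega)]

/-- The polynomial `a - ∑_{i=1}^g v_i ξⁱ`. -/
def genPoly (g : ℕ) (a : ℂ) (v : ℕ → ℂ) : Polynomial ℂ :=
  Polynomial.C a - ∑ i ∈ Finset.Icc 1 g, Polynomial.monomial i (v i)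

lemma coeff_genPoly (g : ℕ) (a : ℂ) (v : ℕ → ℂ) (n : ℕ) : (genPoly g a v).coeff n =
    if n = 0 then a else if n ≤ g then -v n else 0 := by
  rw [genPoly, Polynomial.coeff_sub, Polynomial.coeff_C, Polynomial.finsetSum_coeff]
  simp only [Polynomial.coeff_monomial, Finset.sum_ite_eq', Finset.mem_Icc]
  split_ifs <;> first | omega | simp

lemma eval_genPoly (g : ℕ) (a : ℂ) (v : ℕ → ℂ) (ξ : ℂ) : (genPoly g a v).eval ξ =
    a - ∑ i ∈ Finset.Icc 1 g, v i * ξ ^ i := by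
  simp [genPoly, Polynomial.eval_finsetSum]

lemma natDegree_genPoly_le (g : ℕ) (a : ℂ) (v : ℕ → ℂ) : (genPoly g a v).natDegree ≤ g :=
  Polynomial.natDegree_le_iff_coeff_eq_zero.2 fun n hn => by
    rw [coeff_genPoly, if_neg (by omega), if_neg (by omega)]

/-- The polynomial `4 ξ μ(ξ)`. -/
def curvePoly {g : ℕ} (μ : CurveSpace g) : Polynomial ℂ :=
  Polynomial.C 16 + ∑ i : Fin (2 * g), Polynomial.monomial ((i : ℕ) + 2) (4 * μ i)

lemma eval_curvePoly {g : ℕ} (μ : CurveSpace g) {ξ : ℂ} (hξ : ξ ≠ 0) :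
    (curvePoly μ).eval ξ = ξ * (4 * muFun μ ξ) := by
  simp only [curvePoly, Polynomial.eval_add, Polynomial.eval_C, Polynomial.eval_finsetSum,
    Polynomial.eval_monomial, muFun, mul_add, Finset.mul_sum]
  congr 1
  · field_simp; norm_num
  · exact Finset.sum_congr rfl fun i _ => by ring

lemma coeff_curvePoly {g : ℕ} (μ : CurveSpace g) (n : ℕ) : (curvePoly μ).coeff n =
    if n = 0 then 16 else if h : 2 ≤ n ∧ n < 2 * g + 2 then 4 * μ ⟨n - 2, by omega⟩ else 0 := by
  rw [curvePoly, Polynomial.coeff_add, Polynomial.coeff_C, Polynomial.finsetSum_coeff]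
  simp only [Polynomial.coeff_monomial]
  by_cases h : 2 ≤ n ∧ n < 2 * g + 2
  · rw [Finset.sum_eq_single ⟨n - 2, by omega⟩, if_neg (by omega), if_pos (by simp; omega),
      if_neg (by omega), dif_pos h, zero_add]
    · intro i _ hi
      rw [if_neg]
      rintro rfl
      exact hi (Fin.ext (by simp))
    · simp
  · rw [Finset.sum_eq_zero, dif_neg h, add_zero]
    intro i _
    have := i.2
    rw [if_neg (by omega)]

/-- The quadratic form `quad` for polynomials. -/
def quadPoly (u : ℂ) (F F₁ F₂ : Polynomial ℂ) : Polynomial ℂ :=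
  Polynomial.X * (F₁ ^ 2 - 2 * (F * F₂) + 4 * (Polynomial.C u * F ^ 2)) + 4 * F ^ 2

lemma coe_quadPoly (u : ℂ) (F F₁ F₂ : Polynomial ℂ) :
    (quadPoly u F F₁ F₂ : PowerSeries ℂ) = quad u F F₁ F₂ := by
  have h2 : ((2 : Polynomial ℂ) : PowerSeries ℂ) = 2 := map_ofNat Polynomial.coeToPowerSeries.ringHom 2
  have h4 : ((4 : Polynomial ℂ) : PowerSeries ℂ) = 4 := map_ofNat Polynomial.coeToPowerSeries.ringHom 4
  simp only [quadPoly, quad, Polynomial.coe_add, Polynomial.coe_mul, Polynomial.coe_sub,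
    Polynomial.coe_pow, Polynomial.coe_X, Polynomial.coe_C, h2, h4]

lemma natDegree_quadPoly_le {u : ℂ} {F F₁ F₂ : Polynomial ℂ} {g : ℕ} (h : F.natDegree ≤ g)
    (h₁ : F₁.natDegree ≤ g) (h₂ : F₂.natDegree ≤ g) :
    (quadPoly u F F₁ F₂).natDegree ≤ 2 * g + 1 := by
  have m2 : ∀ {P Q : Polynomial ℂ}, P.natDegree ≤ g → Q.natDegree ≤ g →
      (P * Q).natDegree ≤ 2 * g := fun hP hQ =>
    Polynomial.natDegree_mul_le.trans (by omega)
  have mC : ∀ (c : ℂ) {P : Polynomial ℂ} {d : ℕ}, P.natDegree ≤ d →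
      (Polynomial.C c * P).natDegree ≤ d := fun c P d hP =>
    (Polynomial.natDegree_C_mul_le _ _).trans hP
  have e2 : (2 : Polynomial ℂ) = Polynomial.C 2 := (map_ofNat _ 2).symm
  have e4 : (4 : Polynomial ℂ) = Polynomial.C 4 := (map_ofNat _ 4).symm
  rw [quadPoly, pow_two, pow_two, e2, e4]
  refine Polynomial.natDegree_add_le_of_degree_le (Polynomial.natDegree_mul_le.trans ?_)
    ((mC _ (m2 h h)).trans (by omega))
  rw [Polynomial.natDegree_X, add_comm]
  exact Nat.add_le_add_right (Polynomial.natDegree_add_le_of_degree_le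
    ((Polynomial.natDegree_sub_le _ _).trans (max_le (m2 h₁ h₁) (mC _ (m2 h h₂)))) (mC _ (mC _ (m2 h h)))) 1

/-- Multiplication by `ξ` clears `ξ⁻¹` on both sides and leaves polynomials, which coincide as soon
as they agree at all `ξ ≠ 0`. -/
lemma quadPoly_genPoly_eq_iff {g : ℕ} (μ : CurveSpace g) (u : ℂ) (v v₁ v₂ : ℕ → ℂ) :
    quadPoly u (genPoly g 2 v) (genPoly g 0 v₁) (genPoly g 0 v₂) = curvePoly μ ↔
      ∀ ξ : ℂ, ξ ≠ 0 → 4 * muFun μ ξ = (∑ i ∈ Finset.Icc 1 g, v₁ i * ξ ^ i) ^ 2 +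
        2 * (∑ i ∈ Finset.Icc 1 g, v₂ i * ξ ^ i) * (2 - ∑ i ∈ Finset.Icc 1 g, v i * ξ ^ i) +
        4 * (ξ⁻¹ + u) * (2 - ∑ i ∈ Finset.Icc 1 g, v i * ξ ^ i) ^ 2 := by
  have key : ∀ ξ : ℂ, ξ ≠ 0 →
      (quadPoly u (genPoly g 2 v) (genPoly g 0 v₁) (genPoly g 0 v₂)).eval ξ =
      ξ * ((∑ i ∈ Finset.Icc 1 g, v₁ i * ξ ^ i) ^ 2 +
        2 * (∑ i ∈ Finset.Icc 1 g, v₂ i * ξ ^ i) * (2 - ∑ i ∈ Finset.Icc 1 g, v i * ξ ^ i) +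
        4 * (ξ⁻¹ + u) * (2 - ∑ i ∈ Finset.Icc 1 g, v i * ξ ^ i) ^ 2) := fun ξ hξ => by
    simp only [quadPoly, Polynomial.eval_add, Polynomial.eval_mul, Polynomial.eval_sub,
      Polynomial.eval_pow, Polynomial.eval_X, Polynomial.eval_C, Polynomial.eval_ofNat,
      eval_genPoly]
    have : ξ * ξ⁻¹ = 1 := mul_inv_cancel₀ hξ
    linear_combination (-4 * (2 - ∑ i ∈ Finset.Icc 1 g, v i * ξ ^ i) ^ 2) * this
  constructor
  · intro h ξ hξ
    have h1 := key ξ hξ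
    rw [h, eval_curvePoly μ hξ] at h1
    exact mul_left_cancel₀ hξ h1
  · intro h
    refine Polynomial.eq_of_infinite_eval_eq _ _ (Set.Infinite.mono (s := {0}ᶜ) (fun ξ hξ => ?_)
      (Set.finite_singleton (0 : ℂ)).infinite_compl)
    show Polynomial.eval _ _ = Polynomial.eval _ _
    rw [key ξ hξ, eval_curvePoly μ hξ, h ξ hξ]

lemma quadF_genCoeff (g : ℕ) (u : ℂ → ℂ) (U : ℕ → ℂ → ℂ) (x : ℂ) :
    quadF u (genCoeff g U) x = (quadPoly (u x) (genPoly g 2 fun n => U n x)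
      (genPoly g 0 fun n => deriv (U n) x) (genPoly g 0 fun n => deriv (deriv (U n)) x) :) := by
  have hd : ∀ V : ℕ → ℂ → ℂ, ∀ n, deriv (fun x => -V n x) = fun x => -deriv (V n) x :=
    fun V n => deriv.fun_neg'
  rw [coe_quadPoly, quadF]
  congr 1 <;> ext1 n <;> rw [PowerSeries.coeff_mk, Polynomial.coeff_coe, coeff_genPoly, genCoeff]
  · split_ifs <;> rfl
  · split_ifs <;> simp [hd]
  · split_ifs <;> simp [hd]

lemma quadF_genCoeff_eq_iff {g : ℕ} (μ : CurveSpace g) (U : ℕ → ℂ → ℂ) (x : ℂ) :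
    quadF (U 1) (genCoeff g U) x = (curvePoly μ : PowerSeries ℂ) ↔ ∀ ξ : ℂ, ξ ≠ 0 →
    4 * muFun μ ξ =
      genFun g (fun i => deriv (U i)) x ξ ^ 2 +
      2 * genFun g (fun i => deriv (deriv (U i))) x ξ * (2 - genFun g U x ξ) +
      4 * (ξ⁻¹ + U 1 x) * (2 - genFun g U x ξ) ^ 2 := by
  rw [quadF_genCoeff, Polynomial.coe_inj]
  exact quadPoly_genPoly_eq_iff μ _ _ _ _

/-! ### The functions and the curve associated with a solution -/

lemma coeff_succ_curvePoly_of_pos {g : ℕ} (μ : CurveSpace g) {k : ℕ} (i : Fin (2 * g))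
    (hk : (i : ℕ) + 1 = k) : (curvePoly μ).coeff (k + 1) = 4 * μ i := by
  have := i.2
  rw [coeff_curvePoly, if_neg (by omega), dif_pos (by omega)]
  congr 2
  exact Fin.ext (by simp; omega)

lemma curvePoly_injective {g : ℕ} : Function.Injective (curvePoly (g := g)) := fun μ ν h => by
  funext i
  have := congrArg (fun P => Polynomial.coeff P ((i : ℕ) + 1 + 1)) h
  simp only [coeff_succ_curvePoly_of_pos _ i rfl] at this
  exact mul_left_cancel₀ (by norm_num) this

lemma coeff_succ_sq_phi {g : ℕ} (s : SolutionSpace g) {k : ℕ} (h1 : 1 ≤ k) (hk : k + 1 ≤ g) :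
    PowerSeries.coeff (k + 1) (phi g s.a ^ 2) = 2 * s.aExt (g - k - 1) +
      ∑ j ∈ Finset.Icc 1 (k - 2), s.aExt (g - j - 1) * s.aExt (g - k + j) := by
  rw [coeff_sq_succ, coeff_phi_zero, one_mul, Nat.sub_sub, s.aExt_eq (by omega) hk]
  congr 1
  symm
  -- The full convolution has the additional indices `j = 0` and `j = k - 1`; there one factor is
  -- the linear coefficient of `φ`, which is zero.
  refine Finset.sum_subset_zero_on_sdiff (fun j hj => ?_) (fun j hj => ?_) (fun j hj => ?_)
  · have := Finset.mem_Icc.1 hj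
    exact Finset.mem_range.2 (by omega)
  · rw [Finset.mem_sdiff, Finset.mem_range, Finset.mem_Icc] at hj
    obtain rfl | h : j = 0 ∨ k - j = 1 := by omega
    · rw [zero_add, coeff_phi_one, zero_mul]
    · rw [h, coeff_phi_one, mul_zero]
  · have := Finset.mem_Icc.1 hj
    rw [Nat.sub_sub, s.aExt_eq (by omega) (by omega), show g - k + j = g - (k - j) by omega,
      s.aExt_eq (by omega) (by omega)]

lemma coeff_sixteen_mul (F : PowerSeries ℂ) (n : ℕ) :
    PowerSeries.coeff n (16 * F) = 16 * PowerSeries.coeff n F := by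
  rw [show (16 : PowerSeries ℂ) = PowerSeries.C 16 from (map_ofNat _ 16).symm,
    PowerSeries.coeff_C_mul]

lemma coeff_one_sq_phi (g : ℕ) (a : Fin (g - 1) → ℂ) :
    PowerSeries.coeff 1 (phi g a ^ 2) = 0 := by
  have := coeff_sq_succ (phi g a) 0
  rw [zero_add, coeff_phi_one] at this
  simpa using this

/-- The prescribed formulas for `μ₁, …, μ_{g-1}` are the coefficients of `4 ξ μ(ξ) = 16 φ²` up to
`ξᵍ`. The coefficient at `ξ` imposes nothing: neither side has a linear term. -/
lemma constants_iff {g : ℕ} (s : SolutionSpace g) (μ : CurveSpace g) :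
    (∀ (k : ℕ) (i : Fin (2 * g)), (i : ℕ) + 1 = k → k ≤ g - 1 →
      μ i = 8 * s.aExt (g - k - 1) +
        4 * ∑ j ∈ Finset.Icc 1 (k - 2), s.aExt (g - j - 1) * s.aExt (g - k + j)) ↔
    ∀ n < g, (curvePoly μ).coeff (n + 1) = PowerSeries.coeff (n + 1) (16 * phi g s.a ^ 2) := by
  constructor
  · intro h n hn
    rcases Nat.eq_zero_or_pos n with rfl | h0
    · rw [coeff_curvePoly, if_neg (by omega), dif_neg (by omega), coeff_sixteen_mul, zero_add,
        coeff_one_sq_phi, mul_zero]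
    · have hi : n - 1 + 1 = n := by omega
      rw [coeff_succ_curvePoly_of_pos μ (⟨n - 1, by omega⟩ : Fin (2 * g)) hi,
        h n ⟨n - 1, by omega⟩ hi (by omega), coeff_sixteen_mul, coeff_succ_sq_phi s h0 hn]
      ring
  · intro h k i hik hk
    have := h k (by omega)
    rw [coeff_succ_curvePoly_of_pos μ i hik, coeff_sixteen_mul,
      coeff_succ_sq_phi s (by omega) (by omega)] at this
    linear_combination this / 4

lemma IsAssociated.quadF_eq {g : ℕ} {s : SolutionSpace g} {U : ℕ → ℂ → ℂ} {μ : CurveSpace g}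
    (h : IsAssociated s U μ) :
    ∀ᶠ x in 𝓝 0, quadF (U 1) (genCoeff g U) x = (curvePoly μ : PowerSeries ℂ) :=
  h.equation.mono fun x hx => (quadF_genCoeff_eq_iff μ U x).2 hx

/-- The generating function `2 - 𝐮` is the truncation of a multiple of the resolvent. -/
lemma IsAssociated.genCoeff_eq {g : ℕ} {s : SolutionSpace g} {U : ℕ → ℂ → ℂ} {μ : CurveSpace g}
    (h : IsAssociated s U μ) {f : ℂ → ℂ} (hf : AnalyticAt ℂ f 0)
    (hfs : (f : Germ (𝓝 (0 : ℂ)) ℂ) = s.u) (n : ℕ) (hn : n ≤ g) :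
    genCoeff g U n =ᶠ[𝓝 0] resolventFun (phi g s.a) f n := by
  refine eventuallyEq_of_coeff_quadF_eq (u := U 1) (v := f)
    (Germ.coe_eq.1 (h.first.trans hfs.symm)) (by rw [genCoeff_zero])
    (by rw [resolventFun_zero (coeff_phi_zero _ _)]) (fun n hn => ?_) n hn
  filter_upwards [h.quadF_eq, hf.eventually_analyticAt] with x hx hfx
  rw [hx, quadF_resolventFun _ hfx, Polynomial.coeff_coe]
  exact (constants_iff s μ).1 h.constants n hn

/-- Both generating functions are the truncation of the same `2 φ R`, by `IsAssociated.genCoeff_eq`;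
the curve is then read off from the quadratic form at `x = 0`. -/
lemma IsAssociated.unique {g : ℕ} (hg : 1 ≤ g) {s : SolutionSpace g} {U V : ℕ → ℂ → ℂ}
    {μ ν : CurveSpace g} (hU : IsAssociated s U μ) (hV : IsAssociated s V ν) :
    μ = ν ∧ ∀ i ∈ Finset.Icc 1 g, U i =ᶠ[𝓝 0] V i := by
  obtain ⟨f, hfs, hf, -⟩ := s.regular
  have h : ∀ n, genCoeff g U n =ᶠ[𝓝 0] genCoeff g V n := fun n => by
    by_cases hn : n ≤ g
    · exact (hU.genCoeff_eq hf hfs n hn).trans (hV.genCoeff_eq hf hfs n hn).symm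
    · rw [genCoeff_of_lt (not_le.1 hn), genCoeff_of_lt (not_le.1 hn)]
  have h' : ∀ i ∈ Finset.Icc 1 g, U i =ᶠ[𝓝 0] V i := fun i hi => by
    obtain ⟨h1, h2⟩ := Finset.mem_Icc.1 hi
    have := h i
    rw [genCoeff_of_mem h1 h2, genCoeff_of_mem h1 h2] at this
    filter_upwards [this] with x hx
    exact neg_injective hx
  refine ⟨curvePoly_injective (Polynomial.coe_injective ℂ ?_), h'⟩
  rw [← hU.quadF_eq.self_of_nhds, ← hV.quadF_eq.self_of_nhds, quadF, quadF,
    (h' 1 (Finset.mem_Icc.2 ⟨le_rfl, hg⟩)).self_of_nhds]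
  congr 1 <;> ext1 n <;> simp only [PowerSeries.coeff_mk]
  · exact (h n).self_of_nhds
  · exact (h n).deriv.self_of_nhds
  · exact (h n).deriv.deriv.self_of_nhds

lemma eventually_analyticAt_genCoeff {g : ℕ} {U : ℕ → ℂ → ℂ}
    (hU : ∀ i ∈ Finset.Icc 1 g, AnalyticAt ℂ (U i) 0) :
    ∀ᶠ x in 𝓝 0, ∀ n, AnalyticAt ℂ (genCoeff g U n) x := by
  have : ∀ᶠ x in 𝓝 0, ∀ i ∈ Finset.Icc 1 g, AnalyticAt ℂ (U i) x :=
    (eventually_all_finset _).2 fun i hi => (hU i hi).eventually_analyticAt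
  refine this.mono fun x hx n => ?_
  rw [genCoeff]
  split_ifs with h1 h2
  · exact analyticAt_const
  · exact (hx n (Finset.mem_Icc.2 ⟨by omega, h2⟩)).neg
  · exact analyticAt_const

/-- The solutions of the Lenard system have a spectral curve that does not depend on `x`. -/
lemma eventually_quadF_genCoeff_eq {g : ℕ} (hg : 1 ≤ g) {U : ℕ → ℂ → ℂ} {μ : CurveSpace g}
    (hU : ∀ i ∈ Finset.Icc 1 g, AnalyticAt ℂ (U i) 0)
    (hl : ∀ᶠ x in 𝓝 0, lenardF (U 1) (genCoeff g U) x = 0)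
    (h0 : quadF (U 1) (genCoeff g U) 0 = (curvePoly μ : PowerSeries ℂ)) :
    ∀ᶠ x in 𝓝 0, quadF (U 1) (genCoeff g U) x = (curvePoly μ : PowerSeries ℂ) := by
  -- Each coefficient is constant on its own neighbourhood, so only finitely many may be treated
  -- together. Those of index `2g + 2` or more vanish for degree reasons.
  have h : ∀ᶠ x in 𝓝 0, ∀ n ∈ Finset.range (2 * g + 2),
      PowerSeries.coeff n (quadF (U 1) (genCoeff g U) x) =
      PowerSeries.coeff n (quadF (U 1) (genCoeff g U) 0) :=
    (eventually_all_finset _).2 fun n _ => eventually_quadF_eq (hU 1 (Finset.mem_Icc.2 ⟨le_rfl, hg⟩))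
      (eventually_analyticAt_genCoeff hU) hl n
  refine h.mono fun x hx => ?_
  rw [← h0]
  ext1 n
  by_cases hn : n < 2 * g + 2
  · exact hx n (Finset.mem_range.2 hn)
  · have hz : ∀ x, PowerSeries.coeff n (quadF (U 1) (genCoeff g U) x) = 0 := fun x => by
      rw [quadF_genCoeff, Polynomial.coeff_coe]
      refine Polynomial.coeff_eq_zero_of_natDegree_lt (lt_of_le_of_lt (natDegree_quadPoly_le
        (natDegree_genPoly_le _ _ _) (natDegree_genPoly_le _ _ _) (natDegree_genPoly_le _ _ _)) ?_)
      omega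
    rw [hz, hz]

/-- The functions `u₁, …, u_g` of a solution. -/
def resolventU {g : ℕ} (a : Fin (g - 1) → ℂ) (f : ℂ → ℂ) (i : ℕ) (x : ℂ) : ℂ :=
  -resolventFun (phi g a) f i x

lemma resolventU_one {g : ℕ} (a : Fin (g - 1) → ℂ) (f : ℂ → ℂ) : resolventU a f 1 = f := by
  funext x
  rw [resolventU, resolventFun_one (coeff_phi_zero _ _) (coeff_phi_one _ _), neg_neg]

lemma genCoeff_resolventU {g n : ℕ} (hn : n ≤ g) (a : Fin (g - 1) → ℂ) (f : ℂ → ℂ) :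
    genCoeff g (resolventU a f) n = resolventFun (phi g a) f n := by
  rcases Nat.eq_zero_or_pos n with rfl | h0
  · rw [genCoeff_zero, resolventFun_zero (coeff_phi_zero _ _)]
  · rw [genCoeff_of_mem h0 hn]
    funext x
    rw [resolventU, neg_neg]

lemma evalJet_dx_two_mul (f : ℂ → ℂ) (x : ℂ) (p : DiffPoly) :
    evalJet f x (dx (2 * p)) = 2 * evalJet f x (dx p) := by
  rw [show (2 : DiffPoly) = MvPolynomial.C 2 from (map_ofNat _ 2).symm, dx_mul, dx_C, mul_zero,
    add_zero, evalJet_mul, evalJet_C]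

/-- Beyond order `g + 1` both sides vanish identically. The equation for `n = g` contains the
coefficient of index `g + 1`, which is zero by truncation, and is the only one where truncation is
felt. -/
lemma lenardF_eq_zero_iff {g : ℕ} {u : ℂ → ℂ} {U : ℕ → ℂ → ℂ} {x : ℂ} :
    lenardF u (genCoeff g U) x = 0 ↔ ∀ n ≤ g,
      4 * deriv (genCoeff g U (n + 1)) x = deriv (deriv (deriv (genCoeff g U n))) x -
        2 * deriv u x * genCoeff g U n x - 4 * u x * deriv (genCoeff g U n) x := by
  constructor
  · intro h n _
    have := congrArg (PowerSeries.coeff (n + 1)) h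
    rw [lenardF, coeff_lenard_succ] at this
    simp only [PowerSeries.coeff_mk, map_zero] at this
    linear_combination this
  · intro h
    ext1 n
    cases n with
    | zero => simp [lenardF, coeff_lenard_zero, genCoeff_zero]
    | succ n =>
      rw [lenardF, coeff_lenard_succ]
      simp only [PowerSeries.coeff_mk, map_zero]
      by_cases hn : n ≤ g
      · linear_combination h n hn
      · rw [genCoeff_of_lt (by omega : g < n), genCoeff_of_lt (by omega : g < n + 1)]
        simp

/-- Below order `g` the equations are inherited from `2 φ R`. At order `g` the truncation drops the
derivative of the coefficient of index `g + 1`, which is zero by the stationary equation. -/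
lemma lenardF_resolventU_eq_zero {g : ℕ} (hg : 1 ≤ g) {a : Fin (g - 1) → ℂ} {f : ℂ → ℂ} {x : ℂ}
    (hf : AnalyticAt ℂ f x) (hs : evalJet f x (dx (stationaryPoly g a)) = 0) :
    lenardF (resolventU a f 1) (genCoeff g (resolventU a f)) x = 0 := by
  rw [lenardF_eq_zero_iff, resolventU_one]
  intro n hn
  have h := congrArg (PowerSeries.coeff (n + 1)) (lenardF_resolventFun (phi g a) hf)
  rw [lenardF, coeff_lenard_succ] at h
  simp only [PowerSeries.coeff_mk, map_zero] at h
  rw [genCoeff_resolventU hn]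
  rcases hn.lt_or_eq with hn | rfl
  · rw [genCoeff_resolventU hn]
    linear_combination h
  · have h1 : deriv (resolventFun (phi n a) f (n + 1)) x = 0 := by
      have : resolventFun (phi n a) f (n + 1) =
          fun x => evalJet f x (2 * stationaryPoly n a) := by
        funext x; rw [resolventFun, coeff_resolventMul_phi hg]
      rw [this, (hasDerivAt_evalJet hf _).deriv, evalJet_dx_two_mul, hs, mul_zero]
    rw [genCoeff_of_lt (Nat.lt_succ_self _), deriv_const]
    rw [h1] at h
    linear_combination h

lemma coeff_quadF_resolventU {g : ℕ} {a : Fin (g - 1) → ℂ} {f : ℂ → ℂ} {x : ℂ}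
    (hf : AnalyticAt ℂ f x) {n : ℕ} (hn : n < g) :
    PowerSeries.coeff (n + 1) (quadF (resolventU a f 1) (genCoeff g (resolventU a f)) x) =
      PowerSeries.coeff (n + 1) (16 * phi g a ^ 2) := by
  rw [← quadF_resolventFun (phi g a) hf, resolventU_one, ← sub_eq_zero, quadF, quadF,
    coeff_quad_succ_congr]
  · simp only [PowerSeries.coeff_mk]
    rw [genCoeff_resolventU (by omega : n + 1 ≤ g), sub_self, mul_zero]
  all_goals
    intro k hk
    simp only [PowerSeries.coeff_mk]
    rw [genCoeff_resolventU (by omega : k ≤ g)]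

lemma analyticAt_resolventU {g : ℕ} (a : Fin (g - 1) → ℂ) {f : ℂ → ℂ} {x : ℂ}
    (hf : AnalyticAt ℂ f x) (i : ℕ) : AnalyticAt ℂ (resolventU a f i) x :=
  (analyticAt_resolventFun _ hf i).neg

/-- Every solution has associated functions and an associated curve. -/
lemma exists_isAssociated {g : ℕ} (hg : 1 ≤ g) (s : SolutionSpace g) {f : ℂ → ℂ}
    (hf : AnalyticAt ℂ f 0) (hfs : (f : Germ (𝓝 (0 : ℂ)) ℂ) = s.u)
    (hs : SolvesStationaryKdV g s.a f) : ∃ μ, IsAssociated s (resolventU s.a f) μ := by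
  set U := resolventU s.a f with hU
  set Q := quadPoly (U 1 0) (genPoly g 2 fun n => U n 0)
      (genPoly g 0 fun n => deriv (U n) 0) (genPoly g 0 fun n => deriv (deriv (U n)) 0) with hQ
  have hQ' : quadF (U 1) (genCoeff g U) 0 = (Q : PowerSeries ℂ) := quadF_genCoeff _ _ _ _
  have hQc : ∀ n < g, Q.coeff (n + 1) = PowerSeries.coeff (n + 1) (16 * phi g s.a ^ 2) :=
    fun n hn => by rw [← Polynomial.coeff_coe, ← hQ', hU, coeff_quadF_resolventU hf hn]
  -- The curve is defined by the quadratic form at `x = 0`. To be of the shape `4 ξ μ(ξ)`, this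
  -- polynomial must have constant term `16`, no linear term, and degree at most `2g + 1`.
  set μ : CurveSpace g := fun i => Q.coeff (i + 2) / 4 with hμ
  have h0 : quadF (U 1) (genCoeff g U) 0 = (curvePoly μ : PowerSeries ℂ) := by
    rw [hQ']
    congr 1
    ext n
    rw [coeff_curvePoly]
    split_ifs with h1 h2
    · rw [h1, ← Polynomial.coeff_coe, ← hQ', quadF, coeff_quad_zero, PowerSeries.coeff_mk,
        genCoeff_zero]
      norm_num
    · simp only [hμ]
      rw [show n - 2 + 2 = n by omega]
      ring
    · obtain rfl | h3 : n = 0 + 1 ∨ 2 * g + 2 ≤ n := by omega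
      · rw [hQc 0 hg, coeff_sixteen_mul, zero_add, coeff_one_sq_phi, mul_zero]
      · exact Polynomial.coeff_eq_zero_of_natDegree_lt (lt_of_le_of_lt (natDegree_quadPoly_le
          (natDegree_genPoly_le _ _ _) (natDegree_genPoly_le _ _ _)
          (natDegree_genPoly_le _ _ _)) (by omega))
  have hUa : ∀ i ∈ Finset.Icc 1 g, AnalyticAt ℂ (U i) 0 :=
    fun i _ => analyticAt_resolventU s.a hf i
  have hl : ∀ᶠ x in 𝓝 0, lenardF (U 1) (genCoeff g U) x = 0 := by
    filter_upwards [solvesStationaryKdV_iff.1 hs, hf.eventually_analyticAt] with x hx hfx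
    exact lenardF_resolventU_eq_zero hg hfx hx
  refine ⟨μ, hUa, by rw [hU, resolventU_one, hfs], (constants_iff s μ).2 fun n hn => ?_, ?_⟩
  · rw [← hQc n hn, ← Polynomial.coeff_coe, ← h0, hQ', Polynomial.coeff_coe]
  · exact (eventually_quadF_genCoeff_eq hg hUa hl h0).mono fun x hx =>
      (quadF_genCoeff_eq_iff μ U x).1 hx

/-! ### The points on the curve -/

lemma IsAssociated.isUpsilon_unique {g : ℕ} (hg : 1 ≤ g) {s : SolutionSpace g}
    {U : ℕ → ℂ → ℂ} {μ : CurveSpace g} (h : IsAssociated s U μ) {t : SymFamily g}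
    (ht : IsUpsilon s t) : t.1 = μ ∧
      Multiset.map Curve.xi (t.2 : Multiset (Curve t.1)) = (rootPoly g U).roots ∧
      ∀ p ∈ (t.2 : Multiset (Curve t.1)), p.y = genFun g (fun i => deriv (U i)) 0 p.xi := by
  obtain ⟨V, hV, h1, h2⟩ := ht
  obtain ⟨h3, h4⟩ := hV.unique hg h
  refine ⟨h3, ?_, fun p hp => ?_⟩
  · rw [h1]
    congr 1
    rw [rootPoly, rootPoly]
    congr 1
    exact Finset.sum_congr rfl fun i hi => by rw [(h4 i hi).self_of_nhds]
  · rw [h2 p hp]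
    exact Finset.sum_congr rfl fun i hi =>
      congrArg (· * p.xi ^ i) (h4 i hi).deriv.self_of_nhds

lemma rootPoly_eq (g : ℕ) (U : ℕ → ℂ → ℂ) : rootPoly g U = genPoly g 2 fun n => U n 0 := rfl

lemma natDegree_rootPoly {g : ℕ} (hg : 1 ≤ g) {U : ℕ → ℂ → ℂ} (h : U g 0 ≠ 0) :
    (rootPoly g U).natDegree = g :=
  le_antisymm (natDegree_genPoly_le _ _ _) (Polynomial.le_natDegree_of_ne_zero (by
    rw [rootPoly_eq, coeff_genPoly, if_neg (by omega), if_pos le_rfl]; simpa using h))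

/-- At a zero of `2 - 𝐮` only `𝐮'²` survives in the identity for `4 μ(ξ)`; and `0` is not a zero, as
the constant term is `2`. -/
lemma IsAssociated.mem_curve {g : ℕ} {s : SolutionSpace g} {U : ℕ → ℂ → ℂ} {μ : CurveSpace g}
    (h : IsAssociated s U μ) {ξ : ℂ} (hξ : ξ ∈ (rootPoly g U).roots) :
    ξ ≠ 0 ∧ genFun g (fun i => deriv (U i)) 0 ξ ^ 2 = 4 * muFun μ ξ := by
  have h1 : (rootPoly g U).eval ξ = 0 := (Polynomial.mem_roots'.1 hξ).2
  rw [rootPoly_eq, eval_genPoly] at h1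
  have h0 : ξ ≠ 0 := by
    rintro rfl
    rw [Finset.sum_eq_zero] at h1
    · norm_num at h1
    · intro i hi
      have := (Finset.mem_Icc.1 hi).1
      rw [zero_pow (by omega), mul_zero]
  refine ⟨h0, ?_⟩
  have h2 := h.equation.self_of_nhds ξ h0
  have h3 : 2 - genFun g U 0 ξ = 0 := h1
  rw [h2, h3]
  ring

lemma existsUnique_isUpsilon {g : ℕ} (hg : 1 ≤ g) {s : SolutionSpace g} {U : ℕ → ℂ → ℂ}
    {μ : CurveSpace g} (h : IsAssociated s U μ) (h0 : U g 0 ≠ 0) : ∃! t, IsUpsilon s t := by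
  set L := (rootPoly g U).roots with hL
  set G : {ξ // ξ ∈ L} → Curve μ := fun ξ =>
    ⟨(ξ.1, genFun g (fun i => deriv (U i)) 0 ξ.1), h.mem_curve ξ.2⟩ with hG
  have hcard : L.card = g := by
    rw [hL, ← (IsAlgClosed.splits (rootPoly g U)).natDegree_eq_card_roots, natDegree_rootPoly hg h0]
  refine ⟨⟨μ, ⟨L.attach.map G, by rw [Multiset.card_map, Multiset.card_attach, hcard]⟩⟩,
    ⟨U, h, ?_, ?_⟩, ?_⟩
  · simp only [Sym.coe_mk, Multiset.map_map]
    exact Multiset.attach_map_val L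
  · intro p hp
    obtain ⟨ξ, -, rfl⟩ := Multiset.mem_map.1 hp
    rfl
  · rintro ⟨ν, D, hD⟩ ht
    obtain ⟨rfl, h1, h2⟩ := h.isUpsilon_unique hg ht
    simp only [Sym.coe_mk] at h1 h2
    congr 1
    refine Subtype.ext ?_
    show D = L.attach.map G
    -- On the points of `υ(s)` the coordinate `y` is the function `𝐮'(0, ξ)` of `ξ`, so the multiset
    -- of roots determines the multiset of points.
    refine Multiset.map_injective Subtype.val_injective ?_
    have h3 : D.map Subtype.val =
        (D.map Curve.xi).map fun ξ => (ξ, genFun g (fun i => deriv (U i)) 0 ξ) := by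
      rw [Multiset.map_map]
      exact Multiset.map_congr rfl fun p hp => Prod.ext rfl (h2 p hp)
    rw [h3, h1]
    refine Eq.trans ?_ (Multiset.map_map Subtype.val G L.attach).symm
    conv_lhs => rw [← hL, ← Multiset.attach_map_val L, Multiset.map_map]
    rfl

/-! ### Algebras of functions and their localizations -/

section Functions

variable {X : Type} {A : Subalgebra ℂ (X → ℂ)}

lemma const_mem (A : Subalgebra ℂ (X → ℂ)) (c : ℂ) : (fun _ => c) ∈ A := A.algebraMap_mem c

lemma fun_add_mem {f h : X → ℂ} (hf : f ∈ A) (hh : h ∈ A) : (fun x => f x + h x) ∈ A :=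
  A.add_mem hf hh

lemma fun_sub_mem {f h : X → ℂ} (hf : f ∈ A) (hh : h ∈ A) : (fun x => f x - h x) ∈ A :=
  A.sub_mem hf hh

lemma fun_neg_mem {f : X → ℂ} (hf : f ∈ A) : (fun x => -f x) ∈ A := A.neg_mem hf

lemma fun_mul_mem {f h : X → ℂ} (hf : f ∈ A) (hh : h ∈ A) : (fun x => f x * h x) ∈ A :=
  A.mul_mem hf hh

lemma fun_pow_mem {f : X → ℂ} (hf : f ∈ A) (n : ℕ) : (fun x => f x ^ n) ∈ A := A.pow_mem hf n

lemma fun_const_mul_mem {f : X → ℂ} (c : ℂ) (hf : f ∈ A) : (fun x => c * f x) ∈ A :=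
  fun_mul_mem (const_mem A c) hf

lemma fun_sum_mem {ι : Type*} {s : Finset ι} {f : ι → X → ℂ} (hf : ∀ i ∈ s, f i ∈ A) :
    (fun x => ∑ i ∈ s, f i x) ∈ A := by
  have := A.sum_mem hf
  rwa [← Finset.sum_fn]

lemma fun_prod_mem {ι : Type*} {s : Finset ι} {f : ι → X → ℂ} (hf : ∀ i ∈ s, f i ∈ A) :
    (fun x => ∏ i ∈ s, f i x) ∈ A := by
  have := A.prod_mem hf
  rwa [← Finset.prod_fn]

lemma fun_det_mem {n : Type*} [Fintype n] [DecidableEq n] {M : X → Matrix n n ℂ}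
    (hM : ∀ i j, (fun x => M x i j) ∈ A) : (fun x => (M x).det) ∈ A := by
  simp only [Matrix.det_apply']
  exact fun_sum_mem fun σ _ => fun_const_mul_mem _ (fun_prod_mem fun i _ => hM _ _)

lemma fun_eval_mem {σ : Type*} {v : X → σ → ℂ} (hv : ∀ i, (fun x => v x i) ∈ A)
    (p : MvPolynomial σ ℂ) : (fun x => MvPolynomial.eval (v x) p) ∈ A := by
  induction p using MvPolynomial.induction_on with
  | C a => simpa using const_mem A a
  | add p q hp hq => simpa using fun_add_mem hp hq
  | mul_X p i hp => simpa using fun_mul_mem hp (hv i)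

lemma fun_coeff_quad_mem {u : X → ℂ} {F F₁ F₂ : X → PowerSeries ℂ} (hu : u ∈ A)
    (hF : ∀ n, (fun x => PowerSeries.coeff n (F x)) ∈ A)
    (hF₁ : ∀ n, (fun x => PowerSeries.coeff n (F₁ x)) ∈ A)
    (hF₂ : ∀ n, (fun x => PowerSeries.coeff n (F₂ x)) ∈ A) (n : ℕ) :
    (fun x => PowerSeries.coeff n (quad (u x) (F x) (F₁ x) (F₂ x))) ∈ A := by
  cases n with
  | zero =>
    simp only [coeff_quad_zero]
    exact fun_const_mul_mem _ (fun_pow_mem (hF 0) 2)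
  | succ n =>
    simp only [coeff_quad_succ]
    exact fun_add_mem (fun_add_mem (fun_const_mul_mem _ (fun_mul_mem (hF _) (hF _)))
      (fun_const_mul_mem _ (fun_sum_mem fun i _ => fun_mul_mem (hF _) (hF _))))
      (fun_sum_mem fun i _ => fun_add_mem (fun_sub_mem (fun_mul_mem (hF₁ _) (hF₁ _))
        (fun_const_mul_mem _ (fun_mul_mem (hF _) (hF₂ _))))
        (fun_const_mul_mem _ (fun_mul_mem hu (fun_mul_mem (hF _) (hF _)))))

/-- The functions that are, where `q ≠ 0`, a quotient of an element of `A` by a power of `q`. -/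
def locAlg (A : Subalgebra ℂ (X → ℂ)) (q : X → ℂ) (hq : q ∈ A) : Subalgebra ℂ (X → ℂ) where
  carrier := {f | ∃ N : ℕ, ∃ p ∈ A, ∀ x, q x ≠ 0 → f x * q x ^ N = p x}
  mul_mem' := by
    rintro f h ⟨N, p, hp, hf⟩ ⟨M, r, hr, hh⟩
    refine ⟨N + M, p * r, A.mul_mem hp hr, fun x hx => ?_⟩
    rw [Pi.mul_apply, Pi.mul_apply, ← hf x hx, ← hh x hx]
    ring
  add_mem' := by
    rintro f h ⟨N, p, hp, hf⟩ ⟨M, r, hr, hh⟩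
    refine ⟨N + M, p * q ^ M + r * q ^ N, A.add_mem (A.mul_mem hp (A.pow_mem hq M))
      (A.mul_mem hr (A.pow_mem hq N)), fun x hx => ?_⟩
    simp only [Pi.add_apply, Pi.mul_apply, Pi.pow_apply, ← hf x hx, ← hh x hx]
    ring
  algebraMap_mem' := fun c => ⟨0, _, A.algebraMap_mem c, fun x _ => by simp⟩

variable {q : X → ℂ} {hq : q ∈ A}

lemma mem_locAlg_of_mem {f : X → ℂ} (hf : f ∈ A) : f ∈ locAlg A q hq :=
  ⟨0, f, hf, fun x _ => by simp⟩

lemma mem_locAlg_congr {f h : X → ℂ} (hf : f ∈ locAlg A q hq)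
    (hfh : ∀ x, q x ≠ 0 → h x = f x) : h ∈ locAlg A q hq := by
  obtain ⟨N, p, hp, hx⟩ := hf
  exact ⟨N, p, hp, fun x hqx => by rw [hfh x hqx, hx x hqx]⟩

lemma inv_mem_locAlg : (fun x => (q x)⁻¹) ∈ locAlg A q hq :=
  ⟨1, 1, A.one_mem, fun x hx => by simp [hx]⟩

lemma isRegularOn_of_mem_locAlg {f : X → ℂ} (hf : f ∈ locAlg A q hq) {U : Set X}
    (hU : ∀ x ∈ U, q x ≠ 0) : IsRegularOn A U f := by
  obtain ⟨N, p, hp, hx⟩ := hf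
  exact fun x hxU => ⟨p, hp, q ^ N, A.pow_mem hq N, pow_ne_zero _ (hU x hxU), fun z hz hz' =>
    (eq_div_iff hz').2 (hx z (hU z hz))⟩

lemma isZariskiOpen_ne_zero (hq : q ∈ A) : IsZariskiOpen A {x | q x ≠ 0} :=
  ⟨{q}, by simpa using hq, by simp⟩

lemma coord_mem_polyFunctions {ι : Type} (coords : X → ι → ℂ) (i : ι) :
    (fun x => coords x i) ∈ polyFunctions coords :=
  ⟨MvPolynomial.X i, by simp⟩

lemma mem_polyFunctions_iff {ι : Type} {coords : X → ι → ℂ} {f : X → ℂ} :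
    f ∈ polyFunctions coords ↔ ∃ p : MvPolynomial ι ℂ,
      ∀ x, f x = MvPolynomial.eval (coords x) p := by
  have key : ∀ p : MvPolynomial ι ℂ, ∀ x,
      (MvPolynomial.aeval fun (i : ι) (x : X) => coords x i) p x =
        MvPolynomial.eval (coords x) p := fun p x => by
    induction p using MvPolynomial.induction_on with
    | C a => simp
    | add p q hp hq => simp [hp, hq]
    | mul_X p i hp => simp [hp]
  constructor
  · rintro ⟨p, rfl⟩
    exact ⟨p, fun x => key p x⟩
  · rintro ⟨p, hp⟩
    exact ⟨p, funext fun x => (key p x).trans (hp x).symm⟩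

end Functions

/-! ### Functions on the family of symmetric powers -/

lemma mem_symCoordRing_iff {g : ℕ} {f : SymFamily g → ℂ} : f ∈ SymFamily.coordRing g ↔
    (fun w : PowerFamily g => f w.toSym) ∈ polyFunctions (PowerFamily.coords (g := g)) := Iff.rfl

lemma exists_map_univ_eq {α : Type*} {n : ℕ} {D : Multiset α} (hD : D.card = n) :
    ∃ w : Fin n → α, Multiset.map w Finset.univ.val = D := by
  obtain ⟨l, rfl⟩ := Quot.exists_rep D
  have hl : l.length = n := hD
  subst hl
  exact ⟨l.get, by rw [Fin.univ_val_map, List.ofFn_get]; rfl⟩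

lemma PowerFamily.exists_toSym_eq {g : ℕ} (t : SymFamily g) :
    ∃ w : Fin g → Curve t.1, PowerFamily.toSym ⟨t.1, w⟩ = t := by
  obtain ⟨μ, D, hD⟩ := t
  obtain ⟨w, hw⟩ := exists_map_univ_eq hD
  exact ⟨w, congrArg (Sigma.mk μ) (Subtype.ext hw)⟩

lemma PowerFamily.toSym_comp {g : ℕ} (μ : CurveSpace g) (w : Fin g → Curve μ)
    (σ : Equiv.Perm (Fin g)) :
    PowerFamily.toSym ⟨μ, w ∘ σ⟩ = PowerFamily.toSym ⟨μ, w⟩ := by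
  have : Multiset.map (w ∘ σ) Finset.univ.val = Multiset.map w Finset.univ.val := by
    rw [← Multiset.map_map, Multiset.map_univ_val_equiv]
  exact congrArg (Sigma.mk μ) (Subtype.ext this)

/-- The points `ξ₁, …, ξ_g`. -/
def PowerFamily.xi {g : ℕ} (w : PowerFamily g) (i : Fin g) : ℂ := (w.2 i).xi

/-- The values `y₁, …, y_g`. -/
def PowerFamily.y {g : ℕ} (w : PowerFamily g) (i : Fin g) : ℂ := (w.2 i).y

lemma PowerFamily.xi_ne_zero {g : ℕ} (w : PowerFamily g) (i : Fin g) : w.xi i ≠ 0 := (w.2 i).2.1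

lemma PowerFamily.y_sq {g : ℕ} (w : PowerFamily g) (i : Fin g) :
    w.y i ^ 2 = 4 * muFun w.1 (w.xi i) := (w.2 i).2.2

lemma PowerFamily.map_xi {g : ℕ} (w : PowerFamily g) :
    Multiset.map Curve.xi (w.toSym.2 : Multiset (Curve w.toSym.1)) =
      Multiset.map w.xi Finset.univ.val :=
  Multiset.map_map Curve.xi w.2 Finset.univ.val

/-- The polynomial functions on the family of cartesian powers. -/
abbrev powerRing (g : ℕ) : Subalgebra ℂ (PowerFamily g → ℂ) :=
  polyFunctions (PowerFamily.coords (g := g))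

lemma mu_mem_powerRing {g : ℕ} (i : Fin (2 * g)) :
    (fun w : PowerFamily g => w.1 i) ∈ powerRing g :=
  coord_mem_polyFunctions PowerFamily.coords (Sum.inl i)

lemma xi_mem_powerRing {g : ℕ} (i : Fin g) :
    (fun w : PowerFamily g => w.xi i) ∈ powerRing g :=
  coord_mem_polyFunctions PowerFamily.coords (Sum.inr (Sum.inl i))

lemma y_mem_powerRing {g : ℕ} (i : Fin g) :
    (fun w : PowerFamily g => w.y i) ∈ powerRing g :=
  coord_mem_polyFunctions PowerFamily.coords (Sum.inr (Sum.inr i))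

/-- The equation `y² = 4 μ(ξ)` contains `16 ξ⁻¹` and can be solved for it; inverting `ξ` thus needs
no localization. -/
lemma xi_inv_mem_powerRing {g : ℕ} (i : Fin g) :
    (fun w : PowerFamily g => (w.xi i)⁻¹) ∈ powerRing g := by
  have h : (fun w : PowerFamily g => (w.xi i)⁻¹) = fun w : PowerFamily g => (1 / 16) * (w.y i ^ 2 -
      4 * ∑ j : Fin (2 * g), w.1 j * w.xi i ^ ((j : ℕ) + 1)) := by
    funext w
    rw [w.y_sq, muFun]
    ring
  rw [h]
  exact fun_const_mul_mem _ (fun_sub_mem (fun_pow_mem (y_mem_powerRing i) 2)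
    (fun_const_mul_mem _ (fun_sum_mem fun j _ =>
      fun_mul_mem (mu_mem_powerRing j) (fun_pow_mem (xi_mem_powerRing i) _))))

/-- The discriminant of the points `ξ₁, …, ξ_g`. -/
def symDisc {g : ℕ} (t : SymFamily g) : ℂ :=
  (Matrix.of fun a b : Fin g => (Multiset.map (fun p : Curve t.1 => p.xi ^ ((a : ℕ) + b))
    (t.2 : Multiset (Curve t.1))).sum).det

/-- The matrix of power sums is `Vᵀ V` for the Vandermonde matrix `V`; this exhibits the
discriminant as a function of the unordered points. -/
lemma symDisc_toSym {g : ℕ} (w : PowerFamily g) :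
    symDisc w.toSym = (Matrix.vandermonde w.xi).det ^ 2 := by
  rw [pow_two]
  nth_rewrite 1 [← Matrix.det_transpose]
  rw [← Matrix.det_mul, symDisc]
  congr 1
  ext a b
  rw [Matrix.of_apply, Matrix.mul_apply]
  refine (congrArg Multiset.sum (Multiset.map_map (fun p : Curve w.1 => p.xi ^ ((a : ℕ) + b))
    w.2 Finset.univ.val)).trans ?_
  exact Finset.sum_congr rfl fun i _ => pow_add _ _ _

lemma symDisc_toSym_ne_zero_iff {g : ℕ} (w : PowerFamily g) :
    symDisc w.toSym ≠ 0 ↔ Function.Injective w.xi := by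
  rw [symDisc_toSym, pow_ne_zero_iff two_ne_zero, Matrix.det_vandermonde_ne_zero_iff]

lemma symDisc_mem_coordRing (g : ℕ) : symDisc ∈ SymFamily.coordRing g := by
  rw [mem_symCoordRing_iff]
  simp only [symDisc_toSym]
  exact fun_pow_mem (fun_det_mem fun i j => fun_pow_mem (xi_mem_powerRing i) _) 2

lemma symDisc_toSym_mem (g : ℕ) :
    (fun w : PowerFamily g => symDisc w.toSym) ∈ powerRing g :=
  mem_symCoordRing_iff.1 (symDisc_mem_coordRing g)

/-- A function on the family of symmetric powers is regular off the discriminant if so is its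
pullback to the family of cartesian powers. -/
lemma isRegularOn_symDisc {g : ℕ} {f : SymFamily g → ℂ}
    (hf : (fun w : PowerFamily g => f w.toSym) ∈ locAlg (powerRing g) _ (symDisc_toSym_mem g)) :
    IsRegularOn (SymFamily.coordRing g) {t | symDisc t ≠ 0} f := by
  obtain ⟨N, p, hp, hx⟩ := hf
  -- With the exponent `N + 1` instead of `N` the numerator vanishes on the discriminant, where `f`
  -- is arbitrary. So its pullback equals a polynomial everywhere.
  refine fun t ht => ⟨fun t => f t * symDisc t ^ (N + 1), ?_, fun t => symDisc t ^ (N + 1),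
    fun_pow_mem (symDisc_mem_coordRing g) _, pow_ne_zero _ ht, fun z hz hz' => ?_⟩
  · rw [mem_symCoordRing_iff]
    convert fun_mul_mem hp (symDisc_toSym_mem g) using 2 with w
    by_cases hw : symDisc w.toSym = 0
    · simp [hw]
    · rw [← hx w hw]
      ring
  · rw [mul_div_cancel_right₀ _ hz']

/-! ### The functions and the curve of a solution depend polynomially on its coordinates -/

/-- A function representing the germ of a solution. -/
def solFun {g : ℕ} (s : SolutionSpace g) : ℂ → ℂ := s.regular.choose

lemma coe_solFun {g : ℕ} (s : SolutionSpace g) : (solFun s : Germ (𝓝 (0 : ℂ)) ℂ) = s.u :=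
  s.regular.choose_spec.1

lemma analyticAt_solFun {g : ℕ} (s : SolutionSpace g) : AnalyticAt ℂ (solFun s) 0 :=
  s.regular.choose_spec.2.1

lemma solvesStationaryKdV_solFun {g : ℕ} (s : SolutionSpace g) :
    SolvesStationaryKdV g s.a (solFun s) := s.regular.choose_spec.2.2

/-- The functions `u₁, …, u_g` of a solution. -/
def solU {g : ℕ} (s : SolutionSpace g) : ℕ → ℂ → ℂ := resolventU s.a (solFun s)

open Classical in
/-- The curve of a solution. -/
def solMu {g : ℕ} (s : SolutionSpace g) : CurveSpace g :=
  if h : ∃ μ, IsAssociated s (solU s) μ then h.choose else 0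

lemma isAssociated_sol {g : ℕ} (hg : 1 ≤ g) (s : SolutionSpace g) :
    IsAssociated s (solU s) (solMu s) := by
  have h := exists_isAssociated hg s (analyticAt_solFun s) (coe_solFun s)
    (solvesStationaryKdV_solFun s)
  unfold solMu solU
  rw [dif_pos h]
  exact h.choose_spec

lemma a_mem_coordRing {g : ℕ} (k : Fin (g - 1)) :
    (fun s : SolutionSpace g => s.a k) ∈ SolutionSpace.coordRing g :=
  coord_mem_polyFunctions SolutionSpace.coords (Sum.inr k)

lemma coeff_phi_mem {g : ℕ} (l : ℕ) :
    (fun s : SolutionSpace g => PowerSeries.coeff l (phi g s.a)) ∈ SolutionSpace.coordRing g := by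
  by_cases hl : 2 ≤ l ∧ l ≤ g
  · simp only [coeff_phi hl.1 hl.2]
    exact a_mem_coordRing _
  · simp only [phi, PowerSeries.coeff_mk, dif_neg hl]
    exact const_mem _ _

lemma evalJet_solFun_mem {g : ℕ} {p : DiffPoly} (hp : p ∈ jets (2 * g + 1)) :
    (fun s : SolutionSpace g => evalJet (solFun s) 0 p) ∈ SolutionSpace.coordRing g := by
  refine jets_induction (P := fun p => (fun s : SolutionSpace g => evalJet (solFun s) 0 p) ∈
    SolutionSpace.coordRing g) (fun c => ?_) (fun n hn => ?_) (fun p q hp hq => ?_)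
    (fun p q hp hq => ?_) hp
  · simpa using const_mem _ c
  · have h := coord_mem_polyFunctions (SolutionSpace.coords (g := g)) (Sum.inl ⟨n, hn⟩)
    have h1 : (fun s : SolutionSpace g => evalJet (solFun s) 0 (MvPolynomial.X n)) =
        fun s : SolutionSpace g => s.coords (Sum.inl ⟨n, hn⟩) := by
      funext s
      rw [evalJet_X, SolutionSpace.coords, Sum.elim_inl, ← coe_solFun s]
      rfl
    rw [h1]
    exact h
  · simpa only [evalJet_add] using fun_add_mem hp hq
  · simpa only [evalJet_mul] using fun_mul_mem hp hq

lemma iterate_deriv_evalJet {f : ℂ → ℂ} {x : ℂ} (hf : AnalyticAt ℂ f x) (p : DiffPoly) (j : ℕ) :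
    deriv^[j] (fun x => evalJet f x p) =ᶠ[𝓝 x] fun x => evalJet f x (dx^[j] p) := by
  induction j with
  | zero => exact EventuallyEq.rfl
  | succ j ih =>
    rw [Function.iterate_succ_apply', Function.iterate_succ_apply']
    exact ih.deriv.trans (deriv_evalJet hf _)

lemma iterate_dx_mem_jets {N : ℕ} {p : DiffPoly} (hp : p ∈ jets N) (j : ℕ) :
    dx^[j] p ∈ jets (N + j) := by
  induction j with
  | zero => exact hp
  | succ j ih => rw [Function.iterate_succ_apply']; exact dx_mem_jets ih

lemma iterate_dx_coeff_resolventMul (φ : PowerSeries ℂ) (n j : ℕ) :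
    dx^[j] (PowerSeries.coeff n (resolventMul φ)) = ∑ i ∈ Finset.range (n + 1),
      MvPolynomial.C (2 * PowerSeries.coeff i φ) * dx^[j] (resolvent (n - i)) := by
  induction j with
  | zero =>
    rw [Function.iterate_zero, id, coeff_resolventMul, Finset.mul_sum]
    refine Finset.sum_congr rfl fun i _ => ?_
    rw [map_mul, show (MvPolynomial.C 2 : DiffPoly) = 2 from map_ofNat _ 2, mul_assoc, id]
  | succ j ih =>
    rw [Function.iterate_succ_apply', ih, map_sum]
    refine Finset.sum_congr rfl fun i _ => ?_
    rw [dx_mul, dx_C, mul_zero, add_zero, Function.iterate_succ_apply']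

lemma iterate_deriv_solU {g : ℕ} (s : SolutionSpace g) (i j : ℕ) :
    deriv^[j] (solU s i) =ᶠ[𝓝 0] fun x => -∑ l ∈ Finset.range (i + 1),
      2 * PowerSeries.coeff l (phi g s.a) * evalJet (solFun s) x (dx^[j] (resolvent (i - l))) := by
  have h : solU s i = fun x => evalJet (solFun s) x
      (-PowerSeries.coeff i (resolventMul (phi g s.a))) := by
    funext x
    exact (map_neg (MvPolynomial.eval _) _).symm
  rw [h]
  refine (iterate_deriv_evalJet (analyticAt_solFun s) _ j).trans (Eventually.of_forall fun x => ?_)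
  simp only
  rw [iterate_map_neg, iterate_dx_coeff_resolventMul]
  refine (map_neg (MvPolynomial.eval _) _).trans (congrArg Neg.neg ?_)
  refine (evalJet_sum _ _ _ _).trans (Finset.sum_congr rfl fun l _ => ?_)
  rw [evalJet_mul, evalJet_C]

/-- The differential polynomials involved are `R₀, …, R_g` with at most two derivatives; they have
order at most `2g`, which is exactly the range of the coordinates `c_k`. -/
lemma iterate_deriv_solU_mem {g i j : ℕ} (hi : i ≤ g) (hj : j ≤ 2) :
    (fun s : SolutionSpace g => deriv^[j] (solU s i) 0) ∈ SolutionSpace.coordRing g := by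
  simp only [(iterate_deriv_solU _ i j).self_of_nhds]
  refine fun_neg_mem (fun_sum_mem fun l _ => fun_mul_mem (fun_const_mul_mem 2 (coeff_phi_mem l))
    (evalJet_solFun_mem ?_))
  obtain h0 | h0 : i - l = 0 ∨ 1 ≤ i - l := by omega
  · rw [h0, resolvent_zero]
    cases j with
    | zero => exact one_mem _
    | succ j =>
      rw [Function.iterate_succ_apply, Derivation.map_one_eq_zero, iterate_map_zero]
      exact zero_mem _
  · exact jets_mono (by omega) (iterate_dx_mem_jets (resolvent_mem_jets (i - l)) j)

lemma coeff_genPoly_mem {X : Type} {A : Subalgebra ℂ (X → ℂ)} {g : ℕ} {v : X → ℕ → ℂ}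
    (hv : ∀ i ≤ g, (fun x => v x i) ∈ A) (a : ℂ) (n : ℕ) :
    (fun x => (genPoly g a (v x)).coeff n) ∈ A := by
  simp only [coeff_genPoly]
  split_ifs with h1 h2
  · exact const_mem _ _
  · exact fun_neg_mem (hv n h2)
  · exact const_mem _ _

lemma IsAssociated.curvePoly_eq {g : ℕ} {s : SolutionSpace g} {U : ℕ → ℂ → ℂ} {μ : CurveSpace g}
    (h : IsAssociated s U μ) : curvePoly μ = quadPoly (U 1 0) (genPoly g 2 fun n => U n 0)
      (genPoly g 0 fun n => deriv (U n) 0) (genPoly g 0 fun n => deriv (deriv (U n)) 0) := by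
  refine Polynomial.coe_injective ℂ ?_
  rw [← h.quadF_eq.self_of_nhds]
  exact quadF_genCoeff _ _ _ _

lemma solMu_mem {g : ℕ} (hg : 1 ≤ g) (i : Fin (2 * g)) :
    (fun s : SolutionSpace g => solMu s i) ∈ SolutionSpace.coordRing g := by
  have h : (fun s : SolutionSpace g => solMu s i) = fun s => (1 / 4) *
      PowerSeries.coeff ((i : ℕ) + 1 + 1) (quad (solU s 1 0)
      (genPoly g 2 fun n => solU s n 0) (genPoly g 0 fun n => deriv (solU s n) 0)
      (genPoly g 0 fun n => deriv (deriv (solU s n)) 0)) := by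
    funext s
    rw [← coe_quadPoly, ← (isAssociated_sol hg s).curvePoly_eq, Polynomial.coeff_coe,
      coeff_succ_curvePoly_of_pos _ i rfl]
    ring
  rw [h]
  refine fun_const_mul_mem _ (fun_coeff_quad_mem
    (iterate_deriv_solU_mem (j := 0) hg (by omega)) (fun n => ?_) (fun n => ?_) (fun n => ?_) _)
  all_goals simp only [Polynomial.coeff_coe]
  · exact coeff_genPoly_mem (fun i hi => iterate_deriv_solU_mem (j := 0) hi (by omega)) _ _
  · exact coeff_genPoly_mem (fun i hi => iterate_deriv_solU_mem (j := 1) hi (by omega)) _ _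
  · exact coeff_genPoly_mem (fun i hi => iterate_deriv_solU_mem (j := 2) hi (by omega)) _ _

/-! ### Pullbacks of functions on the family of symmetric powers -/

/-- The leading coefficient of `𝐮(0, ξ)`. -/
def leadCoef {g : ℕ} (s : SolutionSpace g) : ℂ := solU s g 0

lemma leadCoef_mem (g : ℕ) : leadCoef ∈ SolutionSpace.coordRing g :=
  iterate_deriv_solU_mem (j := 0) le_rfl (by omega)

/-- The functions on the space of solutions that are regular where `u_g(0) ≠ 0`. -/
abbrev leadLoc (g : ℕ) : Subalgebra ℂ (SolutionSpace g → ℂ) :=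
  locAlg (SolutionSpace.coordRing g) leadCoef (leadCoef_mem g)

/-- The elementary symmetric functions of the roots of `2 - 𝐮(0, ξ)`. -/
def rootEsymm {g : ℕ} (i : ℕ) (s : SolutionSpace g) : ℂ :=
  (-1) ^ i * ((rootPoly g (solU s)).coeff (g - i) * -(leadCoef s)⁻¹)

lemma rootEsymm_mem (g i : ℕ) : rootEsymm i ∈ leadLoc g :=
  fun_const_mul_mem _ (fun_mul_mem (mem_locAlg_of_mem (coeff_genPoly_mem
    (fun i hi => iterate_deriv_solU_mem (j := 0) hi (by omega)) _ _)) (fun_neg_mem inv_mem_locAlg))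

lemma rootEsymm_eq {g i : ℕ} (hg : 1 ≤ g) (hi : i ≤ g) {s : SolutionSpace g}
    (hs : leadCoef s ≠ 0) : rootEsymm i s = (rootPoly g (solU s)).roots.esymm i := by
  have hd := natDegree_rootPoly hg hs
  have h := Polynomial.coeff_eq_esymm_roots_of_card (p := rootPoly g (solU s))
    (IsAlgClosed.splits (rootPoly g (solU s))).natDegree_eq_card_roots.symm (k := g - i) (by omega)
  have hl : (rootPoly g (solU s)).leadingCoeff = -leadCoef s := by
    rw [Polynomial.leadingCoeff, hd, rootPoly_eq, coeff_genPoly, if_neg (by omega), if_pos le_rfl]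
    rfl
  rw [hd, hl, show g - (g - i) = i by omega] at h
  have h1 : ((-1 : ℂ) ^ i) * (-1) ^ i = 1 := by rw [← mul_pow]; norm_num
  rw [rootEsymm, h]
  have h2 : leadCoef s * (leadCoef s)⁻¹ = 1 := mul_inv_cancel₀ hs
  linear_combination ((rootPoly g (solU s)).roots.esymm i * leadCoef s * (leadCoef s)⁻¹) * h1 +
    (rootPoly g (solU s)).roots.esymm i * h2

open Classical in
/-- The map `υ`, extended arbitrarily where it is not defined. -/
def upsilon {g : ℕ} [Nonempty (SymFamily g)] (s : SolutionSpace g) : SymFamily g :=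
  if h : ∃ t, IsUpsilon s t then h.choose else Classical.arbitrary _

lemma isUpsilon_iff {g : ℕ} (hg : 1 ≤ g) [Nonempty (SymFamily g)] {s : SolutionSpace g}
    (hs : leadCoef s ≠ 0) (t : SymFamily g) : IsUpsilon s t ↔ t = upsilon s := by
  have h := existsUnique_isUpsilon hg (isAssociated_sol hg s) hs
  have h1 : IsUpsilon s (upsilon s) := by
    rw [upsilon, dif_pos h.exists]
    exact h.exists.choose_spec
  exact ⟨fun ht => h.unique ht h1, fun ht => ht ▸ h1⟩

lemma exists_powerFamily_upsilon {g : ℕ} (hg : 1 ≤ g) [Nonempty (SymFamily g)]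
    {s : SolutionSpace g} (hs : leadCoef s ≠ 0) : ∃ w : Fin g → Curve (solMu s),
      (PowerFamily.toSym ⟨solMu s, w⟩ = upsilon s) ∧
      Multiset.map (fun i => (w i).xi) Finset.univ.val = (rootPoly g (solU s)).roots ∧
      ∀ i, (w i).y = genFun g (fun i => deriv (solU s i)) 0 (w i).xi := by
  have ht := (isUpsilon_iff hg hs (upsilon s)).2 rfl
  obtain ⟨h1, h2, h3⟩ := (isAssociated_sol hg s).isUpsilon_unique hg ht
  generalize upsilon s = t at h1 h2 h3
  obtain ⟨μ, D⟩ := t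
  obtain rfl : μ = solMu s := h1
  obtain ⟨w, hw⟩ := PowerFamily.exists_toSym_eq (⟨solMu s, D⟩ : SymFamily g)
  have hw' : Multiset.map w Finset.univ.val = D.1 :=
    congrArg Subtype.val (eq_of_heq (Sigma.mk.inj hw).2)
  refine ⟨w, hw, ?_, fun i => h3 _ ?_⟩
  · rw [← h2]
    refine (Multiset.map_map Curve.xi w Finset.univ.val).symm.trans ?_
    exact congrArg (Multiset.map Curve.xi) hw'
  · show w i ∈ D.1
    rw [← hw']
    exact Multiset.mem_map_of_mem w (Finset.mem_univ_val i)

/-- Evaluation at a point, on an algebra of functions. -/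
def evalAt {X : Type} (A : Subalgebra ℂ (X → ℂ)) (x : X) : A →ₐ[ℂ] ℂ :=
  (Pi.evalAlgHom ℂ (fun _ : X => ℂ) x).comp A.val

/-- Pullbacks under `υ` of regular functions are regular where `u_g(0) ≠ 0`. -/
lemma comp_upsilon_mem {g : ℕ} (hg : 1 ≤ g) [Nonempty (SymFamily g)] {f : SymFamily g → ℂ}
    (hf : f ∈ SymFamily.coordRing g) : (fun s => f (upsilon s)) ∈ leadLoc g := by
  obtain ⟨P, hP⟩ := mem_polyFunctions_iff.1 (mem_symCoordRing_iff.1 hf)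
  set L := leadLoc g with hL
  set muL : Fin (2 * g) → L := fun i => ⟨_, mem_locAlg_of_mem (solMu_mem hg i)⟩ with hmu
  have hd : ∀ k ≤ g, (fun s : SolutionSpace g => deriv (solU s k) 0) ∈ L := fun k hk =>
    mem_locAlg_of_mem (iterate_deriv_solU_mem (j := 1) hk (by omega))
  set dL : ℕ → L := fun k => if hk : k ≤ g then ⟨_, hd k hk⟩ else 0 with hdL
  set eL : Fin g → L := fun i => ⟨_, rootEsymm_mem g ((i : ℕ) + 1)⟩ with heL
  -- Since `yᵢ = ∑ u_k'(0) ξᵢᵏ`, the `y`-variables can be eliminated. There remains a polynomial in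
  -- the `ξᵢ` over the ring `L` of functions regular where `u_g(0) ≠ 0`.
  set G : MvPolynomial (Fin g) L := MvPolynomial.aeval (Sum.elim (fun i => MvPolynomial.C (muL i))
    (Sum.elim MvPolynomial.X fun i => ∑ k ∈ Finset.Icc 1 g,
      MvPolynomial.C (dL k) * MvPolynomial.X i ^ k)) P with hG
  -- `G` need not be symmetric as a polynomial, though its values at the points are unchanged by
  -- permutations. Summing over the group makes it symmetric and multiplies these values by `g!`.
  set Gs : MvPolynomial (Fin g) L := ∑ σ : Equiv.Perm (Fin g), MvPolynomial.rename σ G with hGs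
  have hsymm : Gs.IsSymmetric := fun τ => by
    rw [hGs, map_sum]
    simp only [MvPolynomial.rename_rename]
    exact Fintype.sum_equiv (Equiv.mulLeft τ) _ _ fun σ => rfl
  -- The fundamental theorem on symmetric polynomials over `L`; by Vieta the elementary symmetric
  -- functions of the roots lie in `L`.
  obtain ⟨Q, hQ⟩ := MvPolynomial.esymmAlgHom_surjective (σ := Fin g) L (n := g) (by simp)
    ⟨Gs, hsymm⟩
  have hQ' : Gs = MvPolynomial.aeval (fun i : Fin g => MvPolynomial.esymm (Fin g) L (i + 1)) Q := by
    have := congrArg Subtype.val hQ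
    exact this.symm.trans (MvPolynomial.esymmAlgHom_apply _)
  have hfac : (g.factorial : ℂ) ≠ 0 := by exact_mod_cast g.factorial_ne_zero
  refine mem_locAlg_congr (f := fun s => (1 / (g.factorial : ℂ)) *
    ((MvPolynomial.aeval eL Q : L) : SolutionSpace g → ℂ) s)
    (fun_const_mul_mem _ (MvPolynomial.aeval eL Q : L).2) fun s hs => ?_
  obtain ⟨w, hw, hroots, hy⟩ := exists_powerFamily_upsilon hg hs
  set ev : L →+* ℂ := (evalAt L s).toRingHom with hev
  set x : Fin g → ℂ := fun i => (w i).xi with hx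
  have hGeval : ∀ σ : Equiv.Perm (Fin g), MvPolynomial.eval₂ ev x (MvPolynomial.rename σ G) =
      f (upsilon s) := fun σ => by
    have h1 := hP ⟨solMu s, w ∘ σ⟩
    rw [PowerFamily.toSym_comp, hw] at h1
    rw [h1, MvPolynomial.eval₂_rename, hG, ← MvPolynomial.coe_eval₂Hom,
      MvPolynomial.aeval_def, ← MvPolynomial.coe_eval₂Hom, ← RingHom.comp_apply]
    congr 1
    refine MvPolynomial.ringHom_ext (fun c => ?_) fun i => ?_
    · simp only [RingHom.comp_apply, MvPolynomial.coe_eval₂Hom, MvPolynomial.eval₂_C,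
        MvPolynomial.eval_C]
      rw [IsScalarTower.algebraMap_apply ℂ L (MvPolynomial (Fin g) L), MvPolynomial.algebraMap_eq,
        MvPolynomial.eval₂_C]
      exact (evalAt L s).commutes c
    · rcases i with i | i | i
      · simp only [RingHom.comp_apply, MvPolynomial.coe_eval₂Hom, MvPolynomial.eval₂_X,
          Sum.elim_inl, MvPolynomial.eval₂_C, MvPolynomial.eval_X]
        rfl
      · simp only [RingHom.comp_apply, MvPolynomial.coe_eval₂Hom, MvPolynomial.eval₂_X,
          Sum.elim_inl, Sum.elim_inr, MvPolynomial.eval_X]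
        rfl
      · simp only [RingHom.comp_apply, MvPolynomial.coe_eval₂Hom, MvPolynomial.eval₂_X,
          Sum.elim_inr, MvPolynomial.eval_X, MvPolynomial.eval₂_sum, MvPolynomial.eval₂_mul,
          MvPolynomial.eval₂_C, MvPolynomial.eval₂_pow]
        refine Eq.trans ?_ (hy (σ i)).symm
        refine Finset.sum_congr rfl fun k hk => ?_
        rw [hdL]
        simp only [dif_pos (Finset.mem_Icc.1 hk).2]
        rfl
  have h1 : MvPolynomial.eval₂ ev x Gs = (g.factorial : ℂ) * f (upsilon s) := by
    rw [hGs, MvPolynomial.eval₂_sum, Finset.sum_congr rfl fun σ _ => hGeval σ, Finset.sum_const,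
      Finset.card_univ, Fintype.card_perm, Fintype.card_fin, nsmul_eq_mul]
  have h2 : MvPolynomial.eval₂ ev x Gs = ((MvPolynomial.aeval eL Q : L) : SolutionSpace g → ℂ) s := by
    have h3 : ((MvPolynomial.aeval eL Q : L) : SolutionSpace g → ℂ) s =
        ev (MvPolynomial.aeval eL Q) := rfl
    rw [h3, hQ', ← MvPolynomial.coe_eval₂Hom, MvPolynomial.aeval_def, MvPolynomial.aeval_def,
      ← MvPolynomial.coe_eval₂Hom, ← MvPolynomial.coe_eval₂Hom, ← RingHom.comp_apply,
      ← RingHom.comp_apply]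
    congr 1
    refine MvPolynomial.ringHom_ext (fun c => ?_) fun i => ?_
    · simp
    · simp only [RingHom.comp_apply, MvPolynomial.coe_eval₂Hom, MvPolynomial.eval₂_X]
      have h4 : ev (eL i) = rootEsymm ((i : ℕ) + 1) s := rfl
      rw [h4, rootEsymm_eq hg i.2 hs, ← hroots,
        ← MvPolynomial.aeval_esymm_eq_multiset_esymm (Fin g) ℂ, MvPolynomial.aeval_def,
        ← MvPolynomial.map_esymm (R := L) (Fin g) _ ev, MvPolynomial.eval₂_map]
      rfl
  rw [← h2, h1]
  field_simp

/-! ### The Lenard system as a polynomial vector field -/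

/-- The coordinate `u_{j+1}⁽ᵏ⁾` if `j < g`, and `0` otherwise. -/
def jetVar (g j : ℕ) (k : Fin 3) : MvPolynomial (Fin g × Fin 3) ℂ :=
  if h : j < g then MvPolynomial.X (⟨j, h⟩, k) else 0

/-- The vector field of the system `u_j''' = 2 u₁' u_j + 4 u₁ u_j' + 4 u_{j+1}'`, in the
coordinates `u_j, u_j', u_j''`. -/
def lenardField (g : ℕ) (p : Fin g × Fin 3) : MvPolynomial (Fin g × Fin 3) ℂ :=
  ![jetVar g p.1 1, jetVar g p.1 2, 2 * jetVar g 0 1 * jetVar g p.1 0 +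
    4 * jetVar g 0 0 * jetVar g p.1 1 + 4 * jetVar g (p.1 + 1) 1] p.2

/-- The values of `u_j, u_j', u_j''` at a point. -/
def jetVec (g : ℕ) (U : ℕ → ℂ → ℂ) (x : ℂ) (p : Fin g × Fin 3) : ℂ :=
  deriv^[(p.2 : ℕ)] (U ((p.1 : ℕ) + 1)) x

lemma eval_jetVar {g j : ℕ} (hj : j < g) (k : Fin 3) (v : Fin g × Fin 3 → ℂ) :
    MvPolynomial.eval v (jetVar g j k) = v (⟨j, hj⟩, k) := by
  rw [jetVar, dif_pos hj, MvPolynomial.eval_X]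

lemma lenardF_genCoeff_eq_zero_iff {g : ℕ} (hg : 1 ≤ g) {U : ℕ → ℂ → ℂ} {x : ℂ} :
    lenardF (U 1) (genCoeff g U) x = 0 ↔ ∀ j : Fin g,
      deriv (deriv (deriv (U (j + 1)))) x =
        MvPolynomial.eval (jetVec g U x) (lenardField g (j, 2)) := by
  have hF : ∀ j : Fin g, MvPolynomial.eval (jetVec g U x) (lenardField g (j, 2)) =
      2 * deriv (U 1) x * U (j + 1) x + 4 * U 1 x * deriv (U (j + 1)) x -
        4 * deriv (genCoeff g U (j + 2)) x := fun j => by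
    have h1 : MvPolynomial.eval (jetVec g U x) (jetVar g (j + 1) 1) =
        -deriv (genCoeff g U (j + 2)) x := by
      by_cases hj : (j : ℕ) + 1 < g
      · rw [eval_jetVar hj, genCoeff_of_mem (by omega) (by omega), deriv.fun_neg, neg_neg]
        rfl
      · rw [jetVar, dif_neg hj, genCoeff_of_lt (by omega), deriv_const, map_zero, neg_zero]
    have h2 : MvPolynomial.eval (jetVec g U x) 2 = 2 := map_ofNat _ 2
    have h4 : MvPolynomial.eval (jetVec g U x) 4 = 4 := map_ofNat _ 4
    show MvPolynomial.eval (jetVec g U x) (2 * jetVar g 0 1 * jetVar g j 0 +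
      4 * jetVar g 0 0 * jetVar g j 1 + 4 * jetVar g (j + 1) 1) = _
    simp only [map_add, map_mul, h1, h2, h4, eval_jetVar hg, eval_jetVar j.2]
    simp only [jetVec]
    show 2 * deriv (U 1) x * U (j + 1) x + 4 * U 1 x * deriv (U (j + 1)) x +
      4 * -deriv (genCoeff g U (j + 2)) x = _
    ring
  have hd : ∀ V : ℂ → ℂ, deriv (fun x => -V x) = fun x => -deriv V x := fun V => deriv.fun_neg'
  rw [lenardF_eq_zero_iff]
  constructor
  · intro h j
    have := h (j + 1) j.2
    rw [genCoeff_of_mem (by omega) j.2, hd, hd, hd] at this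
    rw [hF]
    linear_combination this
  · intro h n hn
    cases n with
    | zero =>
      -- The equation of order `0` holds trivially: the potential is `u₁` itself.
      rw [genCoeff_zero, genCoeff_of_mem le_rfl hg, hd]
      simp only [deriv_const']
      ring
    | succ n =>
      have := h ⟨n, hn⟩
      rw [hF] at this
      rw [genCoeff_of_mem (by omega) hn, hd, hd, hd]
      linear_combination this

/-- The Lenard system has solutions with arbitrary initial values. -/
lemma exists_lenard_solution {g : ℕ} (hg : 1 ≤ g) (v : ℕ → ℕ → ℂ) : ∃ U : ℕ → ℂ → ℂ,
    (∀ i ∈ Finset.Icc 1 g, AnalyticAt ℂ (U i) 0) ∧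
    (∀ i ∈ Finset.Icc 1 g, ∀ k < 3, deriv^[k] (U i) 0 = v k i) ∧
    ∀ᶠ x in 𝓝 0, lenardF (U 1) (genCoeff g U) x = 0 := by
  obtain ⟨y, hya, hy0, hy⟩ := exists_analytic_flow (lenardField g)
    fun p => v p.2 ((p.1 : ℕ) + 1)
  set U : ℕ → ℂ → ℂ := fun i x => if h : i - 1 < g then y x (⟨i - 1, h⟩, 0) else 0 with hU
  have hU0 : ∀ j : Fin g, U (j + 1) = fun x => y x (j, 0) := fun j => by
    funext x
    simp only [hU]
    rw [dif_pos (by omega)]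
    rfl
  have hd0 : ∀ j : Fin g, deriv (U (j + 1)) =ᶠ[𝓝 0] fun x => y x (j, 1) := fun j => by
    rw [hU0]
    refine hy.mono fun x hx => (hx (j, 0)).deriv.trans ?_
    exact eval_jetVar j.2 1 _
  have hd1 : ∀ j : Fin g, deriv (deriv (U (j + 1))) =ᶠ[𝓝 0] fun x => y x (j, 2) := fun j => by
    refine (hd0 j).deriv.trans (hy.mono fun x hx => (hx (j, 1)).deriv.trans ?_)
    exact eval_jetVar j.2 2 _
  have hd2 : ∀ j : Fin g, deriv (deriv (deriv (U (j + 1)))) =ᶠ[𝓝 0]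
      fun x => MvPolynomial.eval (y x) (lenardField g (j, 2)) := fun j =>
    (hd1 j).deriv.trans (hy.mono fun x hx => (hx (j, 2)).deriv)
  have hvec : ∀ᶠ x in 𝓝 0, jetVec g U x = y x := by
    filter_upwards [eventually_all.2 hd0, eventually_all.2 hd1] with x h0 h1
    funext ⟨j, k⟩
    fin_cases k
    · exact congrFun (hU0 j) x
    · exact h0 j
    · exact h1 j
  have hi : ∀ i ∈ Finset.Icc 1 g, ∃ j : Fin g, (j : ℕ) + 1 = i := fun i hi => by
    have := Finset.mem_Icc.1 hi
    exact ⟨⟨i - 1, by omega⟩, by simp only; omega⟩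
  refine ⟨U, fun i h => ?_, fun i h k hk => ?_, ?_⟩
  · obtain ⟨j, rfl⟩ := hi i h
    rw [hU0]
    exact hya (j, 0)
  · obtain ⟨j, rfl⟩ := hi i h
    have := congrFun hvec.self_of_nhds (j, ⟨k, hk⟩)
    rw [hy0] at this
    exact this
  · filter_upwards [hvec, eventually_all.2 hd2] with x hx h2
    rw [lenardF_genCoeff_eq_zero_iff hg, hx]
    exact h2

/-! ### The constants of a curve -/

/-- The coefficients of the square root of a power series with constant coefficient `1`. -/
def sqrtCoeff (c : ℕ → ℂ) : ℕ → ℂ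
  | 0 => 1
  | n + 1 => (c (n + 1) - ∑ i : Fin n, sqrtCoeff c (i + 1) * sqrtCoeff c (n - i)) / 2

/-- The series `4 ξ μ(ξ) / 16` starts with `1 + 0 ξ`, hence so does its square root; the
coefficients of index `2` to `g` of the root serve as the `a_k`. Agreement is only required up to
`ξᵍ`, so later coefficients may be dropped. -/
lemma exists_phi_sq_eq {g : ℕ} (μ : CurveSpace g) : ∃ a : Fin (g - 1) → ℂ,
    ∀ n < g, (curvePoly μ).coeff (n + 1) = PowerSeries.coeff (n + 1) (16 * phi g a ^ 2) := by
  set b := sqrtCoeff fun n => (curvePoly μ).coeff n / 16 with hb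
  have hb0 : b 0 = 1 := by rw [hb, sqrtCoeff]
  have hbs : ∀ n, (curvePoly μ).coeff (n + 1) / 16 =
      2 * b (n + 1) + ∑ i ∈ Finset.range n, b (i + 1) * b (n - i) := fun n => by
    rw [hb, sqrtCoeff, Finset.sum_range]
    ring
  have hb1 : b 1 = 0 := by
    have := hbs 0
    rw [coeff_curvePoly, if_neg (by omega), dif_neg (by omega)] at this
    simpa using this.symm
  refine ⟨fun k => b (g - k), fun n hn => ?_⟩
  have hphi : ∀ l ≤ g, PowerSeries.coeff l (phi g fun k => b (g - k)) = b l := fun l hl => by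
    obtain rfl | rfl | h2 : l = 0 ∨ l = 1 ∨ 2 ≤ l := by omega
    · rw [coeff_phi_zero, hb0]
    · rw [coeff_phi_one, hb1]
    · rw [coeff_phi h2 hl]
      congr 1
      simp only
      omega
  rw [coeff_sixteen_mul, coeff_sq_succ, coeff_phi_zero, one_mul, hphi _ hn]
  rw [Finset.sum_congr rfl fun i hi => by
    have := Finset.mem_range.1 hi
    rw [hphi (i + 1) (by omega), hphi (n - i) (by omega)], ← hbs]
  ring

/-! ### Solutions with a given curve and given points -/

/-- Solutions of the Lenard system on a spectral curve come from solutions of a stationary KdV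
equation. -/
lemma exists_isAssociated_of_lenard {g : ℕ} (hg : 1 ≤ g) {U : ℕ → ℂ → ℂ} {μ : CurveSpace g}
    (hU : ∀ i ∈ Finset.Icc 1 g, AnalyticAt ℂ (U i) 0)
    (hl : ∀ᶠ x in 𝓝 0, lenardF (U 1) (genCoeff g U) x = 0)
    (h0 : quadF (U 1) (genCoeff g U) 0 = (curvePoly μ : PowerSeries ℂ)) :
    ∃ s : SolutionSpace g, IsAssociated s U μ := by
  have hq := eventually_quadF_genCoeff_eq hg hU hl h0
  obtain ⟨a, ha⟩ := exists_phi_sq_eq μ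
  have hf : AnalyticAt ℂ (U 1) 0 := hU 1 (Finset.mem_Icc.2 ⟨le_rfl, hg⟩)
  -- `F` and `2 φ R` have the same constant term and the same quadratic form up to `ξᵍ`, so they
  -- agree up to `ξᵍ`.
  have hR : ∀ n ≤ g, genCoeff g U n =ᶠ[𝓝 0] resolventFun (phi g a) (U 1) n := fun n hn => by
    refine eventuallyEq_of_coeff_quadF_eq (u := U 1) (v := U 1) EventuallyEq.rfl
      (by rw [genCoeff_zero]) (by rw [resolventFun_zero (coeff_phi_zero _ _)])
      (fun n hn => ?_) n hn
    filter_upwards [hq, hf.eventually_analyticAt] with x hx hfx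
    rw [hx, quadF_resolventFun _ hfx, Polynomial.coeff_coe, ha n hn]
  have hs : SolvesStationaryKdV g a (U 1) := by
    rw [solvesStationaryKdV_iff]
    filter_upwards [hl, hf.eventually_analyticAt, hR g le_rfl, (hR g le_rfl).deriv,
      (hR g le_rfl).deriv.deriv.deriv] with x hx hfx e0 e1 e3
    have h1 := lenardF_eq_zero_iff.1 hx g le_rfl
    have h2 := congrArg (PowerSeries.coeff (g + 1)) (lenardF_resolventFun (phi g a) hfx)
    rw [lenardF, coeff_lenard_succ] at h2
    simp only [PowerSeries.coeff_mk, map_zero] at h2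
    have h3 : deriv (resolventFun (phi g a) (U 1) (g + 1)) x =
        2 * evalJet (U 1) x (dx (stationaryPoly g a)) := by
      have : resolventFun (phi g a) (U 1) (g + 1) =
          fun x => evalJet (U 1) x (2 * stationaryPoly g a) := by
        funext x; rw [resolventFun, coeff_resolventMul_phi hg]
      rw [this, (hasDerivAt_evalJet hfx _).deriv, evalJet_dx_two_mul]
    -- The Lenard equations of order `g` for `F` and for `2 φ R` differ only in the coefficient of
    -- index `g + 1`, which is `0` for `F`. Comparison yields the stationary equation.
    rw [genCoeff_of_lt (Nat.lt_succ_self _), deriv_const, e0, e1, e3] at h1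
    rw [h3] at h2
    linear_combination (h2 - h1) / 8
  refine ⟨⟨U 1, a, U 1, rfl, hf, hs⟩, hU, rfl, (constants_iff _ μ).2 ha, ?_⟩
  exact hq.mono fun x hx => (quadF_genCoeff_eq_iff μ U x).1 hx

lemma genPoly_eq {g : ℕ} {a : ℂ} {F : Polynomial ℂ} (h0 : F.coeff 0 = a) (hd : F.natDegree ≤ g) :
    genPoly g a (fun n => -F.coeff n) = F := by
  ext n
  rw [coeff_genPoly]
  split_ifs with h1 h2
  · rw [h1, h0]
  · rw [neg_neg]
  · exact (Polynomial.coeff_eq_zero_of_natDegree_lt (by omega)).symm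

lemma coeff_quadPoly_zero (u : ℂ) (F F₁ F₂ : Polynomial ℂ) :
    (quadPoly u F F₁ F₂).coeff 0 = 4 * F.coeff 0 ^ 2 := by
  rw [← Polynomial.coeff_coe, coe_quadPoly, coeff_quad_zero, Polynomial.coeff_coe]

lemma coeff_quadPoly_one (u : ℂ) (F F₁ F₂ : Polynomial ℂ) :
    (quadPoly u F F₁ F₂).coeff 1 = 8 * (F.coeff 0 * F.coeff 1) + F₁.coeff 0 ^ 2 -
      2 * (F.coeff 0 * F₂.coeff 0) + 4 * (u * F.coeff 0 ^ 2) := by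
  rw [← Polynomial.coeff_coe, coe_quadPoly, coeff_quad_succ]
  simp only [Polynomial.coeff_coe, Finset.sum_range_zero, zero_add, Finset.sum_range_one,
    Nat.sub_self]
  ring

/-- Points on a curve with distinct `ξ`-coordinates come from polynomials `F = 2 - 𝐮`,
`F₁ = -𝐮'`, `F₂ = -𝐮''`. -/
lemma exists_quadPoly_eq {g : ℕ} (hg : 1 ≤ g) (w : PowerFamily g) (hw : Function.Injective w.xi) :
    ∃ F F₁ F₂ : Polynomial ℂ, F.natDegree = g ∧ F₁.natDegree ≤ g ∧ F₂.natDegree ≤ g ∧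
      F.coeff 0 = 2 ∧ F₁.coeff 0 = 0 ∧ F₂.coeff 0 = 0 ∧
      F.roots = Multiset.map w.xi Finset.univ.val ∧ (∀ i, F₁.eval (w.xi i) = -w.y i) ∧
      quadPoly (-F.coeff 1) F F₁ F₂ = curvePoly w.1 := by
  set P : Polynomial ℂ := ∏ i, (Polynomial.X - Polynomial.C (w.xi i)) with hP
  have hP0 : P.coeff 0 ≠ 0 := by
    rw [Polynomial.coeff_zero_eq_eval_zero, hP, Polynomial.eval_prod]
    exact Finset.prod_ne_zero_iff.2 fun i _ => by simpa using w.xi_ne_zero i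
  set c := 2 / P.coeff 0 with hc
  -- The scalar `c` normalizes the constant term of `F` to `2`; it exists because no `ξᵢ` is zero.
  have hc0 : c ≠ 0 := div_ne_zero two_ne_zero hP0
  set F := Polynomial.C c * P with hF
  have hPd : P.natDegree = g := by
    rw [hP, Polynomial.natDegree_prod_of_monic _ _ fun i _ => Polynomial.monic_X_sub_C _]
    simp
  have hFd : F.natDegree = g := by rw [hF, Polynomial.natDegree_C_mul hc0, hPd]
  have hF0 : F.coeff 0 = 2 := by rw [hF, Polynomial.coeff_C_mul, hc, div_mul_cancel₀ _ hP0]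
  have hFr : F.roots = Multiset.map w.xi Finset.univ.val := by
    rw [hF, Polynomial.roots_C_mul _ hc0, hP]
    refine Eq.trans ?_ (Polynomial.roots_multiset_prod_X_sub_C (Multiset.map w.xi Finset.univ.val))
    rw [Multiset.map_map]
    rfl
  have hFe : ∀ i, F.eval (w.xi i) = 0 := fun i => by
    rw [hF, Polynomial.eval_mul, hP, Polynomial.eval_prod,
      Finset.prod_eq_zero (Finset.mem_univ i) (by simp), mul_zero]
  -- `F₁` must vanish at `0` and take the values `-yᵢ`, so `F₁ / X` is interpolated.
  set I := Lagrange.interpolate Finset.univ w.xi fun i => -w.y i * (w.xi i)⁻¹ with hI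
  have hinj : Set.InjOn w.xi (Finset.univ : Finset (Fin g)) := hw.injOn
  set F₁ := Polynomial.X * I with hF₁
  have hF₁e : ∀ i, F₁.eval (w.xi i) = -w.y i := fun i => by
    rw [hF₁, Polynomial.eval_mul, Polynomial.eval_X, hI,
      Lagrange.eval_interpolate_at_node _ hinj (Finset.mem_univ i)]
    field_simp [w.xi_ne_zero i]
  have hF₁d : F₁.natDegree ≤ g := by
    have h1 : I.degree < ((Finset.univ : Finset (Fin g)).card : ℕ) :=
      Lagrange.degree_interpolate_lt (fun i => -w.y i * (w.xi i)⁻¹) hinj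
    rw [Finset.card_univ, Fintype.card_fin] at h1
    have h2 : I.natDegree < g := by
      by_cases h : I = 0
      · rw [h, Polynomial.natDegree_zero]; omega
      · exact (Polynomial.natDegree_lt_iff_degree_lt h).2 h1
    refine Polynomial.natDegree_mul_le.trans ?_
    rw [Polynomial.natDegree_X]
    omega
  have hF₁0 : F₁.coeff 0 = 0 := by rw [hF₁, Polynomial.coeff_X_mul_zero]
  -- The defect without `F₂`. It is divisible by `X²`, where the choice `u = -F.coeff 1` kills the
  -- linear term, and by `P`, because the points lie on the curve.
  set E := quadPoly (-F.coeff 1) F F₁ 0 - curvePoly w.1 with hE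
  have hE0 : E.coeff 0 = 0 := by
    rw [hE, Polynomial.coeff_sub, coeff_quadPoly_zero, hF0, coeff_curvePoly, if_pos rfl]
    norm_num
  have hE1 : E.coeff 1 = 0 := by
    rw [hE, Polynomial.coeff_sub, coeff_quadPoly_one, hF0, hF₁0, coeff_curvePoly,
      if_neg one_ne_zero, dif_neg (by omega), Polynomial.coeff_zero]
    ring
  have hX : Polynomial.X ^ 2 ∣ E := Polynomial.X_pow_dvd_iff.2 fun d hd => by
    interval_cases d
    · exact hE0
    · exact hE1
  have hPE : P ∣ E := by
    refine Finset.prod_dvd_of_coprime (fun i _ j _ hij =>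
      Polynomial.pairwise_coprime_X_sub_C hw hij) fun i _ => ?_
    rw [Polynomial.dvd_iff_isRoot, Polynomial.IsRoot, hE, Polynomial.eval_sub,
      eval_curvePoly _ (w.xi_ne_zero i), ← w.y_sq, quadPoly]
    simp only [Polynomial.eval_add, Polynomial.eval_mul, Polynomial.eval_sub, Polynomial.eval_pow,
      hFe, hF₁e, Polynomial.eval_X, Polynomial.eval_zero]
    ring
  have hcop : IsCoprime (Polynomial.X ^ 2) P := by
    refine IsCoprime.pow_left (IsCoprime.prod_right fun i _ => ?_)
    have := Polynomial.isCoprime_X_sub_C_of_isUnit_sub (R := ℂ) (a := 0) (b := w.xi i)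
      (by simpa using w.xi_ne_zero i)
    simpa using this
  obtain ⟨h, hh⟩ := hcop.mul_dvd hX hPE
  have hhd : h = 0 ∨ h.natDegree + 1 ≤ g := by
    by_cases h0 : h = 0
    · exact Or.inl h0
    · right
      have hPne : P ≠ 0 := fun hz => hP0 (by rw [hz, Polynomial.coeff_zero])
      have h1 : E.natDegree = 2 + g + h.natDegree := by
        rw [hh, Polynomial.natDegree_mul (mul_ne_zero (pow_ne_zero _ Polynomial.X_ne_zero) hPne) h0,
          Polynomial.natDegree_mul (pow_ne_zero _ Polynomial.X_ne_zero) hPne,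
          Polynomial.natDegree_X_pow, hPd]
      have h2 : E.natDegree ≤ 2 * g + 1 := by
        rw [hE]
        refine (Polynomial.natDegree_sub_le _ _).trans (max_le (natDegree_quadPoly_le hFd.le hF₁d
          (by simp)) (Polynomial.natDegree_le_iff_coeff_eq_zero.2 fun n hn => ?_))
        rw [coeff_curvePoly, if_neg (by omega), dif_neg (by omega)]
      omega
  -- `F₂` enters through `-2 X F F₂` with `F = c P`, so this choice cancels the defect `X² P h`. Its
  -- degree is at most `g` because that of the defect is at most `2g + 1`.
  refine ⟨F, F₁, Polynomial.C (c⁻¹ / 2) * (Polynomial.X * h), hFd, hF₁d, ?_, hF0, hF₁0, ?_, hFr,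
    hF₁e, ?_⟩
  · rcases hhd with h0 | h0
    · simp [h0]
    · refine (Polynomial.natDegree_C_mul_le _ _).trans (Polynomial.natDegree_mul_le.trans ?_)
      rw [Polynomial.natDegree_X]
      omega
  · rw [Polynomial.coeff_C_mul, Polynomial.coeff_X_mul_zero, mul_zero]
  · have h1 : quadPoly (-F.coeff 1) F F₁ (Polynomial.C (c⁻¹ / 2) * (Polynomial.X * h)) =
        quadPoly (-F.coeff 1) F F₁ 0 -
          (Polynomial.C 2 * Polynomial.C c * Polynomial.C (c⁻¹ / 2)) *
            (Polynomial.X ^ 2 * P * h) := by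
      rw [quadPoly, quadPoly, hF, show (Polynomial.C 2 : Polynomial ℂ) = 2 from map_ofNat _ 2]
      ring
    have h2 : (2 : ℂ) * c * (c⁻¹ / 2) = 1 := by field_simp
    rw [h1, ← map_mul, ← map_mul, h2, map_one, one_mul, ← hh, hE]
    ring

/-- Points on a curve with distinct `ξ`-coordinates come from a solution. -/
lemma exists_isUpsilon {g : ℕ} (hg : 1 ≤ g) {t : SymFamily g} (ht : symDisc t ≠ 0) :
    ∃ s : SolutionSpace g, IsUpsilon s t ∧ leadCoef s ≠ 0 := by
  obtain ⟨w, rfl⟩ : ∃ w : PowerFamily g, w.toSym = t :=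
    ⟨_, (PowerFamily.exists_toSym_eq t).choose_spec⟩
  obtain ⟨F, F₁, F₂, hFd, hF₁d, hF₂d, hF0, hF₁0, hF₂0, hFr, hF₁e, hq⟩ :=
    exists_quadPoly_eq hg w ((symDisc_toSym_ne_zero_iff w).1 ht)
  -- The signs reflect `F = 2 - 𝐮`, `F₁ = -𝐮'`, `F₂ = -𝐮''`.
  obtain ⟨U, hU, hv, hl⟩ := exists_lenard_solution hg
    fun | 0, i => -F.coeff i | 1, i => -F₁.coeff i | _, i => -F₂.coeff i
  have hgen : ∀ (a : ℂ) (V v : ℕ → ℂ), (∀ i ∈ Finset.Icc 1 g, V i = v i) →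
      genPoly g a V = genPoly g a v := fun a V v h => by
    rw [genPoly, genPoly, Finset.sum_congr rfl fun i hi => by rw [h i hi]]
  have g0 : (genPoly g 2 fun n => U n 0) = F :=
    (hgen _ _ _ fun i hi => hv i hi 0 (by omega)).trans (genPoly_eq hF0 hFd.le)
  have g1 : (genPoly g 0 fun n => deriv (U n) 0) = F₁ :=
    (hgen _ _ _ fun i hi => hv i hi 1 (by omega)).trans (genPoly_eq hF₁0 hF₁d)
  have g2 : (genPoly g 0 fun n => deriv (deriv (U n)) 0) = F₂ :=
    (hgen _ _ _ fun i hi => hv i hi 2 (by omega)).trans (genPoly_eq hF₂0 hF₂d)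
  have hU1 : U 1 0 = -F.coeff 1 := hv 1 (Finset.mem_Icc.2 ⟨le_rfl, hg⟩) 0 (by omega)
  obtain ⟨s, hs⟩ := exists_isAssociated_of_lenard hg (μ := w.1) hU hl (by
    rw [quadF_genCoeff, g0, g1, g2, hU1, hq])
  refine ⟨s, ⟨U, hs, ?_, ?_⟩, ?_⟩
  · rw [rootPoly_eq, g0, hFr]
    exact w.map_xi
  · intro p hp
    have hp' : p ∈ Multiset.map w.2 Finset.univ.val := hp
    obtain ⟨i, -, rfl⟩ := Multiset.mem_map.1 hp'
    have h1 := hF₁e i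
    rw [← g1, eval_genPoly, zero_sub] at h1
    exact (neg_injective h1).symm
  · have h1 := ((isAssociated_sol hg s).unique hg hs).2 g (Finset.mem_Icc.2 ⟨hg, le_rfl⟩)
    rw [leadCoef, h1.self_of_nhds]
    have h2 := hv g (Finset.mem_Icc.2 ⟨hg, le_rfl⟩) 0 (by omega)
    refine ne_of_eq_of_ne h2 (neg_ne_zero.2 ?_)
    show F.coeff g ≠ 0
    rw [← hFd]
    exact Polynomial.leadingCoeff_ne_zero.2 fun h => by rw [h] at hF0; simp at hF0

/-! ### The Taylor coefficients of a flow -/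

lemma hasDerivAt_eval_flow {σ : Type*} {V : σ → MvPolynomial σ ℂ} {y : ℂ → σ → ℂ} {x : ℂ}
    (hy : ∀ i, HasDerivAt (fun x => y x i) (MvPolynomial.eval (y x) (V i)) x)
    (p : MvPolynomial σ ℂ) : HasDerivAt (fun x => MvPolynomial.eval (y x) p)
      (MvPolynomial.eval (y x) (MvPolynomial.mkDerivation ℂ V p)) x := by
  induction p using MvPolynomial.induction_on with
  | C a => simpa [MvPolynomial.derivation_C] using hasDerivAt_const x a
  | add p q hp hq => simpa using hp.fun_add hq
  | mul_X p i hp =>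
    simp only [map_mul, MvPolynomial.eval_X]
    refine (hp.fun_mul (hy i)).congr_deriv ?_
    simp only [map_mul, MvPolynomial.eval_X, Derivation.leibniz, MvPolynomial.mkDerivation_X,
      smul_eq_mul, map_add]
    ring

lemma iterate_deriv_eval_flow {σ : Type*} {V : σ → MvPolynomial σ ℂ} {y : ℂ → σ → ℂ}
    (hy : ∀ᶠ x in 𝓝 0, ∀ i, HasDerivAt (fun x => y x i) (MvPolynomial.eval (y x) (V i)) x)
    (p : MvPolynomial σ ℂ) (n : ℕ) : deriv^[n] (fun x => MvPolynomial.eval (y x) p) =ᶠ[𝓝 0]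
      fun x => MvPolynomial.eval (y x) ((MvPolynomial.mkDerivation ℂ V)^[n] p) := by
  induction n with
  | zero => exact EventuallyEq.rfl
  | succ n ih =>
    rw [Function.iterate_succ_apply', Function.iterate_succ_apply']
    exact ih.deriv.trans (hy.mono fun x hx => (hasDerivAt_eval_flow hx _).deriv)

lemma hasDerivAt_jetVec_solU {g : ℕ} (hg : 1 ≤ g) (s : SolutionSpace g) :
    ∀ᶠ x in 𝓝 0, ∀ p, HasDerivAt (fun x => jetVec g (solU s) x p)
      (MvPolynomial.eval (jetVec g (solU s) x) (lenardField g p)) x := by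
  filter_upwards [solvesStationaryKdV_iff.1 (solvesStationaryKdV_solFun s),
    (analyticAt_solFun s).eventually_analyticAt] with x hx hfx
  have hl := (lenardF_genCoeff_eq_zero_iff hg).1 (lenardF_resolventU_eq_zero hg hfx hx)
  have ha : ∀ i, AnalyticAt ℂ (solU s i) x := fun i => analyticAt_resolventU s.a hfx i
  rintro ⟨j, k⟩
  obtain rfl | rfl | rfl : k = 0 ∨ k = 1 ∨ k = 2 := by fin_cases k <;> simp
  · refine (ha (j + 1)).differentiableAt.hasDerivAt.congr_deriv ?_
    exact (eval_jetVar j.2 1 (jetVec g (solU s) x)).symm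
  · refine (ha (j + 1)).deriv.differentiableAt.hasDerivAt.congr_deriv ?_
    exact (eval_jetVar j.2 2 (jetVec g (solU s) x)).symm
  · exact (ha (j + 1)).deriv.deriv.differentiableAt.hasDerivAt.congr_deriv (hl j)

/-- `u = u₁` is a coordinate of the flow of `lenardField`, so each Taylor coefficient is a universal
polynomial in the initial values of `u_j, u_j', u_j''`. -/
lemma germDeriv_eq_eval {g : ℕ} (hg : 1 ≤ g) (s : SolutionSpace g) (n : ℕ) :
    germDeriv n s.u = MvPolynomial.eval (jetVec g (solU s) 0)
      ((MvPolynomial.mkDerivation ℂ (lenardField g))^[n] (MvPolynomial.X (⟨0, hg⟩, 0))) := by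
  refine Eq.trans ?_ (iterate_deriv_eval_flow (hasDerivAt_jetVec_solU hg s) _ n).self_of_nhds
  have h : (fun x => MvPolynomial.eval (jetVec g (solU s) x)
      (MvPolynomial.X ((⟨0, hg⟩, 0) : Fin g × Fin 3))) = solFun s := by
    funext x
    rw [MvPolynomial.eval_X]
    exact congrFun (resolventU_one s.a (solFun s)) x
  rw [h, ← iteratedDeriv_eq_iterate, ← coe_solFun s]
  rfl

/-! ### Solving for the solution that belongs to given points -/

section Solve

variable {X : Type} {A : Subalgebra ℂ (X → ℂ)} {g : ℕ}

/-- Cramer's rule: dividing the `i`-th equation by `ξᵢ` turns the system, whose exponents run from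
`1` to `g`, into a Vandermonde system. -/
lemma vandermonde_solve_mem {ξ : X → Fin g → ℂ} (hξ : ∀ i, (fun x => ξ x i) ∈ A)
    (hξi : ∀ i, (fun x => (ξ x i)⁻¹) ∈ A) (hξ0 : ∀ x i, ξ x i ≠ 0)
    (hdet : ∀ x, (Matrix.vandermonde (ξ x)).det ≠ 0)
    (hd : (fun x => (Matrix.vandermonde (ξ x)).det⁻¹) ∈ A) {v : X → ℕ → ℂ}
    (hv : ∀ i, (fun x => ∑ k ∈ Finset.Icc 1 g, v x k * ξ x i ^ k) ∈ A) {k : ℕ} (h1 : 1 ≤ k)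
    (hk : k ≤ g) : (fun x => v x k) ∈ A := by
  have hadj : ∀ i j, (fun x => (Matrix.vandermonde (ξ x)).adjugate i j) ∈ A := fun i j => by
    simp only [Matrix.adjugate_apply]
    refine fun_det_mem fun a b => ?_
    by_cases ha : a = j
    · subst ha
      simp only [Matrix.updateRow_self]
      exact const_mem _ _
    · simp only [Matrix.updateRow_ne ha, Matrix.vandermonde_apply]
      exact fun_pow_mem (hξ a) _
  have key : (fun x => v x k) = fun x => (Matrix.vandermonde (ξ x)).det⁻¹ *
      ∑ i, (Matrix.vandermonde (ξ x)).adjugate ⟨k - 1, by omega⟩ i *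
        ((ξ x i)⁻¹ * ∑ k ∈ Finset.Icc 1 g, v x k * ξ x i ^ k) := by
    funext x
    have hm : (fun i => (ξ x i)⁻¹ * ∑ k ∈ Finset.Icc 1 g, v x k * ξ x i ^ k) =
        (Matrix.vandermonde (ξ x)).mulVec fun l : Fin g => v x (l + 1) := by
      funext i
      have hs : ∑ k ∈ Finset.Icc 1 g, v x k * ξ x i ^ k =
          ∑ l : Fin g, v x (l + 1) * ξ x i ^ ((l : ℕ) + 1) := by
        rw [← Finset.sum_range fun l => v x (l + 1) * ξ x i ^ (l + 1),
          ← Finset.Ico_succ_right_eq_Icc, Finset.sum_Ico_eq_sum_range]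
        exact Finset.sum_congr rfl fun l _ => by rw [add_comm]
      rw [hs, Matrix.mulVec, dotProduct, Finset.mul_sum]
      refine Finset.sum_congr rfl fun l _ => ?_
      rw [Matrix.vandermonde_apply, pow_succ]
      field_simp [hξ0 x i]
    have h2 := congrArg (fun M => Matrix.mulVec M fun l : Fin g => v x (l + 1))
      (Matrix.adjugate_mul (Matrix.vandermonde (ξ x)))
    simp only [← Matrix.mulVec_mulVec, Matrix.smul_mulVec, Matrix.one_mulVec] at h2
    have h3 := congrFun h2 ⟨k - 1, by omega⟩
    rw [← hm, Matrix.mulVec, dotProduct, Pi.smul_apply, smul_eq_mul] at h3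
    rw [h3, inv_mul_cancel_left₀ (hdet x)]
    congr 1
    simp only
    omega
  rw [key]
  exact fun_mul_mem hd (fun_sum_mem fun i _ => fun_mul_mem (hadj _ i) (fun_mul_mem (hξi i) (hv i)))

/-- `F₂` occurs linearly, through `-2 ξ F F₂`. As `F` has constant term `2`, the coefficient of
index `n + 1` contains `-4` times the `n`-th coefficient of `F₂` and otherwise only earlier ones. -/
lemma coeff_quad_solve_mem {u : X → ℂ} {F F₁ F₂ : X → PowerSeries ℂ} (hu : u ∈ A)
    (hF : ∀ n, (fun x => PowerSeries.coeff n (F x)) ∈ A)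
    (hF0 : ∀ x, PowerSeries.coeff 0 (F x) = 2)
    (hF₁ : ∀ n, (fun x => PowerSeries.coeff n (F₁ x)) ∈ A)
    (hQ : ∀ n, (fun x => PowerSeries.coeff n (quad (u x) (F x) (F₁ x) (F₂ x))) ∈ A) (n : ℕ) :
    (fun x => PowerSeries.coeff n (F₂ x)) ∈ A := by
  induction n using Nat.strong_induction_on with
  | _ n ih =>
    have key : (fun x => PowerSeries.coeff n (F₂ x)) = fun x => (1 / 4) *
        (PowerSeries.coeff (n + 1) (quad (u x) (F x) (F₁ x) 0) -
          PowerSeries.coeff (n + 1) (quad (u x) (F x) (F₁ x) (F₂ x)) -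
          2 * ∑ i ∈ Finset.range n,
            PowerSeries.coeff (i + 1) (F x) * PowerSeries.coeff (n - (i + 1)) (F₂ x)) := by
      funext x
      have h : PowerSeries.coeff (n + 1) (quad (u x) (F x) (F₁ x) (F₂ x)) =
          PowerSeries.coeff (n + 1) (quad (u x) (F x) (F₁ x) 0) -
            2 * ∑ i ∈ Finset.range (n + 1),
              PowerSeries.coeff i (F x) * PowerSeries.coeff (n - i) (F₂ x) := by
        rw [coeff_quad_succ, coeff_quad_succ, add_sub_assoc, Finset.mul_sum _ _ (2 : ℂ),
          ← Finset.sum_sub_distrib]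
        congr 1
        refine Finset.sum_congr rfl fun i _ => ?_
        rw [map_zero]
        ring
      rw [Finset.sum_range_succ', hF0, Nat.sub_zero] at h
      rw [h]
      ring
    rw [key]
    refine fun_const_mul_mem _ (fun_sub_mem (fun_sub_mem (fun_coeff_quad_mem hu hF hF₁
      (fun n => ?_) _) (hQ _)) (fun_const_mul_mem _ (fun_sum_mem fun i hi =>
        fun_mul_mem (hF _) (ih _ ?_))))
    · simp only [map_zero]
      exact const_mem _ _
    · have := Finset.mem_range.1 hi
      omega

lemma coeff_phi_solve_mem {a : X → Fin (g - 1) → ℂ}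
    (h : ∀ n < g, (fun x => PowerSeries.coeff (n + 1) (16 * phi g (a x) ^ 2)) ∈ A) (n : ℕ) :
    (fun x => PowerSeries.coeff n (phi g (a x))) ∈ A := by
  induction n using Nat.strong_induction_on with
  | _ n ih =>
    cases n with
    | zero =>
      simp only [coeff_phi_zero]
      exact const_mem _ _
    | succ n =>
      by_cases hn : n < g
      · have key : (fun x => PowerSeries.coeff (n + 1) (phi g (a x))) = fun x => (1 / 2) *
            (1 / 16 * PowerSeries.coeff (n + 1) (16 * phi g (a x) ^ 2) -
              ∑ i ∈ Finset.range n, PowerSeries.coeff (i + 1) (phi g (a x)) *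
                PowerSeries.coeff (n - i) (phi g (a x))) := by
          funext x
          rw [coeff_sixteen_mul, coeff_sq_succ, coeff_phi_zero]
          ring
        rw [key]
        refine fun_const_mul_mem _ (fun_sub_mem (fun_const_mul_mem _ (h n hn)) (fun_sum_mem
          fun i hi => fun_mul_mem (ih _ ?_) (ih _ ?_)))
        all_goals
          have := Finset.mem_range.1 hi
          omega
      · simp only [coeff_phi_of_lt (show g < n + 1 by omega)]
        exact const_mem _ _

end Solve

/-- Pairs of a solution and a numbering of the points that belong to it, where the points have
distinct `ξ`-coordinates. -/
def UpsilonPair (g : ℕ) : Type :=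
  {p : PowerFamily g × SolutionSpace g // symDisc p.1.toSym ≠ 0 ∧ IsUpsilon p.2 p.1.toSym}

/-- The points of a pair. -/
def UpsilonPair.points {g : ℕ} (x : UpsilonPair g) : PowerFamily g := x.1.1

/-- The solution of a pair. -/
def UpsilonPair.sol {g : ℕ} (x : UpsilonPair g) : SolutionSpace g := x.1.2

/-- The functions of a pair that are regular functions of the points. -/
def pairRing (g : ℕ) : Subalgebra ℂ (UpsilonPair g → ℂ) :=
  (locAlg (powerRing g) _ (symDisc_toSym_mem g)).map
    (AlgHom.pi fun x : UpsilonPair g => Pi.evalAlgHom ℂ (fun _ : PowerFamily g => ℂ) x.points)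

/-- On pairs no inverse of `υ` has to be chosen. Membership of a function of the solution says that
it depends on the points alone, which gives injectivity of `υ`, and that it does so regularly, which
gives regularity of the inverse. -/
lemma mem_pairRing_iff {g : ℕ} {h : UpsilonPair g → ℂ} : h ∈ pairRing g ↔
    ∃ f ∈ locAlg (powerRing g) _ (symDisc_toSym_mem g), ∀ x : UpsilonPair g, h x = f x.points := by
  rw [pairRing, Subalgebra.mem_map]
  exact ⟨fun ⟨f, hf, hx⟩ => ⟨f, hf, fun x => (congrFun hx x).symm⟩,
    fun ⟨f, hf, hx⟩ => ⟨f, hf, funext fun x => (hx x).symm⟩⟩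

lemma points_mem_pairRing {g : ℕ} {f : PowerFamily g → ℂ} (hf : f ∈ powerRing g) :
    (fun x : UpsilonPair g => f x.points) ∈ pairRing g :=
  mem_pairRing_iff.2 ⟨f, mem_locAlg_of_mem hf, fun _ => rfl⟩

lemma UpsilonPair.det_ne_zero {g : ℕ} (x : UpsilonPair g) :
    (Matrix.vandermonde x.points.xi).det ≠ 0 := fun h =>
  x.2.1 ((symDisc_toSym x.points).trans (by rw [h]; norm_num))

lemma det_inv_mem_pairRing (g : ℕ) :
    (fun x : UpsilonPair g => (Matrix.vandermonde x.points.xi).det⁻¹) ∈ pairRing g := by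
  refine mem_pairRing_iff.2 ⟨fun w => (Matrix.vandermonde w.xi).det * (symDisc w.toSym)⁻¹,
    fun_mul_mem (mem_locAlg_of_mem (fun_det_mem fun i j => fun_pow_mem (xi_mem_powerRing i) _))
    inv_mem_locAlg, fun x => ?_⟩
  show _ = (Matrix.vandermonde x.points.xi).det * (symDisc x.points.toSym)⁻¹
  rw [symDisc_toSym, pow_two, mul_inv, mul_inv_cancel_left₀ x.det_ne_zero]

lemma UpsilonPair.spec {g : ℕ} (hg : 1 ≤ g) (x : UpsilonPair g) :
    x.points.1 = solMu x.sol ∧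
    (∀ i, ∑ k ∈ Finset.Icc 1 g, solU x.sol k 0 * x.points.xi i ^ k = 2) ∧
    ∀ i, ∑ k ∈ Finset.Icc 1 g, deriv (solU x.sol k) 0 * x.points.xi i ^ k = x.points.y i := by
  obtain ⟨h1, h2, h3⟩ := (isAssociated_sol hg x.sol).isUpsilon_unique hg x.2.2
  refine ⟨h1, fun i => ?_, fun i => ?_⟩
  · have hi : x.points.xi i ∈ (rootPoly g (solU x.sol)).roots := by
      rw [← h2]
      refine (Multiset.ext.1 x.points.map_xi _ ▸ Multiset.count_pos.2 ?_ : 0 < _) |>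
        Multiset.count_pos.1
      exact Multiset.mem_map_of_mem _ (Finset.mem_univ_val i)
    have h4 : (rootPoly g (solU x.sol)).eval (x.points.xi i) = 0 := (Polynomial.mem_roots'.1 hi).2
    rw [rootPoly_eq, eval_genPoly] at h4
    exact (sub_eq_zero.1 h4).symm
  · exact (h3 (x.points.2 i) (Multiset.mem_map_of_mem x.points.2 (Finset.mem_univ_val i))).symm

lemma solMu_mem_pairRing {g : ℕ} (hg : 1 ≤ g) (i : Fin (2 * g)) :
    (fun x : UpsilonPair g => solMu x.sol i) ∈ pairRing g := by
  simp only [← (UpsilonPair.spec hg _).1]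
  exact points_mem_pairRing (mu_mem_powerRing i)

lemma coeff_curvePoly_mem {X : Type} {A : Subalgebra ℂ (X → ℂ)} {g : ℕ} {μ : X → CurveSpace g}
    (hμ : ∀ i, (fun x => μ x i) ∈ A) (n : ℕ) : (fun x => (curvePoly (μ x)).coeff n) ∈ A := by
  simp only [coeff_curvePoly]
  split_ifs
  · exact const_mem _ _
  · exact fun_const_mul_mem _ (hμ _)
  · exact const_mem _ _

lemma solve_mem_pairRing {g : ℕ} {v : UpsilonPair g → ℕ → ℂ}
    (hv : ∀ i, (fun x => ∑ k ∈ Finset.Icc 1 g, v x k * x.points.xi i ^ k) ∈ pairRing g) {i : ℕ}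
    (h1 : 1 ≤ i) (hi : i ≤ g) : (fun x => v x i) ∈ pairRing g :=
  vandermonde_solve_mem (fun i => points_mem_pairRing (xi_mem_powerRing i))
    (fun i => points_mem_pairRing (xi_inv_mem_powerRing i)) (fun x => x.points.xi_ne_zero)
    (fun x => x.det_ne_zero) (det_inv_mem_pairRing g) hv h1 hi

lemma solU_mem_pairRing {g : ℕ} (hg : 1 ≤ g) {i : ℕ} (h1 : 1 ≤ i) (hi : i ≤ g) :
    (fun x : UpsilonPair g => solU x.sol i 0) ∈ pairRing g := by
  refine solve_mem_pairRing (v := fun x i => solU x.sol i 0) (fun j => ?_) h1 hi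
  simp only [fun x : UpsilonPair g => (x.spec hg).2.1 j]
  exact const_mem _ _

lemma deriv_solU_mem_pairRing {g : ℕ} (hg : 1 ≤ g) {i : ℕ} (h1 : 1 ≤ i) (hi : i ≤ g) :
    (fun x : UpsilonPair g => deriv (solU x.sol i) 0) ∈ pairRing g := by
  refine solve_mem_pairRing (v := fun x i => deriv (solU x.sol i) 0) (fun j => ?_) h1 hi
  simp only [fun x : UpsilonPair g => (x.spec hg).2.2 j]
  exact points_mem_pairRing (y_mem_powerRing j)

lemma coeff_coe_genPoly_mem {X : Type} {A : Subalgebra ℂ (X → ℂ)} {g : ℕ} {v : X → ℕ → ℂ}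
    (hv : ∀ {i}, 1 ≤ i → i ≤ g → (fun x => v x i) ∈ A) (a : ℂ) (n : ℕ) :
    (fun x => PowerSeries.coeff n (genPoly g a (v x) : PowerSeries ℂ)) ∈ A := by
  simp only [Polynomial.coeff_coe, coeff_genPoly]
  split_ifs with h1 h2
  · exact const_mem _ _
  · exact fun_neg_mem (hv (by omega) h2)
  · exact const_mem _ _

lemma deriv_deriv_solU_mem_pairRing {g : ℕ} (hg : 1 ≤ g) {i : ℕ} (h1 : 1 ≤ i) (hi : i ≤ g) :
    (fun x : UpsilonPair g => deriv (deriv (solU x.sol i)) 0) ∈ pairRing g := by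
  have h2 : (fun x : UpsilonPair g => PowerSeries.coeff i
      (genPoly g 0 (fun n => deriv (deriv (solU x.sol n)) 0) : PowerSeries ℂ)) ∈ pairRing g := by
    refine coeff_quad_solve_mem (solU_mem_pairRing hg le_rfl hg)
      (F := fun x : UpsilonPair g => (genPoly g 2 (fun n => solU x.sol n 0) : PowerSeries ℂ))
      (F₁ := fun x : UpsilonPair g =>
        (genPoly g 0 (fun n => deriv (solU x.sol n) 0) : PowerSeries ℂ))
      (coeff_coe_genPoly_mem (solU_mem_pairRing hg) 2) (fun x => ?_)
      (coeff_coe_genPoly_mem (deriv_solU_mem_pairRing hg) 0) (fun n => ?_) i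
    · rw [Polynomial.coeff_coe, coeff_genPoly, if_pos rfl]
    · have h3 := coeff_curvePoly_mem (solMu_mem_pairRing hg) n
      simp only [fun x : UpsilonPair g => (isAssociated_sol hg x.sol).curvePoly_eq] at h3
      simpa only [← coe_quadPoly, Polynomial.coeff_coe] using h3
  simp only [Polynomial.coeff_coe, coeff_genPoly, if_neg (show i ≠ 0 by omega), if_pos hi] at h2
  simpa only [neg_neg] using fun_neg_mem h2

/-- The coordinates of a solution are regular functions of the points. -/
lemma coords_mem_pairRing {g : ℕ} (hg : 1 ≤ g) (i : Fin (2 * g + 1) ⊕ Fin (g - 1)) :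
    (fun x : UpsilonPair g => x.sol.coords i) ∈ pairRing g := by
  rcases i with n | k
  · have h : (fun x : UpsilonPair g => x.sol.coords (Sum.inl n)) = fun x : UpsilonPair g =>
        MvPolynomial.eval (jetVec g (solU x.sol) 0) ((MvPolynomial.mkDerivation ℂ
          (lenardField g))^[(n : ℕ)] (MvPolynomial.X (⟨0, hg⟩, 0))) :=
      funext fun x => germDeriv_eq_eval hg x.sol n
    rw [h]
    refine fun_eval_mem (fun p => ?_) _
    obtain ⟨j, k⟩ := p
    have h1 : 1 ≤ (j : ℕ) + 1 := by omega
    obtain rfl | rfl | rfl : k = 0 ∨ k = 1 ∨ k = 2 := by fin_cases k <;> simp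
    · exact solU_mem_pairRing hg h1 j.2
    · exact deriv_solU_mem_pairRing hg h1 j.2
    · exact deriv_deriv_solU_mem_pairRing hg h1 j.2
  · have h := coeff_phi_solve_mem (A := pairRing g) (a := fun x : UpsilonPair g => x.sol.a)
      (fun n hn => by
        simp only [← (constants_iff _ _).1 (isAssociated_sol hg _).constants n hn]
        exact coeff_curvePoly_mem (solMu_mem_pairRing hg) _) (g - k)
    have h2 : 2 ≤ g - (k : ℕ) := by have := k.2; omega
    simp only [coeff_phi h2 (Nat.sub_le _ _)] at h
    have h3 : (⟨g - (g - (k : ℕ)), by omega⟩ : Fin (g - 1)) = k :=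
      Fin.ext (by have := k.2; simp only; omega)
    rw [h3] at h
    exact h

/-- A solution is determined by its points, if these have distinct `ξ`-coordinates. -/
lemma IsUpsilon.injective {g : ℕ} (hg : 1 ≤ g) {t : SymFamily g} (ht : symDisc t ≠ 0)
    {s s' : SolutionSpace g} (hs : IsUpsilon s t) (hs' : IsUpsilon s' t) : s = s' := by
  obtain ⟨w, rfl⟩ : ∃ w : PowerFamily g, w.toSym = t :=
    ⟨_, (PowerFamily.exists_toSym_eq t).choose_spec⟩
  refine (SolutionSpace.coords_bijective g).1 (funext fun i => ?_)
  obtain ⟨f, -, hf⟩ := mem_pairRing_iff.1 (coords_mem_pairRing hg i)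
  exact (hf ⟨(w, s), ht, hs⟩).trans (hf ⟨(w, s'), ht, hs'⟩).symm

/-- A map that is inverse to `υ` off the discriminant is regular there. -/
lemma isRegularOn_comp_of_isUpsilon {g : ℕ} (hg : 1 ≤ g) {S : SymFamily g → SolutionSpace g}
    (hS : ∀ t, symDisc t ≠ 0 → IsUpsilon (S t) t) {f : SolutionSpace g → ℂ}
    (hf : f ∈ SolutionSpace.coordRing g) :
    IsRegularOn (SymFamily.coordRing g) {t | symDisc t ≠ 0} (f ∘ S) := by
  refine isRegularOn_symDisc ?_
  obtain ⟨P, hP⟩ := mem_polyFunctions_iff.1 hf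
  simp only [Function.comp_apply, hP]
  refine fun_eval_mem (fun i => ?_) P
  obtain ⟨h, hh, hx⟩ := mem_pairRing_iff.1 (coords_mem_pairRing hg i)
  exact mem_locAlg_congr hh fun w hw => hx ⟨(w, S w.toSym), hw, hS _ hw⟩

/-! ### Dense open sets -/

/-- The product of two nonzero polynomials over `ℂ` is nonzero and has a nonzero value, attained at
a point of `X` by surjectivity. -/
lemma isZariskiDense_ne_zero {X ι : Type} {coords : X → ι → ℂ} (hc : Function.Surjective coords)
    {q : X → ℂ} (hq : q ∈ polyFunctions coords) {x : X} (hx : q x ≠ 0) :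
    IsZariskiDense (polyFunctions coords) {x | q x ≠ 0} := by
  rintro V ⟨S, hS, rfl⟩ ⟨z, f, hf, hz⟩
  obtain ⟨Q, hQ⟩ := mem_polyFunctions_iff.1 hq
  obtain ⟨P, hP⟩ := mem_polyFunctions_iff.1 (hS hf)
  have hPQ : Q * P ≠ 0 := by
    refine mul_ne_zero (fun h => hx ?_) fun h => hz ?_
    · rw [hQ, h, map_zero]
    · rw [hP, h, map_zero]
  obtain ⟨v, hv⟩ : ∃ v, MvPolynomial.eval v (Q * P) ≠ 0 := by
    by_contra! h
    exact hPQ (MvPolynomial.funext fun v => by rw [h v, map_zero])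
  obtain ⟨y, rfl⟩ := hc v
  rw [map_mul, ← hQ, ← hP] at hv
  exact ⟨y, left_ne_zero_of_mul hv, f, hf, right_ne_zero_of_mul hv⟩

/-- From `(s - y) (s + y) = z - y²`, the root among `±s` nearer to `y` satisfies the bound. It
follows `y` continuously without a branch of the square root, even at `y = 0`. -/
lemma exists_sq_eq_norm_sub_sq_le (z y : ℂ) : ∃ s : ℂ, s ^ 2 = z ∧ ‖s - y‖ ^ 2 ≤ ‖z - y ^ 2‖ := by
  obtain ⟨s, rfl⟩ := IsAlgClosed.exists_pow_nat_eq z (n := 2) (by norm_num)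
  rw [sq_sub_sq, norm_mul]
  rcases le_total ‖s - y‖ ‖s + y‖ with h | h
  · exact ⟨s, rfl, by nlinarith [norm_nonneg (s - y)]⟩
  · refine ⟨-s, by ring, ?_⟩
    rw [← norm_neg (-s - y), neg_sub', neg_neg, sub_neg_eq_add]
    nlinarith [norm_nonneg (s + y)]

lemma continuousAt_muFun {g : ℕ} (μ : CurveSpace g) {ξ : ℂ} (hξ : ξ ≠ 0) :
    ContinuousAt (muFun μ) ξ := by
  have h1 : ContinuousAt (fun ξ : ℂ => ξ⁻¹) ξ := continuousAt_inv₀ hξ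
  have h2 : Continuous fun ξ : ℂ => ∑ i : Fin (2 * g), μ i * ξ ^ ((i : ℕ) + 1) := by fun_prop
  exact (continuousAt_const.mul h1).add h2.continuousAt

lemma eventually_add_mul_ne_zero {a b : ℂ} (h : a ≠ 0 ∨ b ≠ 0) :
    ∀ᶠ ε in 𝓝[≠] (0 : ℂ), a + ε * b ≠ 0 := by
  by_cases ha : a = 0
  · filter_upwards [self_mem_nhdsWithin] with ε hε
    rw [ha, zero_add]
    exact mul_ne_zero hε (h.resolve_left (not_not.2 ha))
  · have hc : ContinuousAt (fun ε : ℂ => a + ε * b) 0 := by fun_prop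
    exact (hc.eventually_ne (by simpa using ha)).filter_mono nhdsWithin_le_nhds

/-- The points with distinct `ξ`-coordinates are dense in the family of symmetric powers. -/
lemma isZariskiDense_symDisc (g : ℕ) :
    IsZariskiDense (SymFamily.coordRing g) {t | symDisc t ≠ 0} := by
  rintro V ⟨S, hS, rfl⟩ ⟨t, f, hf, ht⟩
  obtain ⟨w, rfl⟩ : ∃ w : PowerFamily g, w.toSym = t :=
    ⟨_, (PowerFamily.exists_toSym_eq t).choose_spec⟩
  obtain ⟨P, hP⟩ := mem_polyFunctions_iff.1 (mem_symCoordRing_iff.1 (hS hf))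
  -- The points move with different speeds `i + 1`, so coinciding ones separate for small `ε ≠ 0`;
  -- the curve is kept fixed, and `Y` follows the `y`-coordinates along it.
  set ξ : ℂ → Fin g → ℂ := fun ε i => w.xi i + ε * ((i : ℕ) + 1) with hξ
  have hξc : ∀ i, Tendsto (fun ε => ξ ε i) (𝓝[≠] 0) (𝓝 (w.xi i)) := fun i => by
    have : ContinuousAt (fun ε => ξ ε i) 0 := by simp only [hξ]; fun_prop
    simpa [hξ] using this.tendsto.mono_left nhdsWithin_le_nhds
  choose Y hY hYle using fun ε i => exists_sq_eq_norm_sub_sq_le (4 * muFun w.1 (ξ ε i)) (w.y i)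
  have hYc : ∀ i, Tendsto (fun ε => Y ε i) (𝓝[≠] 0) (𝓝 (w.y i)) := fun i => by
    have h1 : Tendsto (fun ε => 4 * muFun w.1 (ξ ε i)) (𝓝[≠] 0) (𝓝 (w.y i ^ 2)) := by
      rw [w.y_sq]
      exact tendsto_const_nhds.mul
        ((continuousAt_muFun w.1 (w.xi_ne_zero i)).tendsto.comp (hξc i))
    have h2 := (tendsto_iff_norm_sub_tendsto_zero.1 h1).sqrt
    rw [Real.sqrt_zero] at h2
    refine tendsto_iff_norm_sub_tendsto_zero.2 (squeeze_zero (fun _ => norm_nonneg _)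
      (fun ε => ?_) h2)
    exact Real.le_sqrt_of_sq_le (hYle ε i)
  set v : ℂ → Fin (2 * g) ⊕ Fin g ⊕ Fin g → ℂ := fun ε =>
    Sum.elim w.1 (Sum.elim (ξ ε) (Y ε)) with hv
  have hvc : Tendsto v (𝓝[≠] 0) (𝓝 w.coords) := by
    refine tendsto_pi_nhds.2 fun i => ?_
    rcases i with i | i | i
    · exact tendsto_const_nhds
    · exact hξc i
    · exact hYc i
  have hne : ∀ᶠ ε in 𝓝[≠] (0 : ℂ), MvPolynomial.eval (v ε) P ≠ 0 := by
    refine ((MvPolynomial.continuous_eval P).continuousAt.tendsto.comp hvc).eventually_ne ?_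
    exact (hP w) ▸ ht
  have hξ0 : ∀ᶠ ε in 𝓝[≠] (0 : ℂ), ∀ i, ξ ε i ≠ 0 :=
    eventually_all.2 fun i => eventually_add_mul_ne_zero (Or.inl (w.xi_ne_zero i))
  have hinj : ∀ᶠ ε in 𝓝[≠] (0 : ℂ), ∀ i j, i ≠ j → ξ ε i ≠ ξ ε j := by
    refine eventually_all.2 fun i => eventually_all.2 fun j => ?_
    by_cases hij : i = j
    · exact Eventually.of_forall fun ε h => absurd hij h
    · have h1 : ((i : ℕ) : ℂ) - (j : ℕ) ≠ 0 :=
        sub_ne_zero.2 fun h => hij (Fin.ext (Nat.cast_injective h))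
      filter_upwards [eventually_add_mul_ne_zero (a := w.xi i - w.xi j) (Or.inr h1)] with ε hε _ h
      refine hε ?_
      simp only [hξ] at h
      linear_combination h
  obtain ⟨ε, h1, h2, h3⟩ := (hne.and (hξ0.and hinj)).exists
  set w' : PowerFamily g := ⟨w.1, fun i => ⟨(ξ ε i, Y ε i), h2 i, hY ε i⟩⟩ with hw'
  refine ⟨w'.toSym, (symDisc_toSym_ne_zero_iff w').2 fun i j hij => ?_, f, hf, ?_⟩
  · by_contra h
    exact h3 i j h hij
  · rw [hP w']
    exact h1

lemma exists_symDisc_ne_zero (g : ℕ) : ∃ t : SymFamily g, symDisc t ≠ 0 := by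
  have h : ∀ i : Fin g, ((i : ℕ) : ℂ) + 1 ≠ 0 := fun i => Nat.cast_add_one_ne_zero _
  choose Y hY using fun i : Fin g => IsAlgClosed.exists_pow_nat_eq
    (4 * muFun (0 : CurveSpace g) ((i : ℕ) + 1)) (n := 2) (by norm_num)
  set w : PowerFamily g := ⟨0, fun i => ⟨(((i : ℕ) : ℂ) + 1, Y i), h i, hY i⟩⟩ with hw
  refine ⟨w.toSym, (symDisc_toSym_ne_zero_iff w).2 fun i j hij => ?_⟩
  have h1 : ((i : ℕ) : ℂ) + 1 = (j : ℕ) + 1 := hij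
  exact Fin.ext (Nat.cast_injective (add_right_cancel h1))

instance (g : ℕ) : Nonempty (SymFamily g) := ⟨(exists_symDisc_ne_zero g).choose⟩

/-! ### The birational equivalence -/

/-- The domain of `υ`, as a birational equivalence: `u_g(0) ≠ 0` and the roots of `2 - 𝐮(0, ξ)`
are distinct. -/
def upsilonSource (g : ℕ) : Set (SolutionSpace g) := {s | leadCoef s ≠ 0 ∧ symDisc (upsilon s) ≠ 0}

lemma upsilonSource_nonempty {g : ℕ} (hg : 1 ≤ g) : (upsilonSource g).Nonempty := by
  obtain ⟨t, ht⟩ := exists_symDisc_ne_zero g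
  obtain ⟨s, hs, h0⟩ := exists_isUpsilon hg ht
  exact ⟨s, h0, (isUpsilon_iff hg h0 t).1 hs ▸ ht⟩

/-- The pullback of the discriminant is `p / u_g(0)ᴺ` where `u_g(0) ≠ 0`, so both conditions
together say that `u_g(0) p` does not vanish. -/
lemma exists_upsilonSource_eq {g : ℕ} (hg : 1 ≤ g) :
    ∃ q ∈ SolutionSpace.coordRing g, upsilonSource g = {s | q s ≠ 0} := by
  obtain ⟨N, p, hp, h⟩ := comp_upsilon_mem hg (symDisc_mem_coordRing g)
  refine ⟨fun s => leadCoef s * p s, fun_mul_mem (leadCoef_mem g) hp, Set.ext fun s => ?_⟩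
  show leadCoef s ≠ 0 ∧ symDisc (upsilon s) ≠ 0 ↔ leadCoef s * p s ≠ 0
  rw [mul_ne_zero_iff, and_congr_right_iff]
  intro hs
  rw [← h s hs, mul_ne_zero_iff, and_iff_left (pow_ne_zero N hs)]

open Classical in
/-- The inverse of `υ` off the discriminant. -/
def upsilonInv {g : ℕ} (hg : 1 ≤ g) (t : SymFamily g) : SolutionSpace g :=
  if h : symDisc t ≠ 0 then (exists_isUpsilon hg h).choose else (upsilonSource_nonempty hg).some

lemma upsilonInv_spec {g : ℕ} (hg : 1 ≤ g) {t : SymFamily g} (h : symDisc t ≠ 0) :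
    IsUpsilon (upsilonInv hg t) t ∧ leadCoef (upsilonInv hg t) ≠ 0 := by
  rw [upsilonInv, dif_pos h]
  exact (exists_isUpsilon hg h).choose_spec

lemma upsilon_upsilonInv {g : ℕ} (hg : 1 ≤ g) {t : SymFamily g} (h : symDisc t ≠ 0) :
    upsilon (upsilonInv hg t) = t :=
  ((isUpsilon_iff hg (upsilonInv_spec hg h).2 t).1 (upsilonInv_spec hg h).1).symm

/-- The map `υ` as a birational equivalence. -/
def upsilonEquiv {g : ℕ} (hg : 1 ≤ g) :
    BirationalEquiv (SolutionSpace.coordRing g) (SymFamily.coordRing g) where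
  toFun := upsilon
  invFun := upsilonInv hg
  source := upsilonSource g
  target := {t | symDisc t ≠ 0}
  map_source' := fun _ hs => hs.2
  map_target' := fun t ht => ⟨(upsilonInv_spec hg ht).2, by rwa [upsilon_upsilonInv hg ht]⟩
  left_inv' := fun s hs => (upsilonInv_spec hg hs.2).1.injective hg hs.2
    ((isUpsilon_iff hg hs.1 _).2 rfl)
  right_inv' := fun _ ht => upsilon_upsilonInv hg ht
  open_source := by
    obtain ⟨q, hq, h⟩ := exists_upsilonSource_eq hg
    rw [h]
    exact isZariskiOpen_ne_zero hq
  dense_source := by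
    obtain ⟨q, hq, h⟩ := exists_upsilonSource_eq hg
    obtain ⟨s, hs⟩ := upsilonSource_nonempty hg
    rw [h] at hs ⊢
    exact isZariskiDense_ne_zero (SolutionSpace.coords_bijective g).2 hq hs
  open_target := isZariskiOpen_ne_zero (symDisc_mem_coordRing g)
  dense_target := isZariskiDense_symDisc g
  regular_toFun := fun _ hf => isRegularOn_of_mem_locAlg (comp_upsilon_mem hg hf) fun _ hs => hs.1
  regular_invFun := fun _ hf =>
    isRegularOn_comp_of_isUpsilon hg (fun _ ht => (upsilonInv_spec hg ht).1) hf

end KdV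

end

theorem mainTheorem9 (g : ℕ) (hg : 1 ≤ g) :
    -- `𝐑_g` is identified with `ℂ^{3g}` by its coordinates
    Function.Bijective (KdV.SolutionSpace.coords (g := g)) ∧
    -- the canonical map `𝐑_g → ℳ_g`
    ∃ projM : KdV.SolutionSpace g → KdV.CurveSpace g,
      (∀ s : KdV.SolutionSpace g, ∃ U, KdV.IsAssociated s U (projM s)) ∧
      (∀ (s : KdV.SolutionSpace g) U V μ ν, KdV.IsAssociated s U μ → KdV.IsAssociated s V ν →
        μ = ν ∧ ∀ i ∈ Finset.Icc 1 g, U i =ᶠ[nhds 0] V i) ∧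
      -- `υ(s)` is defined as soon as `2 - 𝐮(0, ξ)` has degree `g`
      (∀ (s : KdV.SolutionSpace g) U μ, KdV.IsAssociated s U μ → U g 0 ≠ 0 → ∃! t, KdV.IsUpsilon s t) ∧
      -- `υ` is a fiber-preserving birational equivalence
      ∃ Φ : KdV.BirationalEquiv (KdV.SolutionSpace.coordRing g) (KdV.SymFamily.coordRing g),
        (∀ s ∈ Φ.source, ∀ t, KdV.IsUpsilon s t ↔ t = Φ.toFun s) ∧
        (∀ s ∈ Φ.source, (Φ.toFun s).proj = projM s) := by
  refine ⟨KdV.SolutionSpace.coords_bijective g, KdV.solMu,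
    fun s => ⟨_, KdV.isAssociated_sol hg s⟩, fun s U V μ ν hU hV => hU.unique hg hV,
    fun s U μ h h0 => KdV.existsUnique_isUpsilon hg h h0, KdV.upsilonEquiv hg,
    fun s hs t => KdV.isUpsilon_iff hg hs.1 t, fun s hs => ?_⟩
  exact ((KdV.isAssociated_sol hg s).isUpsilon_unique hg
    ((KdV.isUpsilon_iff hg hs.1 _).2 rfl)).1
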